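/- **Theorem (Fefferman metric for path geometries).** Let $(M,L_1,L_2)$ be a path geometry: a smooth 3-manifold $M$ with an ordered pair of smooth line fields $L_1,L_2\subset TM$ spanning a contact distribution $D=L_1\oplus L_2$. Let $SD^*\to M$ be the bundle of rays (with respect to positive dilations) in $D$ not contained in $L_1\cup L_2$, with the $\mathbb R^*$-action $s\cdot[X_1+X_2]=[sX_1+s^{-1}X_2]$ ($X_i\in L_i$) and the involution induced by $J(X_1+X_2)=X_1-X_2$. Let $\eta^3$ be a contact form (a smooth 1-form with kernel $D$) on an open set $U\subseteq M$ (for instance $U=M$, if a global contact form exists). Let $B$ be the set of coframes $u=(u^1,u^2,u^3):T_xM\to\mathbb R^3$, $x\in U$, with $u^3=\eta^3$, $u^1\wedge u^2=d\eta^3$, $u^1|_{L_2}=0$, $u^2|_{L_1}=0$, let $s\in\mathbb R^*$ act on $B$ by $(u^1,u^2,u^3)\mapsto(s^{-1}u^1,su^2,u^3)$, and let $\omega^1,\omega^2,\omega^3$ be the components of the restriction to $B$ of the tautological form $\omega_u=u\circ d\pi_u$, where $\pi:B\to M$ is the projection. 1. $B$ is an $\mathbb R^*$-reduction of the coframe bundle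 of $M$ over $U$. There is a unique $\mathbb R^*$-connection form $\alpha$ on $B$ such that, for some functions $a_1,a_2$, $$d\omega^1=-\alpha\wedge\omega^1+a_1\,\omega^2\wedge\omega^3,\qquad d\omega^2=\alpha\wedge\omega^2+a_2\,\omega^3\wedge\omega^1,\qquad d\omega^3=\omega^1\wedge\omega^2 .$$ There is a unique function $K$ on $B$ such that $d\alpha=b_1\,\omega^2\wedge\omega^3+b_2\,\omega^3\wedge\omega^1+K\,\omega^1\wedge\omega^2$ for some functions $b_1,b_2$. 2. With $\sigma=-\tfrac23\alpha+\tfrac16K\omega^3$, the symmetric form $g=\omega^1\cdot\omega^2+\omega^3\cdot\sigma$ is a smooth pseudo-Riemannian metric of signature $(2,2)$ on $B$. 3. $SD^*|_U$ is the disjoint union of $SD^+$ and $SD^-$, the sets of rays $[X]$ over $U$ with $d\eta^3(JX,X)>0$ and $<0$ respectively. The map $h:B\to SD^+$, $h(u)=[X]$ with $u^1(X)=u^2(X)=1$, $u^3(X)=0$, and the map $J\circ h:B\to SD^-$ are isomorphisms of $\mathbb R^*$-bundles over $U$. Hence there is a unique metric $G_{\eta^3}$ on $SD^*|_U$ with $h^*G_{\eta^3}=(J\circ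 h)^*G_{\eta^3}=g$; it is smooth of signature $(2,2)$. 4. Multiplying $\eta^3$ by a smooth non-vanishing function gives again a contact form and multiplies the induced metric by the same factor: if $\tilde\eta^3=f\eta^3$ where both contact forms are defined, then $G_{\tilde\eta^3}=f\,G_{\eta^3}$ there (with $f$ pulled back to $SD^*$). Consequently there is a unique conformal class of metrics of signature $(2,2)$ on $SD^*$ (a line field in the bundle of bilinear forms on tangent spaces, locally spanned by smooth metrics of signature $(2,2)$) that contains, over the domain of each local contact form $\eta^3$, the metric $G_{\eta^3}$. -/

import Mathlib

open Set Bundle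
open scoped Manifold ContDiff Topology

namespace PathGeom

noncomputable section

/-! ### Calculus of 1-forms on a manifold modelled on a normed space -/

section Forms

variable {V : Type*} [NormedAddCommGroup V] [NormedSpace ℝ V]
  {N : Type*} [TopologicalSpace N] [ChartedSpace V N]
  {V' : Type*} [NormedAddCommGroup V'] [NormedSpace ℝ V']
  {N' : Type*} [TopologicalSpace N'] [ChartedSpace V' N']

variable (V N) in
/-- A (not necessarily smooth) 1-form on the manifold `N`. -/
abbrev OneForm : Type _ := ∀ x : N, TangentSpace 𝓘(ℝ, V) x →L[ℝ] ℝ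

variable (V N) in
/-- A (not necessarily smooth) field of bilinear forms on the tangent spaces of `N`. -/
abbrev BilinField : Type _ :=
  ∀ x : N, TangentSpace 𝓘(ℝ, V) x →L[ℝ] TangentSpace 𝓘(ℝ, V) x →L[ℝ] ℝ

/-- Smoothness of a 1-form on a set, as a section of the cotangent bundle. -/
def OneForm.SmoothOn [IsManifold 𝓘(ℝ, V) ∞ N] (α : OneForm V N) (U : Set N) : Prop :=
  ContMDiffOn 𝓘(ℝ, V) (𝓘(ℝ, V).prod 𝓘(ℝ, V →L[ℝ] ℝ)) ∞
    (fun x ↦ TotalSpace.mk' (V →L[ℝ] ℝ)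
      (E := fun x : N ↦ TangentSpace 𝓘(ℝ, V) x →L[ℝ] Bundle.Trivial N ℝ x) x (α x)) U

/-- Smoothness of a field of bilinear forms on a set. -/
def BilinField.SmoothOn [IsManifold 𝓘(ℝ, V) ∞ N] (g : BilinField V N) (U : Set N) : Prop :=
  ContMDiffOn 𝓘(ℝ, V) (𝓘(ℝ, V).prod 𝓘(ℝ, V →L[ℝ] V →L[ℝ] ℝ)) ∞
    (fun x ↦ TotalSpace.mk' (V →L[ℝ] V →L[ℝ] ℝ)
      (E := fun x : N ↦ TangentSpace 𝓘(ℝ, V) x →L[ℝ] TangentSpace 𝓘(ℝ, V) x →L[ℝ]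
        Bundle.Trivial N ℝ x) x (g x)) U

/-- The 1-form `α` read in the preferred chart at `x`, i.e. its pull-back by the inverse chart. -/
def OneForm.inChart (α : OneForm V N) (x : N) (z : V) : V →L[ℝ] ℝ :=
  (α ((extChartAt 𝓘(ℝ, V) x).symm z)).comp
    (mfderiv 𝓘(ℝ, V) 𝓘(ℝ, V) (extChartAt 𝓘(ℝ, V) x).symm z)

/-- The exterior derivative `dα`, computed in the preferred chart at the point, with the
convention `dα(X,Y) = X(α Y) - Y(α X) - α([X,Y])`. -/
def OneForm.d (α : OneForm V N) (x : N) (v w : TangentSpace 𝓘(ℝ, V) x) : ℝ :=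
  fderiv ℝ (α.inChart x) (extChartAt 𝓘(ℝ, V) x x)
      (mfderiv 𝓘(ℝ, V) 𝓘(ℝ, V) (extChartAt 𝓘(ℝ, V) x) x v)
      (mfderiv 𝓘(ℝ, V) 𝓘(ℝ, V) (extChartAt 𝓘(ℝ, V) x) x w) -
    fderiv ℝ (α.inChart x) (extChartAt 𝓘(ℝ, V) x x)
      (mfderiv 𝓘(ℝ, V) 𝓘(ℝ, V) (extChartAt 𝓘(ℝ, V) x) x w)
      (mfderiv 𝓘(ℝ, V) 𝓘(ℝ, V) (extChartAt 𝓘(ℝ, V) x) x v)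

theorem OneForm.d_add_left (α : OneForm V N) (x : N) (v v' w : TangentSpace 𝓘(ℝ, V) x) :
    α.d x (v + v') w = α.d x v w + α.d x v' w := by
  have key : ∀ (L : V →L[ℝ] V →L[ℝ] ℝ) (A : V →L[ℝ] V) (v v' w : V),
      L (A (v + v')) (A w) - L (A w) (A (v + v')) =
        (L (A v) (A w) - L (A w) (A v)) + (L (A v') (A w) - L (A w) (A v')) := by
    intro L A v v' w
    simp only [map_add, add_apply]
    ring
  exact key _ _ v v' w

theorem OneForm.d_smul_left (α : OneForm V N) (x : N) (c : ℝ) (v w : TangentSpace 𝓘(ℝ, V) x) :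
    α.d x (c • v) w = c * α.d x v w := by
  have key : ∀ (L : V →L[ℝ] V →L[ℝ] ℝ) (A : V →L[ℝ] V) (v w : V),
      L (A (c • v)) (A w) - L (A w) (A (c • v)) = c * (L (A v) (A w) - L (A w) (A v)) := by
    intro L A v w
    simp only [map_smul, smul_apply, smul_eq_mul]
    ring
  exact key _ _ v w

theorem OneForm.d_swap (α : OneForm V N) (x : N) (v w : TangentSpace 𝓘(ℝ, V) x) :
    α.d x v w = -α.d x w v := by
  simp only [OneForm.d]
  ring

theorem OneForm.d_self (α : OneForm V N) (x : N) (v : TangentSpace 𝓘(ℝ, V) x) :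
    α.d x v v = 0 := by
  simp [OneForm.d]

theorem OneForm.d_add_right (α : OneForm V N) (x : N) (v w w' : TangentSpace 𝓘(ℝ, V) x) :
    α.d x v (w + w') = α.d x v w + α.d x v w' := by
  rw [α.d_swap, α.d_add_left, α.d_swap x w, α.d_swap x w']
  ring

theorem OneForm.d_smul_right (α : OneForm V N) (x : N) (c : ℝ) (v w : TangentSpace 𝓘(ℝ, V) x) :
    α.d x v (c • w) = c * α.d x v w := by
  rw [α.d_swap, α.d_smul_left, α.d_swap x w]
  ring

/-- The wedge product of two 1-forms, `(α ∧ β)(v,w) = α(v)β(w) - α(w)β(v)`. -/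
def OneForm.wedge (α β : OneForm V N) (x : N) (v w : TangentSpace 𝓘(ℝ, V) x) : ℝ :=
  α x v * β x w - α x w * β x v

/-- The symmetric product of two 1-forms, normalized so that `α · α = α ⊗ α`. -/
def OneForm.symProd (α β : OneForm V N) : BilinField V N := fun x ↦
  (2⁻¹ : ℝ) • ((α x).smulRight (β x) + (β x).smulRight (α x))

/-- The pull-back of a 1-form. -/
def OneForm.pullback (f : N → N') (α : OneForm V' N') : OneForm V N := fun x ↦
  (α (f x)).comp (mfderiv 𝓘(ℝ, V) 𝓘(ℝ, V') f x)

/-- `h = f^* g` for fields of bilinear forms. -/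
def BilinField.IsPullback (f : N → N') (g : BilinField V' N') (h : BilinField V N) : Prop :=
  ∀ (x : N) (v w : TangentSpace 𝓘(ℝ, V) x),
    h x v w = g (f x) (mfderiv 𝓘(ℝ, V) 𝓘(ℝ, V') f x v) (mfderiv 𝓘(ℝ, V) 𝓘(ℝ, V') f x w)

/-- The bilinear form `b` is a symmetric non-degenerate form of signature `(p,q)`: it is diagonal
with `p` entries `+1` and `q` entries `-1` in some basis. -/
def HasSignature (p q : ℕ) (b : V →L[ℝ] V →L[ℝ] ℝ) : Prop :=
  ∃ e : Module.Basis (Fin p ⊕ Fin q) ℝ V, ∀ i j,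
    b (e i) (e j) = if i = j then Sum.elim (fun _ ↦ 1) (fun _ ↦ -1) i else 0

/-- `g` restricts to a pseudo-Riemannian metric of signature `(2,2)` on the set `U`. -/
def BilinField.IsMetric22On [IsManifold 𝓘(ℝ, V) ∞ N] (g : BilinField V N) (U : Set N) : Prop :=
  g.SmoothOn U ∧ ∀ x ∈ U, HasSignature (V := V) 2 2 (g x)

/-- A conformal class of metrics of signature `(2,2)` on `N`: a line in the space of bilinear forms
on each tangent space, locally spanned by a smooth metric of signature `(2,2)`. -/
def IsConformalClass22 [IsManifold 𝓘(ℝ, V) ∞ N]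
    (C : ∀ x : N, Submodule ℝ (TangentSpace 𝓘(ℝ, V) x →L[ℝ] TangentSpace 𝓘(ℝ, V) x →L[ℝ] ℝ)) :
    Prop :=
  ∀ x, ∃ (U : Set N) (g : BilinField V N), IsOpen U ∧ x ∈ U ∧ g.IsMetric22On U ∧
    ∀ y ∈ U, C y = Submodule.span ℝ {g y}

end Forms

/-! ### Manifold structure from a family of charts -/

section Atlas

/-- Charts on a bare type `S` with values in `V`, defined on subsets covering `S`, with smooth
transition maps between open sets. -/
structure SmoothAtlas (V : Type*) [NormedAddCommGroup V] [NormedSpace ℝ V] (S : Type*) where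
  charts : Set (PartialEquiv S V)
  cover : ∀ p, ∃ e ∈ charts, p ∈ e.source
  open_source : ∀ e ∈ charts, ∀ e' ∈ charts, IsOpen (e.symm.trans e').source
  smooth : ∀ e ∈ charts, ∀ e' ∈ charts, ContDiffOn ℝ ∞ (e.symm.trans e') (e.symm.trans e').source

namespace SmoothAtlas

variable {V : Type*} [NormedAddCommGroup V] [NormedSpace ℝ V] {S : Type*}

/-- The topology and the atlas generated by the charts. -/
def toCore (A : SmoothAtlas V S) : ChartedSpaceCore V S where
  atlas := A.charts
  chartAt p := (A.cover p).choose
  mem_chart_source p := (A.cover p).choose_spec.2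
  chart_mem_atlas p := (A.cover p).choose_spec.1
  open_source e e' he he' := A.open_source e he e' he'
  continuousOn_toFun e e' he he' := (A.smooth e he e' he').continuousOn

abbrev topology (A : SmoothAtlas V S) : TopologicalSpace S := A.toCore.toTopologicalSpace

abbrev chartedSpace (A : SmoothAtlas V S) : @ChartedSpace V _ S A.topology :=
  A.toCore.toChartedSpace

theorem isManifold (A : SmoothAtlas V S) :
    @IsManifold ℝ _ V _ _ V _ 𝓘(ℝ, V) ∞ S A.topology A.chartedSpace := by
  let := A.topology
  let := A.chartedSpace
  refine isManifold_of_contDiffOn 𝓘(ℝ, V) ∞ S ?_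
  intro e e' he he'
  change e ∈ ⋃ (f : PartialEquiv S V) (hf : f ∈ A.toCore.atlas),
    {A.toCore.openPartialHomeomorph f hf} at he
  change e' ∈ ⋃ (f : PartialEquiv S V) (hf : f ∈ A.toCore.atlas),
    {A.toCore.openPartialHomeomorph f hf} at he'
  simp only [mem_iUnion, mem_singleton_iff] at he he'
  obtain ⟨f, hf, rfl⟩ := he
  obtain ⟨f', hf', rfl⟩ := he'
  have h := A.smooth f hf f' hf'
  simp only [modelWithCornersSelf_coe, modelWithCornersSelf_coe_symm, Function.comp_id,
    Function.id_comp, preimage_id, range_id, inter_univ]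
  exact h

end SmoothAtlas

end Atlas

/-! ### Path geometries -/

/-- The model space of 3-manifolds. -/
abbrev E3 : Type := EuclideanSpace ℝ (Fin 3)

section PathGeometry

variable {M : Type*} [TopologicalSpace M] [ChartedSpace E3 M] [IsManifold (𝓡 3) ∞ M]

/-- A vector field on a 3-manifold. -/
abbrev VField (M : Type*) [TopologicalSpace M] [ChartedSpace E3 M] : Type _ :=
  ∀ x : M, TangentSpace (𝓡 3) x

/-- `X` is a smooth nowhere zero section over the open set `W` of the field of subspaces `L`,
spanning `L` (which is therefore a line field over `W`). -/
structure IsLocalFrame (L : ∀ x : M, Submodule ℝ (TangentSpace (𝓡 3) x)) (X : VField M)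
    (W : Set M) : Prop where
  isOpen : IsOpen W
  smooth : ContMDiffOn (𝓡 3) (𝓡 3).tangent ∞ (fun x ↦ (⟨x, X x⟩ : TangentBundle (𝓡 3) M)) W
  ne_zero : ∀ x ∈ W, X x ≠ 0
  span : ∀ x ∈ W, L x = Submodule.span ℝ {X x}

/-- `θ` is a smooth contact form on the open set `U`, with kernel the field of planes `D`:
`ker θ = D` and `dθ` is non-degenerate on `D` (that is, `θ ∧ dθ ≠ 0`). -/
structure IsContactFormOn (D : ∀ x : M, Submodule ℝ (TangentSpace (𝓡 3) x))
    (θ : OneForm E3 M) (U : Set M) : Prop where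
  isOpen : IsOpen U
  smooth : θ.SmoothOn U
  ker_eq : ∀ x ∈ U, (θ x).toLinearMap.ker = D x
  nondegenerate : ∀ x ∈ U, ∀ v ∈ D x, (∀ w ∈ D x, θ.d x v w = 0) → v = 0

/-- Two smooth local frames of a line field differ by a smooth non-vanishing factor. -/
theorem IsLocalFrame.exists_ratio {L : ∀ x : M, Submodule ℝ (TangentSpace (𝓡 3) x)}
    {X X' : VField M} {W W' : Set M} (h : IsLocalFrame L X W) (h' : IsLocalFrame L X' W') :
    ∃ c : M → ℝ, ContMDiffOn (𝓡 3) 𝓘(ℝ, ℝ) ∞ c (W ∩ W') ∧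
      ∀ x ∈ W ∩ W', c x ≠ 0 ∧ X' x = c x • X x := by
  have key : ∀ x, ∃ a : ℝ, x ∈ W ∩ W' → a ≠ 0 ∧ X' x = a • X x := by
    intro x
    by_cases hx : x ∈ W ∩ W'
    · have : X' x ∈ Submodule.span ℝ {X x} := by
        rw [← h.span x hx.1, h'.span x hx.2]
        exact Submodule.mem_span_singleton_self _
      obtain ⟨a, ha⟩ := Submodule.mem_span_singleton.1 this
      refine ⟨a, fun _ ↦ ⟨?_, ha.symm⟩⟩
      rintro rfl
      exact h'.ne_zero x hx.2 (by rw [← ha, zero_smul])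
    · exact ⟨0, fun h ↦ (hx h).elim⟩
  choose c hc using key
  refine ⟨c, fun x hx ↦ ?_, hc⟩
  refine ContMDiffAt.contMDiffWithinAt ?_
  have hO : W ∩ W' ∈ 𝓝 x := (h.isOpen.inter h'.isOpen).mem_nhds hx
  have s := (contMDiffAt_section (IB := 𝓡 3) (F := E3) (n := ∞)
    (E := (TangentSpace (𝓡 3) : M → Type _)) (s := X) x).1
    (h.smooth.contMDiffAt (h.isOpen.mem_nhds hx.1))
  have s' := (contMDiffAt_section (IB := 𝓡 3) (F := E3) (n := ∞)
    (E := (TangentSpace (𝓡 3) : M → Type _)) (s := X') x).1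
    (h'.smooth.contMDiffAt (h'.isOpen.mem_nhds hx.2))
  let τ := trivializationAt E3 (TangentSpace (𝓡 3) : M → Type _) x
  have hτ : τ.baseSet ∈ 𝓝 x :=
    τ.open_baseSet.mem_nhds (mem_baseSet_trivializationAt E3 _ x)
  have hx0 : (τ ⟨x, X x⟩).2 ≠ 0 := by
    intro h0
    have hb := mem_baseSet_trivializationAt E3 (TangentSpace (𝓡 3) : M → Type _) x
    have : τ.continuousLinearEquivAt ℝ x hb (X x) = 0 := h0
    exact h.ne_zero x hx.1 ((τ.continuousLinearEquivAt ℝ x hb).map_eq_zero_iff.1 this)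
  let w : E3 := (τ ⟨x, X x⟩).2
  let ℓ : E3 →L[ℝ] ℝ := innerSL ℝ w
  have hℓ : ℓ (τ ⟨x, X x⟩).2 ≠ 0 := by
    change inner ℝ w w ≠ 0
    exact inner_self_ne_zero.2 hx0
  have q : ContMDiffAt (𝓡 3) 𝓘(ℝ, ℝ) ∞ (fun y ↦ ℓ (τ ⟨y, X' y⟩).2 / ℓ (τ ⟨y, X y⟩).2) x :=
    ContMDiffAt.div₀ (ℓ.contMDiff.contMDiffAt.comp x s') (ℓ.contMDiff.contMDiffAt.comp x s) hℓ
  refine q.congr_of_eventuallyEq ?_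
  have hne : ∀ᶠ y in 𝓝 x, ℓ (τ ⟨y, X y⟩).2 ≠ 0 :=
    (ℓ.contMDiff.contMDiffAt.comp x s).continuousAt.eventually_ne hℓ
  filter_upwards [hO, hτ, hne] with y hy hyb hyn
  have e : (τ ⟨y, X' y⟩).2 = c y • (τ ⟨y, X y⟩).2 := by
    have := (τ.continuousLinearEquivAt ℝ y hyb).map_smul (c y) (X y)
    rw [← (hc y hy).2] at this
    exact this
  rw [e, map_smul, smul_eq_mul, mul_div_assoc, div_self hyn, mul_one]

theorem IsLocalFrame.restrict {L : ∀ x : M, Submodule ℝ (TangentSpace (𝓡 3) x)}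
    {X : VField M} {W W' : Set M} (h : IsLocalFrame L X W) (ho : IsOpen W') (hs : W' ⊆ W) :
    IsLocalFrame L X W' :=
  ⟨ho, h.smooth.mono hs, fun x hx ↦ h.ne_zero x (hs hx), fun x hx ↦ h.span x (hs hx)⟩

theorem IsLocalFrame.neg {L : ∀ x : M, Submodule ℝ (TangentSpace (𝓡 3) x)}
    {X : VField M} {W : Set M} (h : IsLocalFrame L X W) : IsLocalFrame L (fun x ↦ -X x) W :=
  ⟨h.isOpen, ContMDiffOn.neg_section (V := (TangentSpace (𝓡 3) : M → Type _)) h.smooth,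
    fun x hx ↦ neg_ne_zero.2 (h.ne_zero x hx),
    fun x hx ↦ by
      rw [h.span x hx, ← Set.neg_singleton, Submodule.span_neg]⟩

/-- Smoothness of the transition maps `(z, t) ↦ (φ' (φ⁻¹ z), c (φ⁻¹ z) t)`. -/
theorem transition_smooth {φ φ' : OpenPartialHomeomorph M E3} (hφ : φ ∈ atlas E3 M)
    (hφ' : φ' ∈ atlas E3 M) {O : Set M} (hO : IsOpen O) (h : O ⊆ φ.source) (h' : O ⊆ φ'.source)
    {c : M → ℝ} (hc : ContMDiffOn (𝓡 3) 𝓘(ℝ, ℝ) ∞ c O) :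
    IsOpen ((φ '' O) ×ˢ ({0}ᶜ : Set ℝ)) ∧
      ContDiffOn ℝ ∞ (fun p : E3 × ℝ ↦ (φ' (φ.symm p.1), c (φ.symm p.1) * p.2))
        ((φ '' O) ×ˢ ({0}ᶜ : Set ℝ)) := by
  have hop : IsOpen (φ '' O) := φ.isOpen_image_of_subset_source hO h
  refine ⟨hop.prod isOpen_compl_singleton, ?_⟩
  have m : MapsTo φ.symm (φ '' O) O := by
    rintro _ ⟨x, hx, rfl⟩
    rwa [φ.left_inv (h hx)]
  have s1 : ContMDiffOn 𝓘(ℝ, E3) (𝓡 3) ∞ φ.symm (φ '' O) :=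
    (contMDiffOn_symm_of_mem_maximalAtlas
      (IsManifold.subset_maximalAtlas hφ)).mono (by
        rintro _ ⟨x, hx, rfl⟩; exact φ.map_source (h hx))
  have s2 : ContDiffOn ℝ ∞ (fun z ↦ φ' (φ.symm z)) (φ '' O) :=
    contMDiffOn_iff_contDiffOn.1 (((contMDiffOn_of_mem_maximalAtlas
      (IsManifold.subset_maximalAtlas hφ')).mono h').comp s1 m)
  have s3 : ContDiffOn ℝ ∞ (fun z ↦ c (φ.symm z)) (φ '' O) :=
    contMDiffOn_iff_contDiffOn.1 (hc.comp s1 m)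
  have m1 : MapsTo (Prod.fst : E3 × ℝ → E3) ((φ '' O) ×ˢ ({0}ᶜ : Set ℝ)) (φ '' O) :=
    fun p hp ↦ hp.1
  exact (s2.comp contDiff_fst.contDiffOn m1).prodMk
    ((s3.comp contDiff_fst.contDiffOn m1).mul contDiff_snd.contDiffOn)

variable (M) in
/-- A path geometry on the 3-manifold `M`: an ordered pair of smooth line fields spanning a
contact distribution `L₁ ⊕ L₂`. -/
structure PathGeometry where
  L₁ : ∀ x : M, Submodule ℝ (TangentSpace (𝓡 3) x)
  L₂ : ∀ x : M, Submodule ℝ (TangentSpace (𝓡 3) x)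
  smooth₁ : ∀ x, ∃ X W, x ∈ W ∧ IsLocalFrame L₁ X W
  smooth₂ : ∀ x, ∃ X W, x ∈ W ∧ IsLocalFrame L₂ X W
  disjoint : ∀ x, Disjoint (L₁ x) (L₂ x)
  contact : ∀ x, ∃ θ U, x ∈ U ∧ IsContactFormOn (fun y ↦ L₁ y ⊔ L₂ y) θ U

namespace PathGeometry

variable (P : PathGeometry M)

/-- The contact distribution `D = L₁ ⊕ L₂`. -/
def D (x : M) : Submodule ℝ (TangentSpace (𝓡 3) x) := P.L₁ x ⊔ P.L₂ x

/-- A contact form `η³` of the path geometry, defined on an open subset `domain` of `M`. -/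
structure ContactForm where
  domain : Set M
  form : OneForm E3 M
  isContact : IsContactFormOn P.D form domain

/-! #### The bundle `SD*` of rays in `D`, not contained in `L₁ ∪ L₂` -/

/-- The complement `D* = D \ (L₁ ∪ L₂)`. An element `v` of `D_x` is written uniquely as
`v = v₁ + v₂` with `vᵢ ∈ Lᵢ`, and it lies outside `L₁ ∪ L₂` iff `v₁ ≠ 0` and `v₂ ≠ 0`
(see `DStar.exists_vec_eq` and `DStar.vec_injective`). -/
structure DStar where
  base : M
  v₁ : TangentSpace (𝓡 3) base
  v₂ : TangentSpace (𝓡 3) base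
  mem₁ : v₁ ∈ P.L₁ base
  mem₂ : v₂ ∈ P.L₂ base
  ne₁ : v₁ ≠ 0
  ne₂ : v₂ ≠ 0

namespace DStar

variable {P}

/-- The vector `v₁ + v₂` itself. -/
def vec (X : P.DStar) : TangentBundle (𝓡 3) M := ⟨X.base, X.v₁ + X.v₂⟩

theorem exists_vec_eq (x : M) (v : TangentSpace (𝓡 3) x) :
    (∃ X : P.DStar, X.vec = ⟨x, v⟩) ↔ v ∈ P.D x ∧ v ∉ P.L₁ x ∧ v ∉ P.L₂ x := by
  constructor
  · rintro ⟨⟨y, v₁, v₂, m₁, m₂, n₁, n₂⟩, h⟩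
    simp only [vec, TotalSpace.mk.injEq] at h
    obtain ⟨rfl, h⟩ := h
    obtain rfl := eq_of_heq h
    have hd := Submodule.disjoint_def.1 (P.disjoint y)
    refine ⟨Submodule.add_mem_sup m₁ m₂, fun h ↦ n₂ ?_, fun h ↦ n₁ ?_⟩
    · exact hd _ (by simpa using sub_mem h m₁) m₂
    · exact hd _ m₁ (by simpa using sub_mem h m₂)
  · rintro ⟨h, h₁, h₂⟩
    obtain ⟨v₁, m₁, v₂, m₂, rfl⟩ := Submodule.mem_sup.1 h
    refine ⟨⟨x, v₁, v₂, m₁, m₂, ?_, ?_⟩, rfl⟩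
    · rintro rfl; exact h₂ (by simpa using m₂)
    · rintro rfl; exact h₁ (by simpa using m₁)

theorem vec_injective : Function.Injective (vec : P.DStar → TangentBundle (𝓡 3) M) := by
  rintro ⟨x, v₁, v₂, m₁, m₂, n₁, n₂⟩ ⟨y, w₁, w₂, k₁, k₂, l₁, l₂⟩ h
  simp only [vec, TotalSpace.mk.injEq] at h
  obtain ⟨rfl, h⟩ := h
  have h := eq_of_heq h
  have hd := Submodule.disjoint_def.1 (P.disjoint x)
  have e : v₁ - w₁ = w₂ - v₂ := by rw [sub_eq_sub_iff_add_eq_add, h, add_comm]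
  have z := hd (v₁ - w₁) (sub_mem m₁ k₁) (e ▸ sub_mem k₂ m₂)
  have z' : w₂ - v₂ = 0 := e ▸ z
  obtain rfl := sub_eq_zero.1 z
  obtain rfl := sub_eq_zero.1 z'
  rfl

/-- The map `a v₁ + b v₂` for non-zero constants `a`, `b`. -/
def scale (a b : ℝˣ) (X : P.DStar) : P.DStar where
  base := X.base
  v₁ := (a : ℝ) • X.v₁
  v₂ := (b : ℝ) • X.v₂
  mem₁ := Submodule.smul_mem _ _ X.mem₁
  mem₂ := Submodule.smul_mem _ _ X.mem₂
  ne₁ := smul_ne_zero a.ne_zero X.ne₁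
  ne₂ := smul_ne_zero b.ne_zero X.ne₂

theorem scale_scale (a b c d : ℝˣ) (X : P.DStar) :
    (X.scale a b).scale c d = X.scale (c * a) (d * b) := by
  simp only [scale, mul_smul, Units.val_mul]
  rfl

theorem scale_one (X : P.DStar) : X.scale 1 1 = X := by
  simp [scale]

variable (P) in
/-- Two elements of `D*` span the same ray. -/
def setoid : Setoid P.DStar where
  r X Y := ∃ c : ℝˣ, 0 < (c : ℝ) ∧ Y = X.scale c c
  iseqv := by
    refine ⟨fun X ↦ ⟨1, by simp, by rw [scale_one]⟩, ?_, ?_⟩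
    · rintro X _ ⟨c, hc, rfl⟩
      refine ⟨c⁻¹, by simpa using hc, ?_⟩
      rw [scale_scale, inv_mul_cancel, scale_one]
    · rintro X _ _ ⟨c, hc, rfl⟩ ⟨d, hd, rfl⟩
      exact ⟨d * c, by simpa using mul_pos hd hc, by rw [scale_scale]⟩

end DStar

/-- The bundle `SD*` of rays in `D = L₁ ⊕ L₂` not contained in `L₁ ∪ L₂`: the quotient of `D*` by
positive dilations. -/
def SDStar : Type _ := Quotient (DStar.setoid P)

variable {P}

/-- The ray spanned by an element of `D*`. -/
def DStar.ray (X : P.DStar) : P.SDStar := Quotient.mk _ X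

theorem DStar.ray_eq_iff {X Y : P.DStar} :
    X.ray = Y.ray ↔ ∃ c : ℝˣ, 0 < (c : ℝ) ∧ Y = X.scale c c :=
  Quotient.eq (r := DStar.setoid P)

namespace SDStar

/-- The projection `SD* → M`. -/
def proj : P.SDStar → M :=
  Quotient.lift (fun X ↦ X.base) (by rintro X _ ⟨c, -, rfl⟩; rfl)

@[simp] theorem proj_ray (X : P.DStar) : proj X.ray = X.base := rfl

/-- The map `[v₁ + v₂] ↦ [a v₁ + b v₂]` on rays. -/
def scale (a b : ℝˣ) : P.SDStar → P.SDStar :=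
  Quotient.map (DStar.scale a b) (by
    rintro X _ ⟨c, hc, rfl⟩
    exact ⟨c, hc, by rw [DStar.scale_scale, DStar.scale_scale, mul_comm c a, mul_comm c b]⟩)

@[simp] theorem scale_ray (a b : ℝˣ) (X : P.DStar) : scale a b X.ray = (X.scale a b).ray := rfl

/-- The action of `s ∈ ℝ*` on `SD*`, `[v₁ + v₂] ↦ [s v₁ + s⁻¹ v₂]`. -/
def act (s : ℝˣ) : P.SDStar → P.SDStar := scale s s⁻¹

/-- The involution of `SD*` induced by `J(v₁ + v₂) = v₁ - v₂`. -/
def J : P.SDStar → P.SDStar := scale 1 (-1)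

end SDStar

/-- The ray spanned by `t X₁ + X₂` at `x`, for local frames `X₁`, `X₂` of `L₁`, `L₂`. -/
def frameRay {X₁ X₂ : VField M} {W : Set M} (h₁ : IsLocalFrame P.L₁ X₁ W)
    (h₂ : IsLocalFrame P.L₂ X₂ W) (x : M) (hx : x ∈ W) (t : ℝ) (ht : t ≠ 0) : P.SDStar :=
  DStar.ray
    { base := x
      v₁ := t • X₁ x
      v₂ := X₂ x
      mem₁ := Submodule.smul_mem _ _ (h₁.span x hx ▸ Submodule.mem_span_singleton_self _)
      mem₂ := h₂.span x hx ▸ Submodule.mem_span_singleton_self _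
      ne₁ := smul_ne_zero ht (h₁.ne_zero x hx)
      ne₂ := h₂.ne_zero x hx }

variable (P) in
/-- The charts `[t X₁(x) + X₂(x)] ↦ (φ(x), t)` of `SD*`, where `φ` is a chart of `M` and `X₁`, `X₂`
are smooth local frames of `L₁`, `L₂` on an open subset `W` of the domain of `φ`. -/
def sdCharts : Set (PartialEquiv P.SDStar (E3 × ℝ)) :=
  {e | ∃ φ ∈ atlas E3 M, ∃ (W : Set M) (X₁ X₂ : VField M) (h₁ : IsLocalFrame P.L₁ X₁ W)
    (h₂ : IsLocalFrame P.L₂ X₂ W), W ⊆ φ.source ∧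
    e.source = {p | ∃ x hx t ht, p = frameRay h₁ h₂ x hx t ht} ∧
    e.target = (φ '' W) ×ˢ {0}ᶜ ∧
    ∀ x hx t ht, e (frameRay h₁ h₂ x hx t ht) = (φ x, t)}

theorem frameRay_inj {X₁ X₂ : VField M} {W : Set M} (h₁ : IsLocalFrame P.L₁ X₁ W)
    (h₂ : IsLocalFrame P.L₂ X₂ W) {x y : M} {hx : x ∈ W} {hy : y ∈ W} {t r : ℝ} {ht : t ≠ 0}
    {hr : r ≠ 0} (h : frameRay h₁ h₂ x hx t ht = frameRay h₁ h₂ y hy r hr) : x = y ∧ t = r := by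
  obtain ⟨c, hc, h⟩ := DStar.ray_eq_iff.1 h
  simp only [DStar.scale, DStar.mk.injEq] at h
  obtain ⟨rfl, e₁, e₂⟩ := h
  have c1 : (c : ℝ) = 1 := by
    by_contra hn
    have : ((c : ℝ) - 1) • X₂ y = 0 := by rw [sub_smul, ← e₂, one_smul, sub_self]
    exact (smul_ne_zero (sub_ne_zero.2 hn) (h₂.ne_zero y hy)) this
  rw [c1, one_smul] at e₁
  refine ⟨rfl, ?_⟩
  by_contra hn
  have : (t - r) • X₁ y = 0 := by rw [sub_smul, ← e₁, sub_self]
  exact (smul_ne_zero (sub_ne_zero.2 hn) (h₁.ne_zero y hy)) this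

variable (P) in
theorem sdCharts_cover (p : P.SDStar) : ∃ e ∈ sdCharts P, p ∈ e.source := by
  obtain ⟨X, rfl⟩ : ∃ X : P.DStar, X.ray = p := Quotient.exists_rep p
  obtain ⟨X₁, W₁, hx₁, k₁⟩ := P.smooth₁ X.base
  obtain ⟨X₂, W₂, hx₂, k₂⟩ := P.smooth₂ X.base
  obtain ⟨a, ha⟩ := Submodule.mem_span_singleton.1 (k₁.span _ hx₁ ▸ X.mem₁)
  obtain ⟨b, hb⟩ := Submodule.mem_span_singleton.1 (k₂.span _ hx₂ ▸ X.mem₂)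
  have ha0 : a ≠ 0 := by rintro rfl; exact X.ne₁ (by rw [← ha, zero_smul])
  have hb0 : b ≠ 0 := by rintro rfl; exact X.ne₂ (by rw [← hb, zero_smul])
  obtain ⟨Y₂, b', k₂, hb', hb⟩ : ∃ (Y₂ : VField M) (b' : ℝ), IsLocalFrame P.L₂ Y₂ W₂ ∧ 0 < b' ∧
      b' • Y₂ X.base = X.v₂ := by
    rcases lt_or_gt_of_ne hb0 with h | h
    · exact ⟨_, -b, k₂.neg, by linarith, by rw [smul_neg, neg_smul, neg_neg, hb]⟩
    · exact ⟨X₂, b, k₂, h, hb⟩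
  let φ := chartAt E3 X.base
  let W := W₁ ∩ W₂ ∩ φ.source
  have hW : IsOpen W := (k₁.isOpen.inter k₂.isOpen).inter φ.open_source
  have h₁ := k₁.restrict hW (fun x hx ↦ hx.1.1)
  have h₂ := k₂.restrict hW (fun x hx ↦ hx.1.2)
  classical
  let g : E3 × ℝ → P.SDStar := fun q ↦
    if h : φ.symm q.1 ∈ W ∧ q.2 ≠ 0 then frameRay h₁ h₂ _ h.1 q.2 h.2 else X.ray
  have hg : ∀ x hx t ht, g (φ x, t) = frameRay h₁ h₂ x hx t ht := by
    intro x hx t ht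
    have e : φ.symm (φ x) = x := φ.left_inv hx.2
    have : φ.symm (φ x, t).1 ∈ W ∧ (φ x, t).2 ≠ 0 := ⟨by rw [e]; exact hx, ht⟩
    simp only [g, dif_pos this]
    congr 1
  have hbij : BijOn g ((φ '' W) ×ˢ {0}ᶜ) {p | ∃ x hx t ht, p = frameRay h₁ h₂ x hx t ht} := by
    refine ⟨?_, ?_, ?_⟩
    · rintro ⟨_, t⟩ ⟨⟨x, hx, rfl⟩, ht⟩
      exact ⟨x, hx, t, ht, hg x hx t ht⟩
    · rintro ⟨_, t⟩ ⟨⟨x, hx, rfl⟩, ht⟩ ⟨_, r⟩ ⟨⟨y, hy, rfl⟩, hr⟩ h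
      rw [hg x hx t ht, hg y hy r hr] at h
      obtain ⟨rfl, rfl⟩ := frameRay_inj h₁ h₂ h
      rfl
    · rintro _ ⟨x, hx, t, ht, rfl⟩
      exact ⟨(φ x, t), ⟨⟨x, hx, rfl⟩, ht⟩, hg x hx t ht⟩
  refine ⟨(BijOn.toPartialEquiv g _ _ hbij).symm,
    ⟨φ, chart_mem_atlas E3 X.base, W, X₁, Y₂, h₁, h₂, fun x hx ↦ hx.2, rfl, rfl, ?_⟩, ?_⟩
  · intro x hx t ht
    rw [← hg x hx t ht]
    exact (BijOn.toPartialEquiv g _ _ hbij).left_inv (x := (φ x, t)) ⟨⟨x, hx, rfl⟩, ht⟩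
  · change X.ray ∈ {p | ∃ x hx t ht, p = frameRay h₁ h₂ x hx t ht}
    refine ⟨X.base, ⟨⟨hx₁, hx₂⟩, mem_chart_source E3 X.base⟩, a / b', by positivity, ?_⟩
    symm
    refine DStar.ray_eq_iff.2 ⟨Units.mk0 b' hb'.ne', hb', ?_⟩
    obtain ⟨x, v₁, v₂, m₁, m₂, n₁, n₂⟩ := X
    simp only [DStar.scale, Units.val_mk0, DStar.mk.injEq, true_and]
    refine ⟨?_, hb.symm⟩
    rw [smul_smul, mul_div_cancel₀ _ hb'.ne']
    exact ha.symm

variable (P) in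
theorem sdCharts_compatible (e e' : PartialEquiv P.SDStar (E3 × ℝ)) (he : e ∈ sdCharts P)
    (he' : e' ∈ sdCharts P) : IsOpen (e.symm.trans e').source ∧
      ContDiffOn ℝ ∞ (e.symm.trans e') (e.symm.trans e').source := by
  obtain ⟨φ, hφ, W, X₁, X₂, h₁, h₂, hW, hs, ht, hf⟩ := he
  obtain ⟨φ', hφ', W', X₁', X₂', h₁', h₂', hW', hs', ht', hf'⟩ := he'
  obtain ⟨c₁, hc₁, k₁⟩ := h₁.exists_ratio h₁'
  obtain ⟨c₂, hc₂, k₂⟩ := h₂.exists_ratio h₂'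
  have hWW : IsOpen (W ∩ W') := h₁.isOpen.inter h₁'.isOpen
  let O := (W ∩ W') ∩ c₂ ⁻¹' (Ioi 0)
  have hO : IsOpen O := hc₂.continuousOn.isOpen_inter_preimage hWW isOpen_Ioi
  have hc : ContMDiffOn (𝓡 3) 𝓘(ℝ, ℝ) ∞ (fun x ↦ c₂ x / c₁ x) O :=
    (hc₂.mono inter_subset_left).div₀ (hc₁.mono inter_subset_left) (fun x hx ↦ (k₁ x hx.1).1)
  obtain ⟨T1, T2⟩ := transition_smooth hφ hφ' hO (fun x hx ↦ hW hx.1.1) (fun x hx ↦ hW' hx.1.2) hc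
  have inv : ∀ x hx t ht, e.symm (φ x, t) = frameRay h₁ h₂ x hx t ht := by
    intro x hx t ht
    rw [← hf x hx t ht]
    exact e.left_inv (by rw [hs]; exact ⟨x, hx, t, ht, rfl⟩)
  have trans : ∀ x (hx : x ∈ O) t (ht : t ≠ 0), frameRay h₁ h₂ x hx.1.1 t ht =
      frameRay h₁' h₂' x hx.1.2 (c₂ x / c₁ x * t)
        (mul_ne_zero (div_ne_zero (k₂ x hx.1).1 (k₁ x hx.1).1) ht) := by
    intro x hx t ht
    refine DStar.ray_eq_iff.2 ⟨Units.mk0 (c₂ x) (k₂ x hx.1).1, hx.2, ?_⟩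
    simp only [DStar.scale, Units.val_mk0, DStar.mk.injEq, true_and]
    refine ⟨?_, (k₂ x hx.1).2⟩
    have := (k₁ x hx.1).1
    rw [(k₁ x hx.1).2, smul_smul, smul_smul]
    congr 1
    field_simp
  have src : (e.symm.trans e').source = (φ '' O) ×ˢ ({0}ᶜ : Set ℝ) := by
    rw [PartialEquiv.trans_source, PartialEquiv.symm_source, ht, hs']
    ext ⟨z, t⟩
    constructor
    · rintro ⟨⟨⟨x, hx, rfl⟩, ht⟩, hm⟩
      obtain ⟨y, hy, r, hr, hm⟩ : ∃ y hy r hr, e.symm (φ x, t) = frameRay h₁' h₂' y hy r hr := hm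
      rw [inv x hx t ht] at hm
      obtain ⟨c, hc, hm⟩ := DStar.ray_eq_iff.1 hm
      simp only [DStar.scale, DStar.mk.injEq] at hm
      obtain ⟨rfl, -, e₂⟩ := hm
      refine ⟨⟨y, ⟨⟨hx, hy⟩, ?_⟩, rfl⟩, ht⟩
      rw [(k₂ y ⟨hx, hy⟩).2] at e₂
      have : c₂ y = c := by
        by_contra hn
        have h0 : (c₂ y - c) • X₂ y = 0 := by rw [sub_smul, e₂, sub_self]
        exact (smul_ne_zero (sub_ne_zero.2 hn) (h₂.ne_zero y hx)) h0
      change 0 < c₂ y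
      rw [this]; exact hc
    · rintro ⟨⟨x, hx, rfl⟩, ht⟩
      refine ⟨⟨⟨x, hx.1.1, rfl⟩, ht⟩, ?_⟩
      change ∃ y hy r hr, e.symm (φ x, t) = frameRay h₁' h₂' y hy r hr
      rw [inv x hx.1.1 t ht, trans x hx t ht]
      exact ⟨_, _, _, _, rfl⟩
  rw [src]
  refine ⟨T1, T2.congr ?_⟩
  rintro ⟨_, t⟩ ⟨⟨x, hx, rfl⟩, ht⟩
  change e' (e.symm (φ x, t)) = _
  simp only [φ.left_inv (hW hx.1.1)]
  rw [inv x hx.1.1 t ht, trans x hx t ht, hf']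

variable (P) in
/-- The smooth structure of `SD*`. -/
def sdAtlas : SmoothAtlas (E3 × ℝ) P.SDStar where
  charts := sdCharts P
  cover := sdCharts_cover P
  open_source e he e' he' := (sdCharts_compatible P e e' he he').1
  smooth e he e' he' := (sdCharts_compatible P e e' he he').2

instance : TopologicalSpace P.SDStar := (sdAtlas P).topology

instance : ChartedSpace (E3 × ℝ) P.SDStar := (sdAtlas P).chartedSpace

instance : IsManifold 𝓘(ℝ, E3 × ℝ) ∞ P.SDStar := (sdAtlas P).isManifold

theorem exists_of_mem_L₁ {x : M} {v : TangentSpace (𝓡 3) x} (hv : v ∈ P.L₁ x) (h0 : v ≠ 0) :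
    ∀ w ∈ P.L₁ x, ∃ a : ℝ, w = a • v := by
  obtain ⟨X, W, hx, h⟩ := P.smooth₁ x
  intro w hw
  rw [h.span x hx] at hv hw
  obtain ⟨a, rfl⟩ := Submodule.mem_span_singleton.1 hv
  obtain ⟨b, rfl⟩ := Submodule.mem_span_singleton.1 hw
  have ha : a ≠ 0 := by rintro rfl; exact h0 (zero_smul _ _)
  exact ⟨b / a, by rw [smul_smul, div_mul_cancel₀ _ ha]⟩

theorem exists_of_mem_L₂ {x : M} {v : TangentSpace (𝓡 3) x} (hv : v ∈ P.L₂ x) (h0 : v ≠ 0) :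
    ∀ w ∈ P.L₂ x, ∃ a : ℝ, w = a • v := by
  obtain ⟨X, W, hx, h⟩ := P.smooth₂ x
  intro w hw
  rw [h.span x hx] at hv hw
  obtain ⟨a, rfl⟩ := Submodule.mem_span_singleton.1 hv
  obtain ⟨b, rfl⟩ := Submodule.mem_span_singleton.1 hw
  have ha : a ≠ 0 := by rintro rfl; exact h0 (zero_smul _ _)
  exact ⟨b / a, by rw [smul_smul, div_mul_cancel₀ _ ha]⟩

variable (P) in
theorem exists_ne_zero_mem_L₁ (x : M) : ∃ v ∈ P.L₁ x, v ≠ 0 := by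
  obtain ⟨X, W, hx, h⟩ := P.smooth₁ x
  exact ⟨X x, h.span x hx ▸ Submodule.mem_span_singleton_self _, h.ne_zero x hx⟩

variable (P) in
theorem exists_ne_zero_mem_L₂ (x : M) : ∃ v ∈ P.L₂ x, v ≠ 0 := by
  obtain ⟨X, W, hx, h⟩ := P.smooth₂ x
  exact ⟨X x, h.span x hx ▸ Submodule.mem_span_singleton_self _, h.ne_zero x hx⟩

/-! #### The bundle `B` of coframes adapted to a contact form -/

variable (M) in
/-- The bundle `Hom(TM, ℝ³)`, containing the coframe bundle `F*` as the open set of isomorphisms. -/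
abbrev HomBundle : Type _ :=
  TotalSpace (E3 →L[ℝ] (Fin 3 → ℝ))
    (fun x : M ↦ TangentSpace (𝓡 3) x →L[ℝ] Bundle.Trivial M (Fin 3 → ℝ) x)

namespace ContactForm

variable (η : P.ContactForm)

/-- `u = (u¹, u², u³)` is a coframe at `x` adapted to `η³`. -/
structure IsAdapted (x : M) (u : TangentSpace (𝓡 3) x →L[ℝ] (Fin 3 → ℝ)) : Prop where
  mem_domain : x ∈ η.domain
  bijective : Function.Bijective u
  third : ∀ v, u v 2 = η.form x v
  wedge : ∀ v w, η.form.d x v w = u v 0 * u w 1 - u w 0 * u v 1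
  first_L₂ : ∀ v ∈ P.L₂ x, u v 0 = 0
  second_L₁ : ∀ v ∈ P.L₁ x, u v 1 = 0

/-- The set `B` of all coframes adapted to `η³`. -/
def B : Type _ := {u : HomBundle M // η.IsAdapted u.proj u.2}

variable {η}

/-- The inclusion of `B` in `Hom(TM, ℝ³)`. -/
def B.incl (u : η.B) : HomBundle M := u.1

/-- The projection `B → M`. -/
def B.proj (u : η.B) : M := u.1.proj

/-- The coframe `u : T_xM → ℝ³` at `x = π(u)`. -/
def B.coframe (u : η.B) : TangentSpace (𝓡 3) u.proj →L[ℝ] (Fin 3 → ℝ) := u.1.2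

theorem B.adapted (u : η.B) : η.IsAdapted u.proj u.coframe := u.2

variable (η) in
/-- The charts `u ↦ (φ(π(u)), u¹(X))` of `B`, where `φ` is a chart of `M` and `X` is a smooth local
frame of `L₁` on an open subset `W` of the domain of `φ`. -/
def bCharts : Set (PartialEquiv η.B (E3 × ℝ)) :=
  {e | ∃ φ ∈ atlas E3 M, ∃ (W : Set M) (X : VField M), IsLocalFrame P.L₁ X W ∧
    W ⊆ φ.source ∧ W ⊆ η.domain ∧
    e.source = {u | u.proj ∈ W} ∧
    e.target = (φ '' W) ×ˢ {0}ᶜ ∧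
    ∀ u ∈ e.source, e u = (φ u.proj, u.coframe (X u.proj) 0)}

theorem d_ne_zero {x : M} (hx : x ∈ η.domain) {v₁ v₂ : TangentSpace (𝓡 3) x}
    (m₁ : v₁ ∈ P.L₁ x) (m₂ : v₂ ∈ P.L₂ x) (n₁ : v₁ ≠ 0) (n₂ : v₂ ≠ 0) :
    η.form.d x v₁ v₂ ≠ 0 := by
  intro h0
  refine n₁ (η.isContact.nondegenerate x hx v₁ (Submodule.mem_sup_left m₁) fun w hw ↦ ?_)
  obtain ⟨w₁, k₁, w₂, k₂, rfl⟩ := Submodule.mem_sup.1 hw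
  obtain ⟨a, rfl⟩ := exists_of_mem_L₁ m₁ n₁ w₁ k₁
  obtain ⟨b, rfl⟩ := exists_of_mem_L₂ m₂ n₂ w₂ k₂
  rw [OneForm.d_add_right, OneForm.d_smul_right, OneForm.d_smul_right, OneForm.d_self, h0]
  ring

theorem not_two_span (v₁ v₂ : E3) : ¬ ∀ w : E3, ∃ a b : ℝ, w = a • v₁ + b • v₂ := by
  intro hall
  have htop : (⊤ : Submodule ℝ E3) ≤ Submodule.span ℝ (Set.range ![v₁, v₂]) := by
    intro w _
    obtain ⟨a, b, e⟩ := hall w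
    rw [e]
    exact add_mem (Submodule.smul_mem _ _ (Submodule.subset_span ⟨0, rfl⟩))
      (Submodule.smul_mem _ _ (Submodule.subset_span ⟨1, rfl⟩))
  have h2 : (Set.range ![v₁, v₂]).finrank ℝ ≤ 2 := by
    simpa using finrank_range_le_card (R := ℝ) ![v₁, v₂]
  have h3 : (Set.range ![v₁, v₂]).finrank ℝ = 3 := by
    rw [Set.finrank, top_le_iff.1 htop, finrank_top]
    simp
  omega

/-- Every tangent vector is a combination of `v₁`, `v₂` and a vector transverse to `D`. -/
theorem exists_transverse {x : M} (hx : x ∈ η.domain) {v₁ v₂ : TangentSpace (𝓡 3) x}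
    (m₁ : v₁ ∈ P.L₁ x) (m₂ : v₂ ∈ P.L₂ x) (n₁ : v₁ ≠ 0) (n₂ : v₂ ≠ 0) :
    ∃ v₃ : TangentSpace (𝓡 3) x, η.form x v₃ = 1 ∧
      ∀ w, ∃ a b c : ℝ, w = a • v₁ + b • v₂ + c • v₃ := by
  have hD : ∀ w, η.form x w = 0 → ∃ a b : ℝ, w = a • v₁ + b • v₂ := by
    intro w hw
    have : w ∈ P.D x := by
      rw [← η.isContact.ker_eq x hx]; exact hw
    obtain ⟨w₁, k₁, w₂, k₂, rfl⟩ := Submodule.mem_sup.1 this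
    obtain ⟨a, rfl⟩ := exists_of_mem_L₁ m₁ n₁ w₁ k₁
    obtain ⟨b, rfl⟩ := exists_of_mem_L₂ m₂ n₂ w₂ k₂
    exact ⟨a, b, rfl⟩
  obtain ⟨v, hv⟩ : ∃ v, η.form x v ≠ 0 := by
    by_contra! hall
    exact not_two_span v₁ v₂ fun w ↦ hD w (hall w)
  refine ⟨(η.form x v)⁻¹ • v, by simp [hv], fun w ↦ ?_⟩
  obtain ⟨a, b, e⟩ := hD (w - (η.form x w) • (η.form x v)⁻¹ • v) (by simp [hv])
  exact ⟨a, b, η.form x w, by rw [← e, sub_add_cancel]⟩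

/-- The component `u¹` of an adapted coframe is non-zero on `L₁`. -/
theorem IsAdapted.first_ne_zero {x : M} {u : TangentSpace (𝓡 3) x →L[ℝ] (Fin 3 → ℝ)}
    (h : η.IsAdapted x u) {v₁ : TangentSpace (𝓡 3) x} (m₁ : v₁ ∈ P.L₁ x) (n₁ : v₁ ≠ 0) :
    u v₁ 0 ≠ 0 := by
  intro h0
  refine n₁ (h.bijective.1 ?_)
  rw [map_zero]
  have : η.form x v₁ = 0 := by
    have : v₁ ∈ (η.form x).toLinearMap.ker := by
      rw [η.isContact.ker_eq x h.mem_domain]; exact Submodule.mem_sup_left m₁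
    exact this
  ext i
  fin_cases i
  · exact h0
  · exact h.second_L₁ v₁ m₁
  · change u v₁ 2 = 0
    rw [h.third, this]

/-- An adapted coframe at a point is determined by the value of `u¹` on a non-zero vector
of `L₁`. -/
theorem IsAdapted.eq_of_first {x : M} {u u' : TangentSpace (𝓡 3) x →L[ℝ] (Fin 3 → ℝ)}
    (h : η.IsAdapted x u) (h' : η.IsAdapted x u') {v₁ : TangentSpace (𝓡 3) x}
    (m₁ : v₁ ∈ P.L₁ x) (n₁ : v₁ ≠ 0) (e : u v₁ 0 = u' v₁ 0) : u = u' := by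
  obtain ⟨v₂, m₂, n₂⟩ := exists_ne_zero_mem_L₂ P x
  have k := h.first_ne_zero m₁ n₁
  have second : ∀ w, u w 1 = u' w 1 := by
    intro w
    have e₁ := h.wedge v₁ w
    have e₂ := h'.wedge v₁ w
    rw [h.second_L₁ v₁ m₁, mul_zero, sub_zero] at e₁
    rw [h'.second_L₁ v₁ m₁, mul_zero, sub_zero, ← e] at e₂
    exact mul_left_cancel₀ k (e₁.symm.trans e₂)
  have k₂ : u v₂ 1 ≠ 0 := by
    intro h0
    have := h.wedge v₁ v₂
    rw [h.second_L₁ v₁ m₁, h0, mul_zero, mul_zero, sub_zero] at this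
    exact d_ne_zero h.mem_domain m₁ m₂ n₁ n₂ this
  ext w i
  fin_cases i
  · have e₁ := h.wedge w v₂
    have e₂ := h'.wedge w v₂
    rw [h.first_L₂ v₂ m₂, zero_mul, sub_zero] at e₁
    rw [h'.first_L₂ v₂ m₂, zero_mul, sub_zero, ← second v₂] at e₂
    exact mul_right_cancel₀ k₂ (e₁.symm.trans e₂)
  · exact second w
  · exact (h.third w).trans (h'.third w).symm

/-- An adapted coframe exists for each non-zero value of `u¹` on a non-zero vector of `L₁`. -/
theorem exists_isAdapted {x : M} (hx : x ∈ η.domain) {v₁ : TangentSpace (𝓡 3) x}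
    (m₁ : v₁ ∈ P.L₁ x) (n₁ : v₁ ≠ 0) {s : ℝ} (hs : s ≠ 0) :
    ∃ u : TangentSpace (𝓡 3) x →L[ℝ] (Fin 3 → ℝ), η.IsAdapted x u ∧ u v₁ 0 = s := by
  obtain ⟨v₂, m₂, n₂⟩ := exists_ne_zero_mem_L₂ P x
  obtain ⟨v₃, h₃, hv⟩ := exists_transverse hx m₁ m₂ n₁ n₂
  have hm := d_ne_zero hx m₁ m₂ n₁ n₂
  have z : ∀ v ∈ P.D x, η.form x v = 0 := by
    intro v hv
    have : v ∈ (η.form x).toLinearMap.ker := by rw [η.isContact.ker_eq x hx]; exact hv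
    exact this
  have z₁ := z v₁ (Submodule.mem_sup_left m₁)
  have z₂ := z v₂ (Submodule.mem_sup_right m₂)
  let U : TangentSpace (𝓡 3) x →ₗ[ℝ] (Fin 3 → ℝ) :=
    { toFun := fun v ↦ ![s / η.form.d x v₁ v₂ * η.form.d x v v₂, s⁻¹ * η.form.d x v₁ v,
        η.form x v]
      map_add' := by
        intro v w
        ext i
        fin_cases i <;> simp [OneForm.d_add_right, OneForm.d_add_left, mul_add]
      map_smul' := by
        intro c v
        ext i
        fin_cases i <;> simp [OneForm.d_smul_right, OneForm.d_smul_left] <;> ring }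
  have : FiniteDimensional ℝ (TangentSpace (𝓡 3) x) := inferInstanceAs (FiniteDimensional ℝ E3)
  have : T2Space (TangentSpace (𝓡 3) x) := inferInstanceAs (T2Space E3)
  let u : TangentSpace (𝓡 3) x →L[ℝ] (Fin 3 → ℝ) := LinearMap.toContinuousLinearMap U
  have u0 : ∀ v, u v 0 = s / η.form.d x v₁ v₂ * η.form.d x v v₂ := fun v ↦ rfl
  have u1 : ∀ v, u v 1 = s⁻¹ * η.form.d x v₁ v := fun v ↦ rfl
  have u2 : ∀ v, u v 2 = η.form x v := fun v ↦ rfl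
  have e₁ : u v₁ 0 = s := by rw [u0, div_mul_cancel₀ _ hm]
  have inj : Function.Injective u := by
    rw [injective_iff_map_eq_zero]
    intro w hw
    have w0 := congrFun hw 0
    have w1 := congrFun hw 1
    have w2 := congrFun hw 2
    obtain ⟨a, b, c, rfl⟩ := hv w
    have hc : c = 0 := by
      rw [u2] at w2
      simpa [z₁, z₂, h₃] using w2
    subst hc
    rw [u0] at w0
    rw [u1] at w1
    simp only [zero_smul, add_zero, OneForm.d_add_left, OneForm.d_smul_left, OneForm.d_add_right,
      OneForm.d_smul_right, OneForm.d_self, mul_zero, zero_add, Pi.zero_apply] at w0 w1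
    have ha : a = 0 := by simpa [hs, hm] using w0
    have hb : b = 0 := by simpa [hs, hm] using w1
    simp [ha, hb]
  refine ⟨u, ⟨hx, ⟨inj, ?_⟩, u2, ?_, ?_, ?_⟩, e₁⟩
  · have e : Module.finrank ℝ (TangentSpace (𝓡 3) x) = 3 :=
      finrank_euclideanSpace_fin (𝕜 := ℝ) (n := 3)
    exact (LinearMap.injective_iff_surjective_of_finrank_eq_finrank (f := U)
      (by rw [e]; simp)).1 inj
  · intro v w
    obtain ⟨a, b, c, rfl⟩ := hv v
    obtain ⟨a', b', c', rfl⟩ := hv w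
    rw [u0, u0, u1, u1]
    simp only [OneForm.d_add_left, OneForm.d_smul_left, OneForm.d_add_right,
      OneForm.d_smul_right, OneForm.d_self, OneForm.d_swap _ x v₂ v₁, OneForm.d_swap _ x v₃ v₁,
      OneForm.d_swap _ x v₃ v₂]
    field_simp
    ring
  · intro v hv
    obtain ⟨a, rfl⟩ := exists_of_mem_L₂ m₂ n₂ v hv
    rw [u0, OneForm.d_smul_left, OneForm.d_self]
    ring
  · intro v hv
    obtain ⟨a, rfl⟩ := exists_of_mem_L₁ m₁ n₁ v hv
    rw [u1, OneForm.d_smul_right, OneForm.d_self]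
    ring

variable (η) in
theorem bCharts_cover (u : η.B) : ∃ e ∈ bCharts η, u ∈ e.source := by
  obtain ⟨X, W₁, hx, k⟩ := P.smooth₁ u.proj
  let φ := chartAt E3 u.proj
  let W := W₁ ∩ η.domain ∩ φ.source
  have hW : IsOpen W := (k.isOpen.inter η.isContact.isOpen).inter φ.open_source
  have h := k.restrict hW (fun x hx ↦ hx.1.1)
  have hX : ∀ x ∈ W, X x ∈ P.L₁ x := fun x hx ↦
    h.span x hx ▸ Submodule.mem_span_singleton_self _
  have hbij : BijOn (fun u : η.B ↦ (φ u.proj, u.coframe (X u.proj) 0)) {u | u.proj ∈ W}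
      ((φ '' W) ×ˢ ({0}ᶜ : Set ℝ)) := by
    refine ⟨?_, ?_, ?_⟩
    · intro u hu
      exact ⟨⟨_, hu, rfl⟩, u.adapted.first_ne_zero (hX _ hu) (h.ne_zero _ hu)⟩
    · rintro ⟨⟨x, u⟩, hu⟩ hxW ⟨⟨y, v⟩, hv⟩ hyW e
      simp only [Prod.mk.injEq] at e
      obtain rfl : x = y := φ.injOn hxW.2 hyW.2 e.1
      obtain rfl : u = v := hu.eq_of_first hv (hX _ hxW) (h.ne_zero _ hxW) e.2
      rfl
    · rintro ⟨_, s⟩ ⟨⟨x, hx, rfl⟩, hs⟩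
      obtain ⟨u, hu, e⟩ := exists_isAdapted hx.1.2 (hX x hx) (h.ne_zero x hx) hs
      exact ⟨⟨⟨x, u⟩, hu⟩, hx, Prod.ext rfl e⟩
  have : Nonempty η.B := ⟨u⟩
  exact ⟨BijOn.toPartialEquiv _ _ _ hbij, ⟨φ, chart_mem_atlas E3 u.proj, W, X, h,
    fun x hx ↦ hx.2, fun x hx ↦ hx.1.2, rfl, rfl, fun _ _ ↦ rfl⟩,
    ⟨⟨hx, u.adapted.mem_domain⟩, mem_chart_source E3 u.proj⟩⟩

variable (η) in
theorem bCharts_compatible (e e' : PartialEquiv η.B (E3 × ℝ)) (he : e ∈ bCharts η)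
    (he' : e' ∈ bCharts η) : IsOpen (e.symm.trans e').source ∧
      ContDiffOn ℝ ∞ (e.symm.trans e') (e.symm.trans e').source := by
  obtain ⟨φ, hφ, W, X, h, hW, hD, hs, ht, hf⟩ := he
  obtain ⟨φ', hφ', W', X', h', hW', hD', hs', ht', hf'⟩ := he'
  obtain ⟨c, hc, k⟩ := h.exists_ratio h'
  have hO : IsOpen (W ∩ W') := h.isOpen.inter h'.isOpen
  obtain ⟨T1, T2⟩ := transition_smooth hφ hφ' hO (fun x hx ↦ hW hx.1) (fun x hx ↦ hW' hx.2) hc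
  have inv : ∀ p ∈ e.target, (e.symm p).proj ∈ W ∧ φ (e.symm p).proj = p.1 ∧
      (e.symm p).coframe (X (e.symm p).proj) 0 = p.2 := by
    intro p hp
    have m := e.map_target hp
    have r := e.right_inv hp
    rw [hf _ m] at r
    rw [hs] at m
    exact ⟨m, congrArg Prod.fst r, congrArg Prod.snd r⟩
  have src : (e.symm.trans e').source = (φ '' (W ∩ W')) ×ˢ ({0}ᶜ : Set ℝ) := by
    rw [PartialEquiv.trans_source, PartialEquiv.symm_source]
    ext p
    constructor
    · rintro ⟨hp, hm⟩
      obtain ⟨i₁, i₂, -⟩ := inv p hp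
      rw [mem_preimage, hs'] at hm
      rw [ht] at hp
      exact ⟨⟨_, ⟨i₁, hm⟩, i₂⟩, hp.2⟩
    · rintro ⟨⟨x, hx, hp⟩, hp'⟩
      have hpt : p ∈ e.target := by rw [ht]; exact ⟨⟨x, hx.1, hp⟩, hp'⟩
      obtain ⟨i₁, i₂, -⟩ := inv p hpt
      have hxx : (e.symm p).proj = x := φ.injOn (hW i₁) (hW hx.1) (i₂.trans hp.symm)
      refine ⟨hpt, ?_⟩
      rw [mem_preimage, hs']
      change (e.symm p).proj ∈ W'
      rw [hxx]; exact hx.2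
  refine ⟨src ▸ T1, ?_⟩
  have T2' := src ▸ T2
  refine T2'.congr ?_
  intro p hp
  have hpt : p ∈ e.target := hp.1
  have hps : e.symm p ∈ e'.source := hp.2
  obtain ⟨i₁, i₂, i₃⟩ := inv p hpt
  change e' (e.symm p) = _
  rw [hf' _ hps]
  rw [hs'] at hps
  have l : φ.symm p.1 = (e.symm p).proj := by rw [← i₂, φ.left_inv (hW i₁)]
  simp only [l, (k _ ⟨i₁, hps⟩).2, map_smul, Pi.smul_apply, smul_eq_mul, i₃]

variable (η) in
/-- The smooth structure of `B`. -/
def bAtlas : SmoothAtlas (E3 × ℝ) η.B where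
  charts := bCharts η
  cover := bCharts_cover η
  open_source e he e' he' := (bCharts_compatible η e e' he he').1
  smooth e he e' he' := (bCharts_compatible η e e' he he').2

instance : TopologicalSpace η.B := (bAtlas η).topology

instance : ChartedSpace (E3 × ℝ) η.B := (bAtlas η).chartedSpace

instance : IsManifold 𝓘(ℝ, E3 × ℝ) ∞ η.B := (bAtlas η).isManifold

/-- The coframe `(s⁻¹ u¹, s u², u³)`. -/
def scaleCoframe {x : M} (s : ℝˣ) (u : TangentSpace (𝓡 3) x →L[ℝ] (Fin 3 → ℝ)) :
    TangentSpace (𝓡 3) x →L[ℝ] (Fin 3 → ℝ) :=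
  (ContinuousLinearMap.pi fun i ↦
    (![((s⁻¹ : ℝˣ) : ℝ), (s : ℝ), 1] i) • ContinuousLinearMap.proj (R := ℝ) i).comp u

theorem scaleCoframe_apply {x : M} (s : ℝˣ) (u : TangentSpace (𝓡 3) x →L[ℝ] (Fin 3 → ℝ))
    (v : TangentSpace (𝓡 3) x) (i : Fin 3) :
    scaleCoframe s u v i = ![((s⁻¹ : ℝˣ) : ℝ), (s : ℝ), 1] i * u v i := rfl

theorem scaleCoframe_mul {x : M} (s t : ℝˣ) (u : TangentSpace (𝓡 3) x →L[ℝ] (Fin 3 → ℝ)) :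
    scaleCoframe (s * t) u = scaleCoframe s (scaleCoframe t u) := by
  ext v i
  simp only [scaleCoframe_apply]
  fin_cases i <;> simp [mul_assoc, mul_left_comm]

theorem scaleCoframe_one {x : M} (u : TangentSpace (𝓡 3) x →L[ℝ] (Fin 3 → ℝ)) :
    scaleCoframe 1 u = u := by
  ext v i
  simp only [scaleCoframe_apply]
  fin_cases i <;> simp

theorem IsAdapted.scale {x : M} {u : TangentSpace (𝓡 3) x →L[ℝ] (Fin 3 → ℝ)}
    (h : η.IsAdapted x u) (s : ℝˣ) : η.IsAdapted x (scaleCoframe s u) where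
  mem_domain := h.mem_domain
  bijective := by
    constructor
    · intro v w hvw
      refine h.bijective.1 ?_
      have e' : scaleCoframe s⁻¹ (scaleCoframe s u) = u := by
        rw [← scaleCoframe_mul, inv_mul_cancel, scaleCoframe_one]
      rw [← e']
      ext i
      rw [scaleCoframe_apply, hvw, ← scaleCoframe_apply]
    · intro y
      obtain ⟨v, hv⟩ := h.bijective.2 (fun i ↦ ![(s : ℝ), ((s⁻¹ : ℝˣ) : ℝ), 1] i * y i)
      refine ⟨v, ?_⟩
      ext i
      rw [scaleCoframe_apply, hv]
      fin_cases i <;> simp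
  third v := by
    rw [scaleCoframe_apply, ← h.third]
    simp
  wedge v w := by
    simp only [scaleCoframe_apply]
    rw [h.wedge]
    simp
    field_simp
  first_L₂ v hv := by rw [scaleCoframe_apply, h.first_L₂ v hv, mul_zero]
  second_L₁ v hv := by rw [scaleCoframe_apply, h.second_L₁ v hv, mul_zero]

/-- The action of `ℝ*` on `B`: `s` sends `(u¹, u², u³)` to `(s⁻¹ u¹, s u², u³)`. -/
instance : MulAction ℝˣ η.B where
  smul s u := ⟨⟨u.proj, scaleCoframe s u.coframe⟩, u.adapted.scale s⟩
  one_smul u := Subtype.ext (congrArg (TotalSpace.mk u.proj) (scaleCoframe_one u.coframe))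
  mul_smul s t u := Subtype.ext (congrArg (TotalSpace.mk u.proj) (scaleCoframe_mul s t u.coframe))

theorem B.coframe_smul (s : ℝˣ) (u : η.B) : (s • u).coframe = scaleCoframe s u.coframe := rfl

variable (η) in
/-- `B` is an `ℝ*`-reduction of the coframe bundle over the domain of `η³`: an embedded submanifold
of `Hom(TM, ℝ³)` on which `ℝ*` acts smoothly and simply transitively along the fibres, with smooth
local sections through every point of the domain. -/
structure IsReduction : Prop where
  isEmbedding : Topology.IsEmbedding (B.incl : η.B → HomBundle M)
  contMDiff_incl : ContMDiff 𝓘(ℝ, E3 × ℝ) ((𝓡 3).prod 𝓘(ℝ, E3 →L[ℝ] (Fin 3 → ℝ))) ∞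
    (B.incl : η.B → HomBundle M)
  immersion : ∀ u : η.B, Function.Injective
    (mfderiv 𝓘(ℝ, E3 × ℝ) ((𝓡 3).prod 𝓘(ℝ, E3 →L[ℝ] (Fin 3 → ℝ)))
      (B.incl : η.B → HomBundle M) u)
  contMDiff_smul : ContMDiff (𝓘(ℝ, ℝ).prod 𝓘(ℝ, E3 × ℝ)) 𝓘(ℝ, E3 × ℝ) ∞
    (fun q : ℝˣ × η.B ↦ q.1 • q.2)
  existsUnique_smul : ∀ u u' : η.B, u.proj = u'.proj → ∃! s : ℝˣ, s • u = u'
  exists_section : ∀ x ∈ η.domain, ∃ (W : Set M) (σ : M → η.B), IsOpen W ∧ x ∈ W ∧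
    W ⊆ η.domain ∧ ContMDiffOn (𝓡 3) 𝓘(ℝ, E3 × ℝ) ∞ σ W ∧ ∀ y ∈ W, (σ y).proj = y

/-! #### The normalized connection and the Fefferman metric on `B`

The components `1, 2, 3` of the text are the indices `0, 1, 2` in `Fin 3`. -/

variable (η) in
/-- The components of the tautological form `ω_u = u ∘ dπ_u` on `B`. -/
def taut (i : Fin 3) : OneForm (E3 × ℝ) η.B := fun u ↦
  ((ContinuousLinearMap.proj (R := ℝ) (φ := fun _ : Fin 3 ↦ ℝ) i).comp u.coframe).comp
    (mfderiv 𝓘(ℝ, E3 × ℝ) (𝓡 3) (B.proj : η.B → M) u)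

/-- The curve `τ ↦ e^τ • u` in `B`, an orbit of the action of `ℝ*`. -/
def orbit (u : η.B) (τ : ℝ) : η.B := Units.mk0 (Real.exp τ) (Real.exp_ne_zero τ) • u

variable (η) in
/-- `α` is an `ℝ*`-connection form on `B`: smooth, invariant and equal to `1` on the fundamental
vector field of the action. -/
structure IsConnection (α : OneForm (E3 × ℝ) η.B) : Prop where
  smooth : α.SmoothOn univ
  invariant : ∀ s : ℝˣ, OneForm.pullback (fun u : η.B ↦ s • u) α = α
  fundamental : ∀ u : η.B,
    α (orbit u 0) (mfderiv 𝓘(ℝ, ℝ) 𝓘(ℝ, E3 × ℝ) (orbit u) 0 (1 : ℝ)) = 1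

variable (η) in
/-- `α` is a connection form satisfying the normalized structure equations
`dω¹ = -α ∧ ω¹ + a₁ ω² ∧ ω³`, `dω² = α ∧ ω² + a₂ ω³ ∧ ω¹`, `dω³ = ω¹ ∧ ω²`. -/
structure IsNormalizedConnection (α : OneForm (E3 × ℝ) η.B) : Prop extends IsConnection η α where
  structure_eq : ∃ a₁ a₂ : η.B → ℝ, ∀ (u : η.B) (v w : TangentSpace 𝓘(ℝ, E3 × ℝ) u),
    (η.taut 0).d u v w = -(α.wedge (η.taut 0) u v w) + a₁ u * (η.taut 1).wedge (η.taut 2) u v w ∧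
    (η.taut 1).d u v w = α.wedge (η.taut 1) u v w + a₂ u * (η.taut 2).wedge (η.taut 0) u v w ∧
    (η.taut 2).d u v w = (η.taut 0).wedge (η.taut 1) u v w

variable (η) in
/-- `K` is the coefficient of `ω¹ ∧ ω²` in
`dα = b₁ ω² ∧ ω³ + b₂ ω³ ∧ ω¹ + K ω¹ ∧ ω²`. -/
def IsCurvature (α : OneForm (E3 × ℝ) η.B) (K : η.B → ℝ) : Prop :=
  ∃ b₁ b₂ : η.B → ℝ, ∀ (u : η.B) (v w : TangentSpace 𝓘(ℝ, E3 × ℝ) u),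
    α.d u v w = b₁ u * (η.taut 1).wedge (η.taut 2) u v w +
      b₂ u * (η.taut 2).wedge (η.taut 0) u v w + K u * (η.taut 0).wedge (η.taut 1) u v w

variable (η) in
/-- The 1-form `σ = -(2/3) α + (1/6) K ω³`. -/
def sigma (α : OneForm (E3 × ℝ) η.B) (K : η.B → ℝ) : OneForm (E3 × ℝ) η.B := fun u ↦
  (-(2 / 3) : ℝ) • α u + (1 / 6 * K u : ℝ) • η.taut 2 u

variable (η) in
/-- The bilinear form `g = ω¹ · ω² + ω³ · σ`. -/
def feffermanMetric (α : OneForm (E3 × ℝ) η.B) (K : η.B → ℝ) : BilinField (E3 × ℝ) η.B := fun u ↦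
  (η.taut 0).symProd (η.taut 1) u + (η.taut 2).symProd (sigma η α K) u

/-! #### The maps `h : B → SD⁺` and `J ∘ h : B → SD⁻` -/

theorem B.exists_mem_L₁ (u : η.B) : ∃ v ∈ P.L₁ u.proj, u.coframe v = ![1, 0, 0] := by
  obtain ⟨w, m, n⟩ := exists_ne_zero_mem_L₁ P u.proj
  have k := u.adapted.first_ne_zero m n
  have z : u.coframe w 2 = 0 := by
    have : w ∈ (η.form u.proj).toLinearMap.ker := by
      rw [η.isContact.ker_eq _ u.adapted.mem_domain]; exact Submodule.mem_sup_left m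
    rw [u.adapted.third]; exact this
  refine ⟨(u.coframe w 0)⁻¹ • w, Submodule.smul_mem _ _ m, ?_⟩
  ext i
  rw [map_smul]
  fin_cases i
  · simp [k]
  · simp [u.adapted.second_L₁ w m]
  · simp [z]

theorem B.exists_mem_L₂ (u : η.B) : ∃ v ∈ P.L₂ u.proj, u.coframe v = ![0, 1, 0] := by
  obtain ⟨w, m, n⟩ := exists_ne_zero_mem_L₂ P u.proj
  have z : u.coframe w 2 = 0 := by
    have : w ∈ (η.form u.proj).toLinearMap.ker := by
      rw [η.isContact.ker_eq _ u.adapted.mem_domain]; exact Submodule.mem_sup_right m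
    rw [u.adapted.third]; exact this
  have z' := u.adapted.first_L₂ w m
  have k : u.coframe w 1 ≠ 0 := by
    intro h0
    refine n (u.adapted.bijective.1 ?_)
    rw [map_zero]
    ext i
    fin_cases i
    · exact z'
    · exact h0
    · exact z
  refine ⟨(u.coframe w 1)⁻¹ • w, Submodule.smul_mem _ _ m, ?_⟩
  ext i
  rw [map_smul]
  fin_cases i
  · simp [z']
  · simp [k]
  · simp [z]

/-- The vector `X = v₁ + v₂ ∈ D` with `u¹(X) = u²(X) = 1` and `u³(X) = 0`. -/
def B.vector (u : η.B) : P.DStar where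
  base := u.proj
  v₁ := u.exists_mem_L₁.choose
  v₂ := u.exists_mem_L₂.choose
  mem₁ := u.exists_mem_L₁.choose_spec.1
  mem₂ := u.exists_mem_L₂.choose_spec.1
  ne₁ := by
    intro h
    have := congrFun u.exists_mem_L₁.choose_spec.2 0
    rw [h] at this
    simp at this
  ne₂ := by
    intro h
    have := congrFun u.exists_mem_L₂.choose_spec.2 1
    rw [h] at this
    simp at this

theorem B.coframe_vector (u : η.B) : u.coframe (u.vector.v₁ + u.vector.v₂) = ![1, 1, 0] := by
  have e₁ : u.coframe u.vector.v₁ = ![1, 0, 0] := u.exists_mem_L₁.choose_spec.2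
  have e₂ : u.coframe u.vector.v₂ = ![0, 1, 0] := u.exists_mem_L₂.choose_spec.2
  refine (map_add u.coframe u.vector.v₁ u.vector.v₂).trans
    ((congrArg₂ (· + ·) e₁ e₂).trans ?_)
  ext i
  fin_cases i <;> simp

variable (η) in
/-- The map `h : B → SD*`, `u ↦ [X]`, where `u¹(X) = u²(X) = 1` and `u³(X) = 0`. -/
def h (u : η.B) : P.SDStar := u.vector.ray

variable (η) in
/-- `SD⁺`, the rays `[X]` over the domain of `η³` with `dη³(JX, X) > 0`. -/
def SDPos : Set P.SDStar :=
  {p | ∃ X : P.DStar, X.ray = p ∧ X.base ∈ η.domain ∧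
    0 < η.form.d X.base (X.v₁ - X.v₂) (X.v₁ + X.v₂)}

variable (η) in
/-- `SD⁻`, the rays `[X]` over the domain of `η³` with `dη³(JX, X) < 0`. -/
def SDNeg : Set P.SDStar :=
  {p | ∃ X : P.DStar, X.ray = p ∧ X.base ∈ η.domain ∧
    η.form.d X.base (X.v₁ - X.v₂) (X.v₁ + X.v₂) < 0}

variable (η) in
/-- `f` is an isomorphism of `ℝ*`-bundles over the domain of `η³` from `B` onto `S ⊆ SD*`:
an equivariant diffeomorphism onto `S` commuting with the projections to `M`. -/
structure IsBundleIso (f : η.B → P.SDStar) (S : Set P.SDStar) : Prop where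
  isLocalDiffeomorph : IsLocalDiffeomorph 𝓘(ℝ, E3 × ℝ) 𝓘(ℝ, E3 × ℝ) ∞ f
  injective : Function.Injective f
  range_eq : range f = S
  proj_eq : ∀ u, (f u).proj = u.proj
  equivariant : ∀ (s : ℝˣ) (u : η.B), f (s • u) = SDStar.act s (f u)

variable (η) in
/-- The part of `SD*` lying over the domain of `η³`. -/
def SDOver : Set P.SDStar := {p | p.proj ∈ η.domain}

variable (η) in
/-- `G` is, over the domain of `η³`, the metric on `SD*` induced by `η³`: the metric
`g = ω¹ · ω² + ω³ · σ` of `B` corresponds to `G` both under `h` and under `J ∘ h`. -/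
def IsInducedMetric (G : BilinField (E3 × ℝ) P.SDStar) : Prop :=
  ∃ (α : OneForm (E3 × ℝ) η.B) (K : η.B → ℝ), η.IsNormalizedConnection α ∧ η.IsCurvature α K ∧
    BilinField.IsPullback η.h G (η.feffermanMetric α K) ∧
    BilinField.IsPullback (fun u : η.B ↦ (η.h u).J) G (η.feffermanMetric α K)

end ContactForm

end PathGeometry

end PathGeometry

end

end PathGeom

open PathGeom

/-! Everything is local over $M$. Given frames $X_1, X_2$ of $L_1, L_2$, the forms $\theta^1 =
d\eta(\cdot,X_2)/d\eta(X_1,X_2)$, $\theta^2 = d\eta(X_1,\cdot)$, $\theta^3=\eta$ make an adapted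
coframe (`localCoframe`), and $\tau(u)=u^1(X_1)$ (`fiberCoord`) trivializes $B$: there
$\omega^1=\tau\theta^1$, $\omega^2=\tau^{-1}\theta^2$, $\omega^3=\theta^3$ (`taut_eq`).

Connection. On $M$ one wants $A$ with $d\theta^1=-A\wedge\theta^1+\dots$ and
$d\theta^2=A\wedge\theta^2+\dots$. Its $\theta^1$ coefficient is read off $d\theta^2$, its
$\theta^2$ coefficient off $d\theta^1$, and its $\theta^3$ coefficient off either one; the two
answers agree because $d(\theta^1\wedge\theta^2)=dd\eta=0$ (`cyclic_of_d_eq_wedge`,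
`exists_structureEq`). Then $\alpha=-d\log|\tau|+\pi^*A$ solves the equations on $B$
(`localStructure`), and $d\alpha=\pi^*dA$ has no $\alpha$-component, whence $K$. Uniqueness is
linear algebra at each point (`eq_of_normalizedAt`). So the connection can be chosen point by point
(`conn`); smoothness comes from the local formula, invariance from uniqueness. The metric has
signature $(2,2)$ because $\omega^1,\omega^2,\omega^3,\sigma$ is a coframe consisting of two null
pairs.

The map $h$. One has $h(u)=[tX_1+X_2]$ exactly when $t\tau^2=d\eta(X_1,X_2)$ and $t\tau>0$
(`h_eq_frameRay_iff`). Solving for $t$ gives smoothness of $h$, solving for $\tau$ by a square root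
gives a smooth inverse on $SD^+$; and $J$ exchanges $SD^+$ and $SD^-$.

Conformal invariance. Write $f=\varepsilon e^{l}$ with $\varepsilon=\pm1$ and $m=e^{l/2}$, and let
$l_1,l_2,l_3$ be the derivatives of $l$ along the frame dual to $\omega^1,\omega^2,\omega^3,\alpha$.
Since $d(f\eta)=df\wedge\eta+f\,d\eta$, the coframe $(m(u^1-l_2u^3),\ \varepsilon m(u^2+l_1u^3),\
\varepsilon m^2u^3)$ is adapted to $f\eta$, which defines a map $\psi$ between the two bundles. The
relations in $ddl=0$ (`frameDeriv_frameDeriv`) show that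
$\alpha+\tfrac32l_1\omega^1-\tfrac32l_2\omega^2+c\,\omega^3$, with $c$ given by `connCoeff`, solves
the rescaled equations, so by uniqueness it is $\psi^*\alpha'$ (`conn_pullback`). This determines
$K'$, and with the weights $-\tfrac23$ and $\tfrac16$ in $\sigma$ all terms in the derivatives of
$l$ cancel: $\psi^*g'=fg$ (`rescaled_metric`, `metric_pullback`). Finally $h'\circ\psi$ is $h$ for
$\varepsilon=1$ and $J\circ h$ for $\varepsilon=-1$ (`h_eq`, `h_eq_J`). As the induced metric is
given by $g$ through both $h$ and $J\circ h$, it is multiplied by $f$ for either sign, and the lines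
it spans do not depend on the contact form. -/

namespace PathGeom

noncomputable section

set_option linter.unusedSectionVars false

/-! ### Exterior calculus in charts: pull-backs, naturality of $d$, and smoothness. -/

section Calculus

variable {V : Type*} [NormedAddCommGroup V] [NormedSpace ℝ V]
  {N : Type*} [TopologicalSpace N] [ChartedSpace V N] [IsManifold 𝓘(ℝ, V) ∞ N]
  {V' : Type*} [NormedAddCommGroup V'] [NormedSpace ℝ V']
  {N' : Type*} [TopologicalSpace N'] [ChartedSpace V' N'] [IsManifold 𝓘(ℝ, V') ∞ N']

/-- Smoothness of a 1-form at a point. -/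
def OneForm.SmoothAt (α : OneForm V N) (x : N) : Prop :=
  ContDiffAt ℝ ∞ (α.inChart x) (extChartAt 𝓘(ℝ, V) x x)

/-- The preferred chart at a point has identity derivative at that point, so the chart derivatives
in the definition of `d` disappear. -/
theorem OneForm.d_apply (α : OneForm V N) (x : N) (v w : TangentSpace 𝓘(ℝ, V) x) :
    α.d x v w = fderiv ℝ (α.inChart x) (extChartAt 𝓘(ℝ, V) x x) v w -
      fderiv ℝ (α.inChart x) (extChartAt 𝓘(ℝ, V) x x) w v := by
  rw [OneForm.d, mfderiv_extChartAt_self]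
  rfl

omit [IsManifold 𝓘(ℝ, V) ∞ N] in
theorem OneForm.inChart_extChartAt (α : OneForm V N) {x y : N}
    (hy : y ∈ (extChartAt 𝓘(ℝ, V) x).source) :
    α.inChart x (extChartAt 𝓘(ℝ, V) x y) =
      (α y).comp (mfderiv 𝓘(ℝ, V) 𝓘(ℝ, V) (extChartAt 𝓘(ℝ, V) x).symm
        (extChartAt 𝓘(ℝ, V) x y)) := by
  -- `α` takes values in a type depending on the point, so the base point is replaced by
  -- substitution after all tangent spaces have been unfolded to `V`.
  have key : ∀ y', y' = y → ∀ L : V →L[ℝ] V, (show V →L[ℝ] ℝ from α y').comp L =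
    (show V →L[ℝ] ℝ from α y).comp L := by rintro _ rfl L; rfl
  exact key _ ((extChartAt 𝓘(ℝ, V) x).left_inv hy) _

/-- The derivatives of a chart and of its inverse cancel. This is the rule for passing between
intrinsic values and the coordinate expression in a fixed chart at nearby points. -/
theorem OneForm.inChart_mfderiv (α : OneForm V N) {x y : N}
    (hy : y ∈ (extChartAt 𝓘(ℝ, V) x).source) (v : TangentSpace 𝓘(ℝ, V) y) :
    α.inChart x (extChartAt 𝓘(ℝ, V) x y)
      (mfderiv 𝓘(ℝ, V) 𝓘(ℝ, V) (extChartAt 𝓘(ℝ, V) x) y v) = α y v := by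
  rw [α.inChart_extChartAt hy]
  have h := mfderivWithin_extChartAt_symm_comp_mfderiv_extChartAt' (I := 𝓘(ℝ, V)) hy
  simp only [modelWithCornersSelf_coe, range_id, mfderivWithin_univ] at h
  exact congrArg (α y) (DFunLike.congr_fun h v)

theorem OneForm.inChart_self (α : OneForm V N) (x : N) :
    α.inChart x (extChartAt 𝓘(ℝ, V) x x) = α x := by
  ext v
  have := α.inChart_mfderiv (mem_extChartAt_source (I := 𝓘(ℝ, V)) x) v
  rw [mfderiv_extChartAt_self] at this
  exact this

theorem eventually_extChartAt_symm {x : N} {p : N → Prop} (h : ∀ᶠ y in 𝓝 x, p y) :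
    ∀ᶠ z in 𝓝 (extChartAt 𝓘(ℝ, V) x x), p ((extChartAt 𝓘(ℝ, V) x).symm z) := by
  have := continuousAt_extChartAt_symm (I := 𝓘(ℝ, V)) x
  rw [ContinuousAt, (extChartAt 𝓘(ℝ, V) x).left_inv (mem_extChartAt_source x)] at this
  exact this.eventually h

theorem eventually_mem_target (x : N) :
    ∀ᶠ z in 𝓝 (extChartAt 𝓘(ℝ, V) x x), z ∈ (extChartAt 𝓘(ℝ, V) x).target :=
  extChartAt_target_mem_nhds x

theorem mfderiv_symm_extChartAt {x : N} {z : V} (hz : z ∈ (extChartAt 𝓘(ℝ, V) x).target) :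
    MDifferentiableAt 𝓘(ℝ, V) 𝓘(ℝ, V) (extChartAt 𝓘(ℝ, V) x).symm z := by
  have h := mdifferentiableWithinAt_extChartAt_symm (I := 𝓘(ℝ, V)) hz
  simpa only [modelWithCornersSelf_coe, range_id, mdifferentiableWithinAt_univ] using h

/-- The coordinate formula $a(F(z))\circ DF(z)$, from the chain rule. It holds only where the charts
are defined, but a germ suffices for derivatives and smoothness. -/
theorem OneForm.pullback_inChart {f : N → N'} {x : N}
    (hf : ContMDiffAt 𝓘(ℝ, V) 𝓘(ℝ, V') ∞ f x) (α : OneForm V' N') :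
    (OneForm.pullback f α).inChart x =ᶠ[𝓝 (extChartAt 𝓘(ℝ, V) x x)]
      fun z ↦ (α.inChart (f x) (writtenInExtChartAt 𝓘(ℝ, V) 𝓘(ℝ, V') x f z)).comp
        (fderiv ℝ (writtenInExtChartAt 𝓘(ℝ, V) 𝓘(ℝ, V') x f) z) := by
  have h1 : ∀ᶠ y in 𝓝 x, MDifferentiableAt 𝓘(ℝ, V) 𝓘(ℝ, V') f y :=
    ((contMDiffAt_iff_contMDiffAt_nhds (by simp)).1
      (hf.of_le (by simp : (1 : ℕ∞ω) ≤ ∞))).mono fun y hy ↦ hy.mdifferentiableAt (by simp)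
  have h2 : ∀ᶠ y in 𝓝 x, f y ∈ (extChartAt 𝓘(ℝ, V') (f x)).source :=
    hf.continuousAt.eventually (extChartAt_source_mem_nhds (I := 𝓘(ℝ, V')) (f x))
  filter_upwards [eventually_extChartAt_symm (V := V) h1,
    eventually_extChartAt_symm (V := V) h2, eventually_mem_target (V := V) x] with z m1 m2 m3
  have e1 := mfderiv_symm_extChartAt m3
  have e2 : MDifferentiableAt 𝓘(ℝ, V') 𝓘(ℝ, V') (extChartAt 𝓘(ℝ, V') (f x))
      (f ((extChartAt 𝓘(ℝ, V) x).symm z)) :=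
    mdifferentiableAt_extChartAt (by simpa using m2)
  have e3 : fderiv ℝ (writtenInExtChartAt 𝓘(ℝ, V) 𝓘(ℝ, V') x f) z =
      (mfderiv 𝓘(ℝ, V') 𝓘(ℝ, V') (extChartAt 𝓘(ℝ, V') (f x))
        (f ((extChartAt 𝓘(ℝ, V) x).symm z))).comp
      ((mfderiv 𝓘(ℝ, V) 𝓘(ℝ, V') f ((extChartAt 𝓘(ℝ, V) x).symm z)).comp
        (mfderiv 𝓘(ℝ, V) 𝓘(ℝ, V) (extChartAt 𝓘(ℝ, V) x).symm z)) := by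
    rw [← mfderiv_eq_fderiv]
    rw [← mfderiv_comp z m1 e1]
    exact mfderiv_comp z e2 (m1.comp z e1)
  ext v
  rw [e3]
  exact (α.inChart_mfderiv m2 _).symm

theorem contDiffAt_writtenInExtChartAt {f : N → N'} {x : N}
    (hf : ContMDiffAt 𝓘(ℝ, V) 𝓘(ℝ, V') ∞ f x) :
    ContDiffAt ℝ ∞ (writtenInExtChartAt 𝓘(ℝ, V) 𝓘(ℝ, V') x f) (extChartAt 𝓘(ℝ, V) x x) := by
  have := (contMDiffAt_iff.1 hf).2
  rw [modelWithCornersSelf_coe, range_id, contDiffWithinAt_univ] at this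
  exact this

theorem writtenInExtChartAt_self (f : N → N') (x : N) :
    writtenInExtChartAt 𝓘(ℝ, V) 𝓘(ℝ, V') x f (extChartAt 𝓘(ℝ, V) x x) =
      extChartAt 𝓘(ℝ, V') (f x) (f x) := by
  simp [writtenInExtChartAt]

theorem mfderiv_eq_fderiv_written {f : N → N'} {x : N}
    (hf : ContMDiffAt 𝓘(ℝ, V) 𝓘(ℝ, V') ∞ f x) :
    mfderiv 𝓘(ℝ, V) 𝓘(ℝ, V') f x =
      fderiv ℝ (writtenInExtChartAt 𝓘(ℝ, V) 𝓘(ℝ, V') x f) (extChartAt 𝓘(ℝ, V) x x) := by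
  have h := hf.mdifferentiableAt (by simp)
  have e : mfderiv 𝓘(ℝ, V) 𝓘(ℝ, V') f x = fderivWithin ℝ
      (writtenInExtChartAt 𝓘(ℝ, V) 𝓘(ℝ, V') x f) (range 𝓘(ℝ, V)) (extChartAt 𝓘(ℝ, V) x x) :=
    if_pos h
  rw [e, modelWithCornersSelf_coe, range_id, fderivWithin_univ]

theorem OneForm.SmoothAt.pullback {f : N → N'} {x : N}
    (hf : ContMDiffAt 𝓘(ℝ, V) 𝓘(ℝ, V') ∞ f x) {α : OneForm V' N'} (hα : α.SmoothAt (f x)) :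
    OneForm.SmoothAt (OneForm.pullback f α : OneForm V N) x := by
  have hF := contDiffAt_writtenInExtChartAt hf
  refine ContDiffAt.congr_of_eventuallyEq ?_ (OneForm.pullback_inChart hf α)
  refine ContDiffAt.clm_comp ?_ (hF.fderiv_right (m := ∞) (by simp))
  refine ContDiffAt.comp (g := α.inChart (f x)) _ ?_ hF
  rw [writtenInExtChartAt_self (V := V) (V' := V')]
  exact hα

/-- The exterior derivative of the pull-back of a 1-form, in normed spaces. -/
theorem fderiv_comp_fderiv_sub {F : V → V'} {z : V} (hF : ContDiffAt ℝ ∞ F z)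
    {a : V' → V' →L[ℝ] ℝ} (ha : DifferentiableAt ℝ a (F z)) (v w : V) :
    fderiv ℝ (fun z ↦ (a (F z)).comp (fderiv ℝ F z)) z v w -
      fderiv ℝ (fun z ↦ (a (F z)).comp (fderiv ℝ F z)) z w v =
    fderiv ℝ a (F z) (fderiv ℝ F z v) (fderiv ℝ F z w) -
      fderiv ℝ a (F z) (fderiv ℝ F z w) (fderiv ℝ F z v) := by
  have hF1 := hF.differentiableAt (by simp)
  have hF2 := (hF.fderiv_right (m := ∞) (by simp)).differentiableAt (by simp)
  -- The term with the second derivative of `F` is symmetric in the two vectors, so it drops out of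
  -- the antisymmetrization; this is why $d$ commutes with pull-back.
  have hs := (hF.isSymmSndFDerivAt (n := ∞) (by simp; exact WithTop.coe_le_coe.2 le_top)).eq v w
  have e := ((ha.hasFDerivAt.comp z hF1.hasFDerivAt).clm_comp hF2.hasFDerivAt).fderiv
  have e' : fderiv ℝ (fun z ↦ (a (F z)).comp (fderiv ℝ F z)) z = _ := e
  rw [e']
  generalize fderiv ℝ (fderiv ℝ F) z = H at hs ⊢
  change (a (F z) (H v w) + fderiv ℝ a (F z) (fderiv ℝ F z v) (fderiv ℝ F z w)) -
    (a (F z) (H w v) + fderiv ℝ a (F z) (fderiv ℝ F z w) (fderiv ℝ F z v)) = _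
  rw [hs]
  ring

theorem OneForm.d_pullback {f : N → N'} {x : N}
    (hf : ContMDiffAt 𝓘(ℝ, V) 𝓘(ℝ, V') ∞ f x) {α : OneForm V' N'} (hα : α.SmoothAt (f x))
    (v w : TangentSpace 𝓘(ℝ, V) x) :
    (OneForm.pullback f α).d x v w =
      α.d (f x) (mfderiv 𝓘(ℝ, V) 𝓘(ℝ, V') f x v) (mfderiv 𝓘(ℝ, V) 𝓘(ℝ, V') f x w) := by
  have hF := contDiffAt_writtenInExtChartAt hf
  rw [OneForm.d_apply, OneForm.d_apply, (OneForm.pullback_inChart hf α).fderiv_eq,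
    mfderiv_eq_fderiv_written hf, ← writtenInExtChartAt_self (V := V) (V' := V') f x]
  refine fderiv_comp_fderiv_sub hF ?_ v w
  rw [writtenInExtChartAt_self (V := V) (V' := V')]
  exact ContDiffAt.differentiableAt hα (by simp)

/-- In the tangent trivialization at `x` a 1-form is exactly its `inChart` expression, so smoothness
as a section of the cotangent bundle is smoothness of a map between normed spaces. -/
theorem OneForm.smoothOn_iff (α : OneForm V N) {U : Set N} (hU : IsOpen U) :
    α.SmoothOn U ↔ ∀ x ∈ U, α.SmoothAt x := by
  have key : ∀ x, ContMDiffAt 𝓘(ℝ, V) (𝓘(ℝ, V).prod 𝓘(ℝ, V →L[ℝ] ℝ)) ∞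
      (fun x ↦ TotalSpace.mk' (V →L[ℝ] ℝ)
        (E := fun x : N ↦ TangentSpace 𝓘(ℝ, V) x →L[ℝ] Bundle.Trivial N ℝ x) x (α x)) x ↔
      α.SmoothAt x := by
    intro x
    rw [contMDiffAt_hom_bundle]
    have e : (fun y ↦ ContinuousLinearMap.inCoordinates V (TangentSpace 𝓘(ℝ, V)) ℝ
        (Bundle.Trivial N ℝ) x y x y (α y)) =ᶠ[𝓝 x]
        fun y ↦ α.inChart x (extChartAt 𝓘(ℝ, V) x y) := by
      filter_upwards [extChartAt_source_mem_nhds (I := 𝓘(ℝ, V)) x] with y hy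
      rw [α.inChart_extChartAt hy]
      have h := TangentBundle.symmL_trivializationAt (I := 𝓘(ℝ, V)) (x₀ := x) (x := y)
        (by simpa using hy)
      rw [modelWithCornersSelf_coe, range_id, mfderivWithin_univ] at h
      rw [ContinuousLinearMap.inCoordinates, h]
      ext v
      simp
      rfl
    constructor
    · rintro ⟨-, h⟩
      have h' := (contMDiffAt_iff.1 (h.congr_of_eventuallyEq e.symm)).2
      rw [modelWithCornersSelf_coe, range_id, contDiffWithinAt_univ] at h'
      refine h'.congr_of_eventuallyEq ?_
      filter_upwards [eventually_mem_target (V := V) x] with z hz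
      change _ = α.inChart x (extChartAt 𝓘(ℝ, V) x ((extChartAt 𝓘(ℝ, V) x).symm z))
      rw [(extChartAt 𝓘(ℝ, V) x).right_inv hz]
    · intro h
      refine ⟨contMDiffAt_id, ContMDiffAt.congr_of_eventuallyEq ?_ e⟩
      exact (ContDiffAt.contMDiffAt h).comp x contMDiffAt_extChartAt
  refine ⟨fun h x hx ↦ (key x).1 (h.contMDiffAt (hU.mem_nhds hx)),
    fun h x hx ↦ ((key x).2 (h x hx)).contMDiffWithinAt⟩

end Calculus
end
end PathGeom

/-! ### Leibniz rule, $dd=0$, independence of the chart, and evaluation on vector fields. -/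

namespace PathGeom

noncomputable section

set_option linter.unusedSectionVars false

set_option synthInstance.maxHeartbeats 200000 in
theorem contDiffAt_flip_comp {V E : Type*} [NormedAddCommGroup V] [NormedSpace ℝ V]
    [NormedAddCommGroup E] [NormedSpace ℝ E] {A : E → V →L[ℝ] V →L[ℝ] ℝ} {z : E}
    (hA : ContDiffAt ℝ ∞ A z) : ContDiffAt ℝ ∞ (fun z ↦ (A z).flip) z := by
  have hf : IsBoundedLinearMap ℝ (fun L : V →L[ℝ] V →L[ℝ] ℝ ↦ L.flip) :=
    ⟨⟨fun _ _ ↦ rfl, fun _ _ ↦ rfl⟩, 1, one_pos, fun L ↦ by simp⟩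
  have h : ContDiff ℝ ∞ (fun L : V →L[ℝ] V →L[ℝ] ℝ ↦ L.flip) := IsBoundedLinearMap.contDiff hf
  exact h.contDiffAt.comp z hA

section Calculus

variable {V : Type*} [NormedAddCommGroup V] [NormedSpace ℝ V]
  {N : Type*} [TopologicalSpace N] [ChartedSpace V N] [IsManifold 𝓘(ℝ, V) ∞ N]
  {V' : Type*} [NormedAddCommGroup V'] [NormedSpace ℝ V']
  {N' : Type*} [TopologicalSpace N'] [ChartedSpace V' N'] [IsManifold 𝓘(ℝ, V') ∞ N']

theorem contMDiffAt_iff_contDiffAt_symm {F : Type*} [NormedAddCommGroup F] [NormedSpace ℝ F]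
    (f : N → F) (x : N) : ContMDiffAt 𝓘(ℝ, V) 𝓘(ℝ, F) ∞ f x ↔
      ContDiffAt ℝ ∞ (fun z ↦ f ((extChartAt 𝓘(ℝ, V) x).symm z)) (extChartAt 𝓘(ℝ, V) x x) := by
  constructor
  · intro h
    have h' := (contMDiffAt_iff.1 h).2
    rw [modelWithCornersSelf_coe, range_id, contDiffWithinAt_univ] at h'
    exact h'
  · intro h
    refine ((ContDiffAt.contMDiffAt h).comp x contMDiffAt_extChartAt).congr_of_eventuallyEq ?_
    filter_upwards [extChartAt_source_mem_nhds (I := 𝓘(ℝ, V)) x] with y hy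
    change f y = f ((extChartAt 𝓘(ℝ, V) x).symm (extChartAt 𝓘(ℝ, V) x y))
    rw [(extChartAt 𝓘(ℝ, V) x).left_inv hy]

theorem mfderiv_eq_fderiv_symm {f : N → ℝ} {x : N} (hf : ContMDiffAt 𝓘(ℝ, V) 𝓘(ℝ, ℝ) ∞ f x) :
    mfderiv 𝓘(ℝ, V) 𝓘(ℝ, ℝ) f x =
      fderiv ℝ (fun z ↦ f ((extChartAt 𝓘(ℝ, V) x).symm z)) (extChartAt 𝓘(ℝ, V) x x) :=
  mfderiv_eq_fderiv_written hf

theorem OneForm.inChart_congr {α β : OneForm V N} {x : N} (h : ∀ᶠ y in 𝓝 x, α y = β y) :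
    α.inChart x =ᶠ[𝓝 (extChartAt 𝓘(ℝ, V) x x)] β.inChart x := by
  filter_upwards [eventually_extChartAt_symm (V := V) h] with z hz
  rw [OneForm.inChart, OneForm.inChart, hz]

theorem OneForm.SmoothAt.congr {α β : OneForm V N} {x : N} (hα : α.SmoothAt x)
    (h : ∀ᶠ y in 𝓝 x, β y = α y) : β.SmoothAt x :=
  ContDiffAt.congr_of_eventuallyEq hα (OneForm.inChart_congr h)

theorem OneForm.d_congr {α β : OneForm V N} {x : N} (h : ∀ᶠ y in 𝓝 x, α y = β y)
    (v w : TangentSpace 𝓘(ℝ, V) x) : α.d x v w = β.d x v w := by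
  rw [OneForm.d_apply, OneForm.d_apply, (OneForm.inChart_congr h).fderiv_eq]

/-- The sum of two 1-forms. -/
def OneForm.add (α β : OneForm V N) : OneForm V N := fun y ↦ α y + β y

/-- The product of a 1-form by a function. -/
def OneForm.fmul (f : N → ℝ) (α : OneForm V N) : OneForm V N := fun y ↦ f y • α y

/-- The differential of a function, as a 1-form. -/
def dform (f : N → ℝ) : OneForm V N := fun y ↦ mfderiv 𝓘(ℝ, V) 𝓘(ℝ, ℝ) f y

theorem OneForm.add_apply (α β : OneForm V N) (x : N) (v : TangentSpace 𝓘(ℝ, V) x) :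
    α.add β x v = α x v + β x v := rfl

theorem OneForm.fmul_apply (f : N → ℝ) (α : OneForm V N) (x : N) (v : TangentSpace 𝓘(ℝ, V) x) :
    OneForm.fmul f α x v = f x * α x v := rfl

theorem OneForm.inChart_add (α β : OneForm V N) (x : N) :
    (α.add β).inChart x = fun z ↦ α.inChart x z + β.inChart x z := rfl

theorem OneForm.inChart_fmul (f : N → ℝ) (α : OneForm V N) (x : N) :
    (OneForm.fmul f α).inChart x =
      fun z ↦ f ((extChartAt 𝓘(ℝ, V) x).symm z) • α.inChart x z := rfl

theorem OneForm.SmoothAt.add {α β : OneForm V N} {x : N} (hα : α.SmoothAt x)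
    (hβ : β.SmoothAt x) : (α.add β).SmoothAt x :=
  ContDiffAt.add hα hβ

theorem OneForm.SmoothAt.fmul {f : N → ℝ} {α : OneForm V N} {x : N}
    (hf : ContMDiffAt 𝓘(ℝ, V) 𝓘(ℝ, ℝ) ∞ f x) (hα : α.SmoothAt x) :
    (OneForm.fmul f α).SmoothAt x :=
  ContDiffAt.smul ((contMDiffAt_iff_contDiffAt_symm f x).1 hf) hα

theorem OneForm.d_add {α β : OneForm V N} {x : N} (hα : α.SmoothAt x) (hβ : β.SmoothAt x)
    (v w : TangentSpace 𝓘(ℝ, V) x) : (α.add β).d x v w = α.d x v w + β.d x v w := by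
  have e := fderiv_fun_add (ContDiffAt.differentiableAt hα (by simp))
    (ContDiffAt.differentiableAt hβ (by simp))
  simp only [OneForm.d_apply, OneForm.inChart_add]
  rw [e]
  generalize fderiv ℝ (α.inChart x) _ = A
  generalize fderiv ℝ (β.inChart x) _ = B
  change (A v w + B v w) - (A w v + B w v) = _
  ring

theorem OneForm.d_fmul {f : N → ℝ} {α : OneForm V N} {x : N}
    (hf : ContMDiffAt 𝓘(ℝ, V) 𝓘(ℝ, ℝ) ∞ f x) (hα : α.SmoothAt x)
    (v w : TangentSpace 𝓘(ℝ, V) x) :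
    (OneForm.fmul f α).d x v w = (dform f).wedge α x v w + f x * α.d x v w := by
  have hf' := (contMDiffAt_iff_contDiffAt_symm f x).1 hf
  have e := fderiv_fun_smul (hf'.differentiableAt (by simp))
    (ContDiffAt.differentiableAt hα (by simp))
  have e0 : f ((extChartAt 𝓘(ℝ, V) x).symm (extChartAt 𝓘(ℝ, V) x x)) = f x := by
    rw [(extChartAt 𝓘(ℝ, V) x).left_inv (mem_extChartAt_source x)]
  simp only [OneForm.d_apply, OneForm.inChart_fmul, OneForm.wedge, dform]
  rw [mfderiv_eq_fderiv_symm hf, e, e0, α.inChart_self]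
  have key : ∀ (A : V →L[ℝ] V →L[ℝ] ℝ) (B a : V →L[ℝ] ℝ) (c : ℝ) (v w : V),
      (c • A + B.smulRight a) v w - (c • A + B.smulRight a) w v =
        B v * a w - B w * a v + c * (A v w - A w v) := by
    intro A B a c v w
    change (c * A v w + B v * a w) - (c * A w v + B w * a v) = _
    ring
  exact key _ _ _ _ v w

/-- A 1-form on a normed space, viewed as a manifold. -/
def modelForm (a : V → V →L[ℝ] ℝ) : OneForm V V := a

theorem inChart_modelForm (a : V → V →L[ℝ] ℝ) (x : V) : (modelForm a).inChart x = a := by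
  funext z
  have h : mfderiv 𝓘(ℝ, V) 𝓘(ℝ, V) (id : V → V) z = ContinuousLinearMap.id ℝ V := mfderiv_id
  exact congrArg (fun L : V →L[ℝ] V ↦ (a z).comp L) h

theorem modelForm_smoothAt {a : V → V →L[ℝ] ℝ} {x : V} :
    (modelForm a).SmoothAt x ↔ ContDiffAt ℝ ∞ a x := by
  rw [OneForm.SmoothAt, inChart_modelForm]
  rfl

theorem d_modelForm (a : V → V →L[ℝ] ℝ) (x : V) (v w : TangentSpace 𝓘(ℝ, V) x) :
    (modelForm a).d x v w = fderiv ℝ a x v w - fderiv ℝ a x w v := by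
  rw [OneForm.d_apply, inChart_modelForm]
  rfl

/-- The coordinate 1-form on `ℝ`. -/
def dt : OneForm ℝ ℝ := modelForm fun _ ↦ ContinuousLinearMap.id ℝ ℝ

/-- Writing $df=f^*dt$ makes both the smoothness of $df$ and $ddf=0$ instances of naturality. -/
theorem dform_eq_pullback (f : N → ℝ) : (dform f : OneForm V N) = OneForm.pullback f dt := by
  funext y
  ext v
  rfl

theorem dt_smoothAt (t : ℝ) : dt.SmoothAt t :=
  modelForm_smoothAt.2 contDiffAt_const

theorem dform_smoothAt {f : N → ℝ} {x : N} (hf : ContMDiffAt 𝓘(ℝ, V) 𝓘(ℝ, ℝ) ∞ f x) :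
    (dform f : OneForm V N).SmoothAt x := by
  rw [dform_eq_pullback]
  exact OneForm.SmoothAt.pullback hf (dt_smoothAt _)

theorem d_dform {f : N → ℝ} {x : N} (hf : ContMDiffAt 𝓘(ℝ, V) 𝓘(ℝ, ℝ) ∞ f x)
    (v w : TangentSpace 𝓘(ℝ, V) x) : (dform f : OneForm V N).d x v w = 0 := by
  rw [dform_eq_pullback, OneForm.d_pullback hf (dt_smoothAt _)]
  refine (d_modelForm _ _ _ _).trans ?_
  rw [fderiv_const_apply]
  exact sub_self _

theorem contMDiffAt_extChartAt_symm_of_mem {x y : N}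
    (hy : y ∈ (extChartAt 𝓘(ℝ, V) x).source) :
    ContMDiffAt 𝓘(ℝ, V) 𝓘(ℝ, V) ∞ (extChartAt 𝓘(ℝ, V) x).symm (extChartAt 𝓘(ℝ, V) x y) :=
  (contMDiffOn_extChartAt_symm x).contMDiffAt
    (extChartAt_target_mem_nhds' ((extChartAt 𝓘(ℝ, V) x).map_source hy))

theorem OneForm.SmoothAt.inChart_of_mem {α : OneForm V N} {x y : N}
    (hy : y ∈ (extChartAt 𝓘(ℝ, V) x).source) (hα : α.SmoothAt y) :
    ContDiffAt ℝ ∞ (α.inChart x) (extChartAt 𝓘(ℝ, V) x y) := by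
  refine modelForm_smoothAt.1 ?_
  have h := contMDiffAt_extChartAt_symm_of_mem hy
  have e := (extChartAt 𝓘(ℝ, V) x).left_inv hy
  exact OneForm.SmoothAt.pullback h (e.symm ▸ hα)

/-- The exterior derivative at a nearby point, read in a fixed chart. -/
theorem OneForm.d_inChart (α : OneForm V N) {x y : N} (hy : y ∈ (extChartAt 𝓘(ℝ, V) x).source)
    (hα : α.SmoothAt y) (v w : TangentSpace 𝓘(ℝ, V) y) :
    α.d y v w =
      fderiv ℝ (α.inChart x) (extChartAt 𝓘(ℝ, V) x y)
        (mfderiv 𝓘(ℝ, V) 𝓘(ℝ, V) (extChartAt 𝓘(ℝ, V) x) y v)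
        (mfderiv 𝓘(ℝ, V) 𝓘(ℝ, V) (extChartAt 𝓘(ℝ, V) x) y w) -
      fderiv ℝ (α.inChart x) (extChartAt 𝓘(ℝ, V) x y)
        (mfderiv 𝓘(ℝ, V) 𝓘(ℝ, V) (extChartAt 𝓘(ℝ, V) x) y w)
        (mfderiv 𝓘(ℝ, V) 𝓘(ℝ, V) (extChartAt 𝓘(ℝ, V) x) y v) := by
  -- Near `y` the form is the pull-back, by the chart at `x`, of its own coordinate expression;
  -- naturality then shows that `d` may be computed in a chart centred elsewhere.
  have h1 : ∀ᶠ y' in 𝓝 y, α y' =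
      OneForm.pullback (extChartAt 𝓘(ℝ, V) x) (modelForm (α.inChart x)) y' := by
    filter_upwards [extChartAt_source_mem_nhds' (I := 𝓘(ℝ, V)) hy] with y' hy'
    ext v
    exact (α.inChart_mfderiv hy' v).symm
  rw [OneForm.d_congr h1, OneForm.d_pullback
    (contMDiffAt_extChartAt' (by simpa using hy))
    (modelForm_smoothAt.2 (hα.inChart_of_mem hy)), d_modelForm]

/-- Smoothness of a vector field at a point. -/
def SmoothVFieldAt (Y : ∀ x : N, TangentSpace 𝓘(ℝ, V) x) (x : N) : Prop :=
  ContDiffAt ℝ ∞ (fun z ↦ (show V from mfderiv 𝓘(ℝ, V) 𝓘(ℝ, V) (extChartAt 𝓘(ℝ, V) x)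
    ((extChartAt 𝓘(ℝ, V) x).symm z) (Y ((extChartAt 𝓘(ℝ, V) x).symm z))))
    (extChartAt 𝓘(ℝ, V) x x)

theorem smoothVFieldAt_of_section {Y : ∀ x : N, TangentSpace 𝓘(ℝ, V) x} {x : N}
    (h : ContMDiffAt 𝓘(ℝ, V) 𝓘(ℝ, V).tangent ∞
      (fun x ↦ (⟨x, Y x⟩ : TangentBundle 𝓘(ℝ, V) N)) x) : SmoothVFieldAt Y x := by
  have h' := (contMDiffAt_iff_contDiffAt_symm _ _).1 ((contMDiffAt_section (IB := 𝓘(ℝ, V))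
    (F := V) (n := ∞) (E := (TangentSpace 𝓘(ℝ, V) : N → Type _)) (s := Y) x).1 h)
  refine h'.congr_of_eventuallyEq ?_
  filter_upwards [eventually_extChartAt_symm (V := V)
    (extChartAt_source_mem_nhds (I := 𝓘(ℝ, V)) x)] with z hz
  have e := TangentBundle.continuousLinearMapAt_trivializationAt (I := 𝓘(ℝ, V)) (x₀ := x)
    (x := (extChartAt 𝓘(ℝ, V) x).symm z) (extChartAt_source 𝓘(ℝ, V) x ▸ hz)
  refine (DFunLike.congr_fun e.symm (Y _)).trans ?_
  exact congrFun (Trivialization.coe_linearMapAt_of_mem (R := ℝ)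
    (trivializationAt V (TangentSpace 𝓘(ℝ, V)) x) (b := (extChartAt 𝓘(ℝ, V) x).symm z)
    (show _ ∈ (chartAt V x).source from extChartAt_source 𝓘(ℝ, V) x ▸ hz)) (Y _)

theorem OneForm.SmoothAt.apply_vField {α : OneForm V N} {x : N} (hα : α.SmoothAt x)
    {Y : ∀ x : N, TangentSpace 𝓘(ℝ, V) x} (hY : SmoothVFieldAt Y x) :
    ContMDiffAt 𝓘(ℝ, V) 𝓘(ℝ, ℝ) ∞ (fun y ↦ α y (Y y)) x := by
  rw [contMDiffAt_iff_contDiffAt_symm]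
  refine (ContDiffAt.clm_apply hα hY).congr_of_eventuallyEq ?_
  filter_upwards [eventually_extChartAt_symm (V := V)
    (extChartAt_source_mem_nhds (I := 𝓘(ℝ, V)) x), eventually_mem_target (V := V) x] with z hz hz'
  rw [← α.inChart_mfderiv hz, (extChartAt 𝓘(ℝ, V) x).right_inv hz']

theorem OneForm.smoothAt_d_vField {α : OneForm V N} {x : N} (hα : ∀ᶠ y in 𝓝 x, α.SmoothAt y)
    {Y Z : ∀ x : N, TangentSpace 𝓘(ℝ, V) x} (hY : SmoothVFieldAt Y x) (hZ : SmoothVFieldAt Z x) :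
    ContMDiffAt 𝓘(ℝ, V) 𝓘(ℝ, ℝ) ∞ (fun y ↦ α.d y (Y y) (Z y)) x := by
  rw [contMDiffAt_iff_contDiffAt_symm]
  have hD : ContDiffAt ℝ ∞ (fderiv ℝ (α.inChart x)) (extChartAt 𝓘(ℝ, V) x x) :=
    ContDiffAt.fderiv_right hα.self_of_nhds (by simp)
  refine (((hD.clm_apply hY).clm_apply hZ).sub
    ((hD.clm_apply hZ).clm_apply hY)).congr_of_eventuallyEq ?_
  filter_upwards [eventually_extChartAt_symm (V := V)
    (extChartAt_source_mem_nhds (I := 𝓘(ℝ, V)) x), eventually_mem_target (V := V) x,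
    eventually_extChartAt_symm (V := V) hα] with z hz hz' h
  rw [α.d_inChart hz h, (extChartAt 𝓘(ℝ, V) x).right_inv hz']

/-- The contraction of `dα` with a vector field. -/
def OneForm.contractD (α : OneForm V N) (Y : ∀ x : N, TangentSpace 𝓘(ℝ, V) x) : OneForm V N :=
  fun x ↦ ((fderiv ℝ (α.inChart x) (extChartAt 𝓘(ℝ, V) x x) (Y x) -
    (fderiv ℝ (α.inChart x) (extChartAt 𝓘(ℝ, V) x x)).flip (Y x) : V →L[ℝ] ℝ))

theorem OneForm.contractD_apply (α : OneForm V N) (Y : ∀ x : N, TangentSpace 𝓘(ℝ, V) x) (x : N)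
    (v : TangentSpace 𝓘(ℝ, V) x) : α.contractD Y x v = α.d x (Y x) v := by
  rw [OneForm.d_apply]
  rfl

theorem OneForm.contractD_smoothAt {α : OneForm V N} {x : N} (hα : ∀ᶠ y in 𝓝 x, α.SmoothAt y)
    {Y : ∀ x : N, TangentSpace 𝓘(ℝ, V) x} (hY : SmoothVFieldAt Y x) :
    (α.contractD Y).SmoothAt x := by
  have hD : ContDiffAt ℝ ∞ (fderiv ℝ (α.inChart x)) (extChartAt 𝓘(ℝ, V) x x) :=
    ContDiffAt.fderiv_right hα.self_of_nhds (by simp)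
  have hD' : ContDiffAt ℝ ∞ (fun z ↦ (fderiv ℝ (α.inChart x) z).flip)
      (extChartAt 𝓘(ℝ, V) x x) :=
    contDiffAt_flip_comp hD
  refine ((hD.clm_apply hY).sub (hD'.clm_apply hY)).congr_of_eventuallyEq ?_
  filter_upwards [eventually_extChartAt_symm (V := V)
    (extChartAt_source_mem_nhds (I := 𝓘(ℝ, V)) x), eventually_mem_target (V := V) x,
    eventually_extChartAt_symm (V := V) hα] with z hz hz' h
  ext v
  have e := (α.contractD Y).inChart_extChartAt hz
  rw [(extChartAt 𝓘(ℝ, V) x).right_inv hz'] at e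
  rw [e]
  refine (α.contractD_apply Y _ _).trans ?_
  rw [α.d_inChart hz h, (extChartAt 𝓘(ℝ, V) x).right_inv hz']
  have h2 := mfderiv_extChartAt_comp_mfderivWithin_extChartAt_symm (I := 𝓘(ℝ, V)) hz'
  simp only [modelWithCornersSelf_coe, range_id, mfderivWithin_univ] at h2
  have h3 := DFunLike.congr_fun h2 v
  have h4 : mfderiv 𝓘(ℝ, V) 𝓘(ℝ, V) (extChartAt 𝓘(ℝ, V) x) ((extChartAt 𝓘(ℝ, V) x).symm z)
    (mfderiv 𝓘(ℝ, V) 𝓘(ℝ, V) (extChartAt 𝓘(ℝ, V) x).symm z v) = v := h3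
  have key : ∀ (A : V →L[ℝ] V →L[ℝ] ℝ) (y v v' : V), v' = v →
      A y v' - A v' y = (A y - A.flip y) v := by
    rintro A y v _ rfl
    rfl
  exact key _ _ _ _ h4

end Calculus
end
end PathGeom

/-! ### Coframes, dual frames, and the closedness of $\theta_1\wedge\theta_2$. -/

namespace PathGeom

noncomputable section

set_option linter.unusedSectionVars false

section Calculus

variable {V : Type*} [NormedAddCommGroup V] [NormedSpace ℝ V]
  {N : Type*} [TopologicalSpace N] [ChartedSpace V N] [IsManifold 𝓘(ℝ, V) ∞ N]

/-- Smooth families of 1-forms `θ i`, assembled in a linear map `T_xN → ℝⁿ`. -/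
def coframeMap {n : ℕ} (θ : Fin n → OneForm V N) (x : N) :
    TangentSpace 𝓘(ℝ, V) x →L[ℝ] (Fin n → ℝ) :=
  ContinuousLinearMap.pi fun i ↦ θ i x

theorem coframeMap_apply {n : ℕ} (θ : Fin n → OneForm V N) (x : N)
    (v : TangentSpace 𝓘(ℝ, V) x) (i : Fin n) : coframeMap θ x v i = θ i x v := rfl

/-- The frame dual to the coframe `θ` (at the points where `θ` is a coframe). -/
def dualFrame {n : ℕ} (θ : Fin n → OneForm V N) (j : Fin n) (x : N) : TangentSpace 𝓘(ℝ, V) x :=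
  (coframeMap θ x).inverse (Pi.single j 1)

theorem apply_dualFrame {n : ℕ} {θ : Fin n → OneForm V N} {x : N}
    (h : (coframeMap θ x).IsInvertible) (i j : Fin n) :
    θ i x (dualFrame θ j x) = if i = j then 1 else 0 := by
  rw [← coframeMap_apply, dualFrame, h.self_apply_inverse, Pi.single_apply]

theorem eq_sum_dualFrame {n : ℕ} {θ : Fin n → OneForm V N} {x : N}
    (h : (coframeMap θ x).IsInvertible) (v : TangentSpace 𝓘(ℝ, V) x) :
    v = ∑ j, θ j x v • dualFrame θ j x := by
  have e : ∑ j, θ j x v • dualFrame θ j x = (coframeMap θ x).inverse (coframeMap θ x v) := by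
    rw [pi_eq_sum_univ' (coframeMap θ x v), map_sum]
    refine Finset.sum_congr rfl fun j _ ↦ ?_
    rw [map_smul, coframeMap_apply, dualFrame]
  rw [e, h.inverse_apply_self]

theorem coframeMap_isInvertible [FiniteDimensional ℝ V] {n : ℕ} (hn : Module.finrank ℝ V = n)
    {θ : Fin n → OneForm V N} {x : N}
    (h : ∀ v : TangentSpace 𝓘(ℝ, V) x, (∀ i, θ i x v = 0) → v = 0) :
    (coframeMap θ x).IsInvertible := by
  have key : ∀ L : V →L[ℝ] (Fin n → ℝ), (∀ v, L v = 0 → v = 0) → L.IsInvertible := by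
    intro L hL
    have inj : Function.Injective L := (injective_iff_map_eq_zero L).2 hL
    have sur := (LinearMap.injective_iff_surjective_of_finrank_eq_finrank
      (f := L.toLinearMap) (by rw [hn]; simp)).1 inj
    refine ⟨(LinearEquiv.ofBijective L.toLinearMap ⟨inj, sur⟩).toContinuousLinearEquiv, ?_⟩
    ext v
    rfl
  exact key _ fun v hv ↦ h v fun i ↦ congrFun hv i

theorem coframeMap_inChart {n : ℕ} (θ : Fin n → OneForm V N) {x y : N}
    (hy : y ∈ (extChartAt 𝓘(ℝ, V) x).source) :
    coframeMap θ y = (ContinuousLinearMap.pi fun i ↦ (θ i).inChart x (extChartAt 𝓘(ℝ, V) x y) :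
      V →L[ℝ] (Fin n → ℝ)).comp (mfderiv 𝓘(ℝ, V) 𝓘(ℝ, V) (extChartAt 𝓘(ℝ, V) x) y) := by
  ext v i
  exact ((θ i).inChart_mfderiv hy v).symm

theorem isInvertible_mfderiv_extChartAt' {x y : N} (hy : y ∈ (extChartAt 𝓘(ℝ, V) x).source) :
    ((mfderiv 𝓘(ℝ, V) 𝓘(ℝ, V) (extChartAt 𝓘(ℝ, V) x) y : TangentSpace 𝓘(ℝ, V) y →L[ℝ]
      TangentSpace 𝓘(ℝ, V) (extChartAt 𝓘(ℝ, V) x y))).IsInvertible :=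
  isInvertible_mfderiv_extChartAt hy

/-- The coframe matrix in a chart. -/
def coframeChart {n : ℕ} (θ : Fin n → OneForm V N) (x : N) (z : V) : V →L[ℝ] (Fin n → ℝ) :=
  ContinuousLinearMap.pi fun i ↦ (θ i).inChart x z

theorem coframeChart_self {n : ℕ} (θ : Fin n → OneForm V N) (x : N) :
    coframeChart θ x (extChartAt 𝓘(ℝ, V) x x) = coframeMap θ x := by
  ext v i
  exact DFunLike.congr_fun ((θ i).inChart_self x) v

theorem coframeChart_contDiffAt {n : ℕ} {θ : Fin n → OneForm V N} {x : N}
    (hθ : ∀ i, (θ i).SmoothAt x) :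
    ContDiffAt ℝ ∞ (coframeChart θ x) (extChartAt 𝓘(ℝ, V) x x) := by
  have e : coframeChart θ x =
      fun z ↦ ∑ i, ((θ i).inChart x z).smulRight (Pi.single i (1 : ℝ) : Fin n → ℝ) := by
    funext z
    ext v i
    simp [coframeChart, Finset.sum_apply, Pi.single_apply]
  rw [e]
  exact ContDiffAt.sum fun i _ ↦ ContDiffAt.smulRight (hθ i) contDiffAt_const

/-- Inversion of continuous linear maps is smooth at an invertible one, and in a chart the dual
frame is the inverse coframe matrix applied to a fixed vector: the derivative of the chart cancels.
-/
theorem smoothVFieldAt_dualFrame [CompleteSpace V] {n : ℕ} {θ : Fin n → OneForm V N} {x : N}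
    (hθ : ∀ i, (θ i).SmoothAt x) (h : (coframeMap θ x).IsInvertible) (j : Fin n) :
    SmoothVFieldAt (dualFrame θ j) x := by
  have h0 : (coframeChart θ x (extChartAt 𝓘(ℝ, V) x x)).IsInvertible := by
    rw [coframeChart_self]; exact h
  have h1 : ContDiffAt ℝ ∞ (fun z ↦ (coframeChart θ x z).inverse (Pi.single j 1))
      (extChartAt 𝓘(ℝ, V) x x) :=
    (h0.contDiffAt_map_inverse.comp _ (coframeChart_contDiffAt hθ)).clm_apply contDiffAt_const
  refine h1.congr_of_eventuallyEq ?_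
  filter_upwards [eventually_extChartAt_symm (V := V)
    (extChartAt_source_mem_nhds (I := 𝓘(ℝ, V)) x), eventually_mem_target (V := V) x] with z hz hz'
  have e := coframeMap_inChart θ hz
  have e' : coframeMap θ ((extChartAt 𝓘(ℝ, V) x).symm z) = (coframeChart θ x z).comp
    (mfderiv 𝓘(ℝ, V) 𝓘(ℝ, V) (extChartAt 𝓘(ℝ, V) x) ((extChartAt 𝓘(ℝ, V) x).symm z)) := by
    rw [e, (extChartAt 𝓘(ℝ, V) x).right_inv hz']
    rfl
  have hi := isInvertible_mfderiv_extChartAt' hz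
  have key : ∀ (L : V →L[ℝ] V) (A : V →L[ℝ] (Fin n → ℝ)) (w : Fin n → ℝ), L.IsInvertible →
      L ((A.comp L).inverse w) = A.inverse w := by
    intro L A w hL
    rw [hL.inverse_comp_apply_of_right, hL.self_apply_inverse]
  have := key _ (coframeChart θ x z) (Pi.single j 1) hi
  rw [← this]
  change mfderiv 𝓘(ℝ, V) 𝓘(ℝ, V) (extChartAt 𝓘(ℝ, V) x)
    ((extChartAt 𝓘(ℝ, V) x).symm z) (dualFrame θ j _) = _
  rw [dualFrame, e']
  rfl

/-- Being a coframe is an open condition. -/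
theorem eventually_isInvertible [CompleteSpace V] {n : ℕ} {θ : Fin n → OneForm V N} {x : N}
    (hθ : ∀ i, (θ i).SmoothAt x) (h : (coframeMap θ x).IsInvertible) :
    ∀ᶠ y in 𝓝 x, (coframeMap θ y).IsInvertible := by
  obtain ⟨e, he⟩ : (coframeChart θ x (extChartAt 𝓘(ℝ, V) x x)).IsInvertible := by
    rw [coframeChart_self]; exact h
  have hc : ContinuousAt (fun y ↦ coframeChart θ x (extChartAt 𝓘(ℝ, V) x y)) x :=
    ContinuousAt.comp (g := coframeChart θ x) (coframeChart_contDiffAt hθ).continuousAt (continuousAt_extChartAt x)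
  have hn := ContinuousLinearEquiv.nhds e
  rw [he] at hn
  filter_upwards [hc hn, extChartAt_source_mem_nhds (I := 𝓘(ℝ, V)) x] with y hy hy'
  rw [coframeMap_inChart θ hy']
  obtain ⟨e', he'⟩ := hy
  have key : ∀ (L : V →L[ℝ] V) (A : V →L[ℝ] (Fin n → ℝ)), L.IsInvertible → A.IsInvertible →
      (A.comp L).IsInvertible := fun L A hL hA ↦ hA.comp hL
  exact key _ _ (isInvertible_mfderiv_extChartAt' hy') ⟨e', he'⟩

/-- The coefficient is the value of `β` on a vector of the smooth dual frame, near the point. -/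
theorem coeff_smoothAt [CompleteSpace V] {n : ℕ} {θ : Fin n → OneForm V N} {x : N}
    (hθ : ∀ i, (θ i).SmoothAt x) (h : (coframeMap θ x).IsInvertible) {β : OneForm V N}
    (hβ : β.SmoothAt x) {c : Fin n → N → ℝ}
    (hc : ∀ᶠ y in 𝓝 x, ∀ v, β y v = ∑ i, c i y * θ i y v) (j : Fin n) :
    ContMDiffAt 𝓘(ℝ, V) 𝓘(ℝ, ℝ) ∞ (c j) x := by
  refine (hβ.apply_vField (smoothVFieldAt_dualFrame hθ h j)).congr_of_eventuallyEq ?_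
  filter_upwards [hc, eventually_isInvertible hθ h] with y h1 h2
  rw [h1]
  simp [apply_dualFrame h2]

/-- This is $0=dda=d(b_1\wedge b_2)$ in coordinates. The hypothesis is differentiated with the other
two vectors held constant; in the cyclic sum the second derivatives of `a` cancel by symmetry. -/
theorem cyclic_of_fderiv {a b₁ b₂ : V → V →L[ℝ] ℝ} {z : V} (ha : ContDiffAt ℝ ∞ a z)
    (h₁ : DifferentiableAt ℝ b₁ z) (h₂ : DifferentiableAt ℝ b₂ z)
    (h : ∀ᶠ z in 𝓝 z, ∀ v w, fderiv ℝ a z v w - fderiv ℝ a z w v =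
      b₁ z v * b₂ z w - b₁ z w * b₂ z v) (u v w : V) :
    ((fderiv ℝ b₁ z u v - fderiv ℝ b₁ z v u) * b₂ z w +
      (fderiv ℝ b₁ z v w - fderiv ℝ b₁ z w v) * b₂ z u +
      (fderiv ℝ b₁ z w u - fderiv ℝ b₁ z u w) * b₂ z v) -
    ((fderiv ℝ b₂ z u v - fderiv ℝ b₂ z v u) * b₁ z w +
      (fderiv ℝ b₂ z v w - fderiv ℝ b₂ z w v) * b₁ z u +
      (fderiv ℝ b₂ z w u - fderiv ℝ b₂ z u w) * b₁ z v) = 0 := by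
  have hD : DifferentiableAt ℝ (fderiv ℝ a) z :=
    (ContDiffAt.fderiv_right (m := ∞) ha (by simp)).differentiableAt (by simp)
  have hs := fun v w ↦ (ha.isSymmSndFDerivAt (n := ∞)
    (by simp; exact WithTop.coe_le_coe.2 le_top)).eq v w
  have E : ∀ u v w : V, fderiv ℝ (fderiv ℝ a) z u v w - fderiv ℝ (fderiv ℝ a) z u w v =
      (fderiv ℝ b₁ z u v * b₂ z w + b₁ z v * fderiv ℝ b₂ z u w) -
        (fderiv ℝ b₁ z u w * b₂ z v + b₁ z w * fderiv ℝ b₂ z u v) := by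
    intro u v w
    have d2 : ∀ v w : V, HasFDerivAt (fun z ↦ fderiv ℝ a z v w)
        (((fderiv ℝ (fderiv ℝ a) z).flip v).flip w) z := by
      intro v w
      have := (hD.hasFDerivAt.clm_apply (hasFDerivAt_const v z)).clm_apply (hasFDerivAt_const w z)
      exact this.congr_fderiv (by ext u; simp)
    have d1 : ∀ (b : V → V →L[ℝ] ℝ), DifferentiableAt ℝ b z → ∀ v : V,
        HasFDerivAt (fun z ↦ b z v) ((fderiv ℝ b z).flip v) z := by
      intro b hb v
      have := hb.hasFDerivAt.clm_apply (hasFDerivAt_const v z)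
      exact this.congr_fderiv (by ext u; simp)
    have L := (d2 v w).sub (d2 w v)
    have R := ((d1 b₁ h₁ v).mul (d1 b₂ h₂ w)).sub ((d1 b₁ h₁ w).mul (d1 b₂ h₂ v))
    have := L.unique (R.congr_of_eventuallyEq (h.mono fun z hz ↦ hz v w))
    have := DFunLike.congr_fun this u
    simp only [sub_apply, add_apply, smul_apply, ContinuousLinearMap.flip_apply,
      smul_eq_mul] at this
    linarith
  have E1 := E u v w
  have E2 := E v w u
  have E3 := E w u v
  rw [hs v u] at E2
  rw [hs w u, hs w v] at E3
  linear_combination (-1 : ℝ) * E1 - E2 - E3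

/-- `d(θ₁ ∧ θ₂) = 0` when `dη = θ₁ ∧ θ₂`. -/
theorem cyclic_of_d_eq_wedge {η θ₁ θ₂ : OneForm V N} {x : N} (hη : ∀ᶠ y in 𝓝 x, η.SmoothAt y)
    (h₁ : θ₁.SmoothAt x) (h₂ : θ₂.SmoothAt x)
    (h : ∀ᶠ y in 𝓝 x, ∀ v w, η.d y v w = θ₁.wedge θ₂ y v w)
    (u v w : TangentSpace 𝓘(ℝ, V) x) :
    (θ₁.d x u v * θ₂ x w + θ₁.d x v w * θ₂ x u + θ₁.d x w u * θ₂ x v) -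
      (θ₂.d x u v * θ₁ x w + θ₂.d x v w * θ₁ x u + θ₂.d x w u * θ₁ x v) = 0 := by
  have hC : ∀ᶠ z in 𝓝 (extChartAt 𝓘(ℝ, V) x x), ∀ v w : V,
      fderiv ℝ (η.inChart x) z v w - fderiv ℝ (η.inChart x) z w v =
        θ₁.inChart x z v * θ₂.inChart x z w - θ₁.inChart x z w * θ₂.inChart x z v := by
    filter_upwards [eventually_extChartAt_symm (V := V) h, eventually_extChartAt_symm (V := V) hη,
      eventually_mem_target (V := V) x] with z hz hz2 hz' v w
    have hm := (extChartAt 𝓘(ℝ, V) x).map_target hz'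
    have e1 := η.d_inChart hm hz2
    have e2 := θ₁.inChart_mfderiv hm
    have e3 := θ₂.inChart_mfderiv hm
    rw [(extChartAt 𝓘(ℝ, V) x).right_inv hz'] at e1 e2 e3
    -- The chart derivative is onto, so every pair of coordinate vectors comes from tangent vectors,
    -- to which the hypothesis applies.
    have hi := isInvertible_mfderiv_extChartAt' (V := V) hm
    obtain ⟨v', hv⟩ : ∃ v', mfderiv 𝓘(ℝ, V) 𝓘(ℝ, V) (extChartAt 𝓘(ℝ, V) x)
      ((extChartAt 𝓘(ℝ, V) x).symm z) v' = v := hi.bijective.2 v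
    obtain ⟨w', hw⟩ : ∃ v', mfderiv 𝓘(ℝ, V) 𝓘(ℝ, V) (extChartAt 𝓘(ℝ, V) x)
      ((extChartAt 𝓘(ℝ, V) x).symm z) v' = w := hi.bijective.2 w
    have k := hz v' w'
    rw [e1, OneForm.wedge, ← e2, ← e2, ← e3, ← e3] at k
    rw [← hv, ← hw]
    exact k
  have := cyclic_of_fderiv hη.self_of_nhds (ContDiffAt.differentiableAt h₁ (by simp))
    (ContDiffAt.differentiableAt h₂ (by simp)) hC u v w
  rw [θ₁.inChart_self, θ₂.inChart_self] at this
  simp only [OneForm.d_apply]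
  exact this

end Calculus
end
end PathGeom

/-! ### Fields of bilinear forms: smoothness and signature. -/

namespace PathGeom

noncomputable section

set_option linter.unusedSectionVars false

section Bilin

variable {V : Type*} [NormedAddCommGroup V] [NormedSpace ℝ V]
  {N : Type*} [TopologicalSpace N] [ChartedSpace V N] [IsManifold 𝓘(ℝ, V) ∞ N]

/-- Smoothness of a field of bilinear forms at a point. -/
def BilinField.SmoothAt (g : BilinField V N) (x : N) : Prop :=
  ContMDiffAt 𝓘(ℝ, V) (𝓘(ℝ, V).prod 𝓘(ℝ, V →L[ℝ] V →L[ℝ] ℝ)) ∞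
    (fun x ↦ TotalSpace.mk' (V →L[ℝ] V →L[ℝ] ℝ)
      (E := fun x : N ↦ TangentSpace 𝓘(ℝ, V) x →L[ℝ] TangentSpace 𝓘(ℝ, V) x →L[ℝ]
        Bundle.Trivial N ℝ x) x (g x)) x

/-- The coordinate expression `b` is left free, so that it can be supplied in a form whose
smoothness is evident. -/
theorem BilinField.smoothAt_iff (g : BilinField V N) (x : N) {b : N → V →L[ℝ] V →L[ℝ] ℝ}
    (hb : ∀ᶠ y in 𝓝 x, ∀ v w, b y v w = g y
      (mfderiv 𝓘(ℝ, V) 𝓘(ℝ, V) (extChartAt 𝓘(ℝ, V) x).symm (extChartAt 𝓘(ℝ, V) x y) v)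
      (mfderiv 𝓘(ℝ, V) 𝓘(ℝ, V) (extChartAt 𝓘(ℝ, V) x).symm (extChartAt 𝓘(ℝ, V) x y) w)) :
    g.SmoothAt x ↔ ContMDiffAt 𝓘(ℝ, V) 𝓘(ℝ, V →L[ℝ] V →L[ℝ] ℝ) ∞ b x := by
  have e : b =ᶠ[𝓝 x] (fun y ↦ ContinuousLinearMap.inCoordinates V (TangentSpace 𝓘(ℝ, V))
      (V →L[ℝ] ℝ) (fun x : N ↦ TangentSpace 𝓘(ℝ, V) x →L[ℝ] Bundle.Trivial N ℝ x)
      x y x y (g y)) := by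
    filter_upwards [hb, extChartAt_source_mem_nhds (I := 𝓘(ℝ, V)) x] with y hy1 hy
    have hy' : y ∈ (chartAt V x).source := by simpa using hy
    have h := TangentBundle.symmL_trivializationAt (I := 𝓘(ℝ, V)) (x₀ := x) (x := y) hy'
    rw [modelWithCornersSelf_coe, range_id, mfderivWithin_univ] at h
    ext v w
    rw [hy1, ← h]
    rw [ContinuousLinearMap.inCoordinates]
    change _ = (Trivialization.continuousLinearMapAt ℝ (trivializationAt (V →L[ℝ] ℝ)
      (fun x : N ↦ TangentSpace 𝓘(ℝ, V) x →L[ℝ] Bundle.Trivial N ℝ x) x) y) (g y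
        ((trivializationAt V (TangentSpace 𝓘(ℝ, V)) x).symmL ℝ y v)) w
    have hmem : y ∈ (trivializationAt (V →L[ℝ] ℝ)
      (fun x : N ↦ TangentSpace 𝓘(ℝ, V) x →L[ℝ] Bundle.Trivial N ℝ x) x).baseSet := by
      rw [hom_trivializationAt_baseSet]
      exact ⟨hy', trivial⟩
    have e2 := congrFun (Trivialization.coe_linearMapAt_of_mem (R := ℝ) (trivializationAt (V →L[ℝ] ℝ)
      (fun x : N ↦ TangentSpace 𝓘(ℝ, V) x →L[ℝ] Bundle.Trivial N ℝ x) x) hmem) (g y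
        ((trivializationAt V (TangentSpace 𝓘(ℝ, V)) x).symmL ℝ y v))
    have e3 := DFunLike.congr_fun e2 w
    refine Eq.trans ?_ e3.symm
    rw [hom_trivializationAt_apply, ContinuousLinearMap.inCoordinates]
    simp
    rfl
  rw [BilinField.SmoothAt, contMDiffAt_hom_bundle]
  exact ⟨fun h ↦ h.2.congr_of_eventuallyEq e, fun h ↦ ⟨contMDiffAt_id, h.congr_of_eventuallyEq e.symm⟩⟩

theorem BilinField.smoothOn_of_smoothAt {g : BilinField V N} {U : Set N}
    (h : ∀ x ∈ U, g.SmoothAt x) : g.SmoothOn U :=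
  fun x hx ↦ (h x hx).contMDiffWithinAt

theorem BilinField.SmoothAt.congr {g g' : BilinField V N} {x : N} (h : g.SmoothAt x)
    (hg : ∀ᶠ y in 𝓝 x, g' y = g y) : g'.SmoothAt x := by
  refine ContMDiffAt.congr_of_eventuallyEq h ?_
  filter_upwards [hg] with y hy
  rw [hy]

theorem BilinField.smoothAt_of_contDiffAt {g : BilinField V N} {x : N}
    {b : V → V →L[ℝ] V →L[ℝ] ℝ} (hb : ContDiffAt ℝ ∞ b (extChartAt 𝓘(ℝ, V) x x))
    (h : ∀ᶠ z in 𝓝 (extChartAt 𝓘(ℝ, V) x x), ∀ v w, b z v w =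
      g ((extChartAt 𝓘(ℝ, V) x).symm z)
        (mfderiv 𝓘(ℝ, V) 𝓘(ℝ, V) (extChartAt 𝓘(ℝ, V) x).symm z v)
        (mfderiv 𝓘(ℝ, V) 𝓘(ℝ, V) (extChartAt 𝓘(ℝ, V) x).symm z w)) : g.SmoothAt x := by
  refine (g.smoothAt_iff x (b := fun y ↦ b (extChartAt 𝓘(ℝ, V) x y)) ?_).2
    ((ContDiffAt.contMDiffAt hb).comp x contMDiffAt_extChartAt)
  filter_upwards [extChartAt_source_mem_nhds (I := 𝓘(ℝ, V)) x,
    (continuousAt_extChartAt (I := 𝓘(ℝ, V)) x).eventually h] with y hy hb v w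
  rw [hb]
  have key : ∀ y', y' = y → ∀ v w : V, (show V →L[ℝ] V →L[ℝ] ℝ from g y') v w =
    (show V →L[ℝ] V →L[ℝ] ℝ from g y) v w := by rintro _ rfl _ _; rfl
  exact key _ ((extChartAt 𝓘(ℝ, V) x).left_inv hy) _ _

/-- The symmetric product of two linear forms. -/
def symL (a b : V →L[ℝ] ℝ) : V →L[ℝ] V →L[ℝ] ℝ :=
  (2⁻¹ : ℝ) • (a.smulRight b + b.smulRight a)

set_option synthInstance.maxHeartbeats 200000 in
set_option maxHeartbeats 1000000 in
theorem contDiffAt_symL_add {a b c d : V → V →L[ℝ] ℝ} {z : V} (ha : ContDiffAt ℝ ∞ a z)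
    (hb : ContDiffAt ℝ ∞ b z) (hc : ContDiffAt ℝ ∞ c z) (hd : ContDiffAt ℝ ∞ d z) :
    ContDiffAt ℝ ∞ (fun z ↦ symL (a z) (b z) + symL (c z) (d z)) z := by
  have h : ∀ {a b : V → V →L[ℝ] ℝ}, ContDiffAt ℝ ∞ a z → ContDiffAt ℝ ∞ b z →
      ContDiffAt ℝ ∞ (fun z ↦ symL (a z) (b z)) z := fun ha hb ↦
    ContDiffAt.const_smul _ (ContDiffAt.add (ContDiffAt.smulRight ha hb)
      (ContDiffAt.smulRight hb ha))
  exact ContDiffAt.add (h ha hb) (h hc hd)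

/-- The field of bilinear forms `α · β + γ · δ` is smooth. -/
theorem smoothAt_symProd_add {α β γ δ : OneForm V N} {x : N} (hα : α.SmoothAt x)
    (hβ : β.SmoothAt x) (hγ : γ.SmoothAt x) (hδ : δ.SmoothAt x) :
    BilinField.SmoothAt (fun y ↦ α.symProd β y + γ.symProd δ y : BilinField V N) x :=
  BilinField.smoothAt_of_contDiffAt (contDiffAt_symL_add hα hβ hγ hδ)
    (Filter.Eventually.of_forall fun _ _ _ ↦ rfl)

/-- Each null pair spans a hyperbolic plane. With `E` the basis dual to `a`, the vectors $E_0\pm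
E_1$ and $E_2\pm E_3$ are orthogonal with squares $\pm1$. -/
theorem hasSignature_of_coframe [FiniteDimensional ℝ V] (hV : Module.finrank ℝ V = 4)
    {b : V →L[ℝ] V →L[ℝ] ℝ} {a : Fin 4 → V →L[ℝ] ℝ} (ha : ∀ v, (∀ i, a i v = 0) → v = 0)
    (hb : ∀ v w, b v w = 2⁻¹ * (a 0 v * a 1 w + a 1 v * a 0 w) +
      2⁻¹ * (a 2 v * a 3 w + a 3 v * a 2 w)) : HasSignature 2 2 b := by
  have inj : Function.Injective (LinearMap.pi fun i ↦ (a i).toLinearMap) :=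
    (injective_iff_map_eq_zero _).2 fun v hv ↦ ha v fun i ↦ congrFun hv i
  have sur := (LinearMap.injective_iff_surjective_of_finrank_eq_finrank
    (by rw [hV]; simp)).1 inj
  have hE : ∀ j : Fin 4, ∃ v : V, ∀ i, a i v = if i = j then 1 else 0 := by
    intro j
    obtain ⟨v, hv⟩ := sur (fun i ↦ if i = j then 1 else 0)
    exact ⟨v, fun i ↦ congrFun hv i⟩
  choose E hE using hE
  let e : Fin 2 ⊕ Fin 2 → V := Sum.elim ![E 0 + E 1, E 2 + E 3] ![E 0 - E 1, E 2 - E 3]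
  have he : ∀ i j, b (e i) (e j) =
      if i = j then Sum.elim (fun _ ↦ 1) (fun _ ↦ -1) i else 0 := by
    intro i j
    rw [hb]
    rcases i with i | i <;> rcases j with j | j <;> fin_cases i <;> fin_cases j <;>
      simp [e, hE] <;> norm_num
  -- Pairing a linear relation with `e j` isolates its `j`-th coefficient up to sign.
  have li : LinearIndependent ℝ e := by
    rw [Fintype.linearIndependent_iff]
    intro c hc j
    have h := congrArg (fun v ↦ b v (e j)) hc
    simp only [map_sum, map_smul, sum_apply, smul_apply,
      he, smul_eq_mul, map_zero, zero_apply] at h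
    rcases j with j | j <;> simpa using h
  refine ⟨basisOfLinearIndependentOfCardEqFinrank li (by simp [hV]), fun i j ↦ ?_⟩
  simp only [coe_basisOfLinearIndependentOfCardEqFinrank]
  exact he i j

/-- The signature is invariant under linear isomorphisms. -/
theorem HasSignature.comp {V' : Type*} [NormedAddCommGroup V'] [NormedSpace ℝ V'] {p q : ℕ}
    {b : V →L[ℝ] V →L[ℝ] ℝ} {b' : V' →L[ℝ] V' →L[ℝ] ℝ} {L : V →L[ℝ] V'}
    (hL : Function.Bijective L) (h : ∀ v w, b v w = b' (L v) (L w)) (hb : HasSignature p q b) :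
    HasSignature p q b' := by
  obtain ⟨e, he⟩ := hb
  refine ⟨e.map (LinearEquiv.ofBijective L.toLinearMap hL), fun i j ↦ ?_⟩
  rw [← he i j, h]
  rfl

end Bilin
end
end PathGeom

/-! ### Coordinates on $B$: the projection and the fibre coordinate. -/

namespace PathGeom

noncomputable section

set_option linter.unusedSectionVars false

namespace PathGeometry

variable {M : Type*} [TopologicalSpace M] [ChartedSpace E3 M] [IsManifold (𝓡 3) ∞ M]
  {P : PathGeometry M}

namespace ContactForm

variable {η : P.ContactForm}

theorem B.chartAt_spec (u : η.B) : ∃ φ ∈ atlas E3 M, ∃ (W : Set M) (X : VField M),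
    IsLocalFrame P.L₁ X W ∧ W ⊆ φ.source ∧ W ⊆ η.domain ∧
    (chartAt (E3 × ℝ) u).source = {u | u.proj ∈ W} ∧
    ∀ u' ∈ (chartAt (E3 × ℝ) u).source,
      chartAt (E3 × ℝ) u u' = (φ u'.proj, u'.coframe (X u'.proj) 0) := by
  obtain ⟨φ, hφ, W, X, h, h1, h2, h3, -, h5⟩ := ((bAtlas η).cover u).choose_spec.1
  exact ⟨φ, hφ, W, X, h, h1, h2, h3, h5⟩

/-- The component `u¹(X)` of a coframe along a local frame `X` of `L₁`. -/
def fiberCoord (X : VField M) (u : η.B) : ℝ := u.coframe (X u.proj) 0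

theorem fiberCoord_ne_zero {X : VField M} {W : Set M} (h : IsLocalFrame P.L₁ X W) {u : η.B}
    (hu : u.proj ∈ W) : fiberCoord X u ≠ 0 :=
  u.adapted.first_ne_zero (h.span _ hu ▸ Submodule.mem_span_singleton_self _) (h.ne_zero _ hu)

/-- The preferred chart at `u` uses some frame of $L_1$ over which there is no control. The smooth
ratio `c` to a given frame `X` expresses it through `fiberCoord X`, so later arguments may use any
frame. -/
theorem B.exists_chart (u : η.B) {X : VField M} {W : Set M} (h : IsLocalFrame P.L₁ X W)
    (hu : u.proj ∈ W) : ∃ φ ∈ atlas E3 M, ∃ (c : M → ℝ) (W' : Set M), u.proj ∈ W' ∧ IsOpen W' ∧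
      W' ⊆ φ.source ∧ W' ⊆ W ∧ ContMDiffOn (𝓡 3) 𝓘(ℝ, ℝ) ∞ c W' ∧ (∀ x ∈ W', c x ≠ 0) ∧
      ∀ u' : η.B, u'.proj ∈ W' → u' ∈ (chartAt (E3 × ℝ) u).source ∧
        chartAt (E3 × ℝ) u u' = (φ u'.proj, c u'.proj * fiberCoord X u') := by
  obtain ⟨φ, hφ, W', X', h', h1, h2, h3, h5⟩ := u.chartAt_spec
  obtain ⟨c, hc, k⟩ := h.exists_ratio h'
  have hu' : u ∈ (chartAt (E3 × ℝ) u).source := mem_chart_source _ _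
  rw [h3] at hu'
  refine ⟨φ, hφ, c, W ∩ W', ⟨hu, hu'⟩, h.isOpen.inter h'.isOpen, fun x hx ↦ h1 hx.2,
    inter_subset_left, hc, fun x hx ↦ (k x hx).1, fun v hv ↦ ?_⟩
  have hv' : v ∈ (chartAt (E3 × ℝ) u).source := by rw [h3]; exact hv.2
  refine ⟨hv', ?_⟩
  rw [h5 v hv', (k _ hv).2, map_smul]
  rfl

theorem B.exists_frame (u : η.B) : ∃ (X : VField M) (W : Set M), IsLocalFrame P.L₁ X W ∧
    u.proj ∈ W := by
  obtain ⟨X, W, hx, h⟩ := P.smooth₁ u.proj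
  exact ⟨X, W, h, hx⟩

theorem contMDiffAt_proj (u : η.B) :
    ContMDiffAt 𝓘(ℝ, E3 × ℝ) (𝓡 3) ∞ (B.proj : η.B → M) u := by
  obtain ⟨φ, hφ, W, X, h, h1, h2, h3, h5⟩ := u.chartAt_spec
  have hu : u ∈ (chartAt (E3 × ℝ) u).source := mem_chart_source _ _
  have hu' := hu
  rw [h3] at hu'
  have s1 : ContMDiffAt 𝓘(ℝ, E3 × ℝ) 𝓘(ℝ, E3 × ℝ) ∞ (chartAt (E3 × ℝ) u) u :=
    contMDiffAt_of_mem_maximalAtlas (IsManifold.chart_mem_maximalAtlas u) hu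
  have s2 : ContMDiffAt 𝓘(ℝ, E3) (𝓡 3) ∞ φ.symm (chartAt (E3 × ℝ) u u).1 := by
    rw [h5 u hu]
    exact contMDiffAt_symm_of_mem_maximalAtlas (IsManifold.subset_maximalAtlas hφ)
      (φ.map_source (h1 hu'))
  refine (s2.comp u ((contDiff_fst.contMDiff.contMDiffAt).comp u s1)).congr_of_eventuallyEq ?_
  filter_upwards [(chartAt (E3 × ℝ) u).open_source.mem_nhds hu] with v hv
  have hv' := hv
  rw [h3] at hv'
  change v.proj = φ.symm (chartAt (E3 × ℝ) u v).1
  rw [h5 v hv, φ.left_inv (h1 hv')]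

theorem continuous_proj : Continuous (B.proj : η.B → M) :=
  continuous_iff_continuousAt.2 fun u ↦ (contMDiffAt_proj u).continuousAt

theorem contMDiffAt_fiberCoord {X : VField M} {W : Set M} (h : IsLocalFrame P.L₁ X W) {u : η.B}
    (hu : u.proj ∈ W) : ContMDiffAt 𝓘(ℝ, E3 × ℝ) 𝓘(ℝ, ℝ) ∞ (fiberCoord X : η.B → ℝ) u := by
  obtain ⟨φ, hφ, c, W', hu', hW', h1, h2, hc, hc0, h5⟩ := u.exists_chart h hu
  have s1 : ContMDiffAt 𝓘(ℝ, E3 × ℝ) 𝓘(ℝ, E3 × ℝ) ∞ (chartAt (E3 × ℝ) u) u :=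
    contMDiffAt_of_mem_maximalAtlas (IsManifold.chart_mem_maximalAtlas u) (mem_chart_source _ _)
  have s2 := (contDiff_snd (𝕜 := ℝ) (E := E3) (F := ℝ) (n := ∞)).contMDiff.contMDiffAt.comp u s1
  have s3 : ContMDiffAt 𝓘(ℝ, E3 × ℝ) 𝓘(ℝ, ℝ) ∞ (fun v : η.B ↦ c v.proj) u :=
    (hc.contMDiffAt (hW'.mem_nhds hu')).comp u (contMDiffAt_proj u)
  refine (s2.div₀ s3 (hc0 _ hu')).congr_of_eventuallyEq ?_
  filter_upwards [continuous_proj.continuousAt (hW'.mem_nhds hu')] with v hv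
  change _ = (chartAt (E3 × ℝ) u v).2 / c v.proj
  rw [(h5 v hv).2, mul_div_cancel_left₀ _ (hc0 _ hv)]

/-- The topology of $B$ is the one determined by $\pi$ and the fibre coordinate. The filter version
also serves to show that $B$ is embedded in the bundle of homomorphisms. -/
theorem tendsto_B {ι : Type*} {l : Filter ι} {f : ι → η.B} {u : η.B} {X : VField M} {W : Set M}
    (h : IsLocalFrame P.L₁ X W) (hu : u.proj ∈ W)
    (h1 : Filter.Tendsto (fun i ↦ (f i).proj) l (𝓝 u.proj))
    (h2 : Filter.Tendsto (fun i ↦ fiberCoord X (f i)) l (𝓝 (fiberCoord X u))) :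
    Filter.Tendsto f l (𝓝 u) := by
  obtain ⟨φ, hφ, c, W', hu', hW', k1, k2, hc, hc0, h5⟩ := u.exists_chart h hu
  have hev : ∀ᶠ i in l, (f i).proj ∈ W' := h1.eventually (hW'.mem_nhds hu')
  have t1 : Filter.Tendsto (fun i ↦ (φ (f i).proj, c (f i).proj * fiberCoord X (f i))) l
      (𝓝 (φ u.proj, c u.proj * fiberCoord X u)) :=
    Filter.Tendsto.prodMk_nhds ((φ.continuousAt (k1 hu')).tendsto.comp h1)
      (Filter.Tendsto.mul ((hc.continuousOn.continuousAt (hW'.mem_nhds hu')).tendsto.comp h1) h2)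
  rw [← (h5 u hu').2] at t1
  have t2 := ((chartAt (E3 × ℝ) u).continuousAt_symm (mem_chart_target _ u)).tendsto.comp t1
  rw [(chartAt (E3 × ℝ) u).left_inv (mem_chart_source _ u)] at t2
  refine t2.congr' ?_
  filter_upwards [hev] with i hi
  change (chartAt (E3 × ℝ) u).symm (φ (f i).proj, c (f i).proj * fiberCoord X (f i)) = _
  rw [← (h5 _ hi).2, (chartAt (E3 × ℝ) u).left_inv (h5 _ hi).1]

section Maps

variable {E : Type*} [NormedAddCommGroup E] [NormedSpace ℝ E] {H : Type*} [TopologicalSpace H]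
  {I : ModelWithCorners ℝ E H} {N : Type*} [TopologicalSpace N] [ChartedSpace H N]

/-- The test used for every map into $B$: after multiplication by the ratio `c`, $\pi$ and the fibre
coordinate give the chart, so their smoothness along `f` suffices. -/
theorem contMDiffAt_B {f : N → η.B} {n : N} {X : VField M} {W : Set M}
    (h : IsLocalFrame P.L₁ X W) (hu : (f n).proj ∈ W)
    (h1 : ContMDiffAt I (𝓡 3) ∞ (fun y ↦ (f y).proj) n)
    (h2 : ContMDiffAt I 𝓘(ℝ, ℝ) ∞ (fun y ↦ fiberCoord X (f y)) n) :
    ContMDiffAt I 𝓘(ℝ, E3 × ℝ) ∞ f n := by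
  have hcont : ContinuousAt f n := tendsto_B h hu h1.continuousAt h2.continuousAt
  obtain ⟨φ, hφ, c, W', hu', hW', k1, k2, hc, hc0, h5⟩ := (f n).exists_chart h hu
  rw [contMDiffAt_iff_target]
  refine ⟨hcont, ?_⟩
  have s1 : ContMDiffAt I 𝓘(ℝ, E3) ∞ (fun y ↦ φ (f y).proj) n :=
    (contMDiffAt_of_mem_maximalAtlas (IsManifold.subset_maximalAtlas hφ) (k1 hu')).comp n h1
  have s2 : ContMDiffAt I 𝓘(ℝ, ℝ) ∞ (fun y ↦ c (f y).proj) n :=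
    (hc.contMDiffAt (hW'.mem_nhds hu')).comp n h1
  refine (s1.prodMk_space (s2.mul h2)).congr_of_eventuallyEq ?_
  filter_upwards [h1.continuousAt (hW'.mem_nhds hu')] with y hy
  exact (h5 _ hy).2

end Maps

/-- A tangent vector of `B` is determined by its projection and the derivative of the fibre
coordinate. -/
theorem eq_zero_of_mfderiv {X : VField M} {W : Set M} (h : IsLocalFrame P.L₁ X W) {u : η.B}
    (hu : u.proj ∈ W) {v : TangentSpace 𝓘(ℝ, E3 × ℝ) u}
    (h1 : mfderiv 𝓘(ℝ, E3 × ℝ) (𝓡 3) (B.proj : η.B → M) u v = 0)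
    (h2 : dform (fiberCoord X : η.B → ℝ) u v = 0) : v = 0 := by
  obtain ⟨φ, hφ, c, W', hu', hW', k1, k2, hc, hc0, h5⟩ := u.exists_chart h hu
  -- `F` recovers the chart from $(\pi,\tau)$. The chart has identity derivative at `u`, so the
  -- identity factors through $(d\pi,d\tau)$.
  let F : M × ℝ → E3 × ℝ := fun p ↦ (φ p.1, c p.1 * p.2)
  have hF : ContMDiffAt ((𝓡 3).prod 𝓘(ℝ, ℝ)) 𝓘(ℝ, E3 × ℝ) ∞ F (u.proj, fiberCoord X u) := by
    have f1 : ContMDiffAt ((𝓡 3).prod 𝓘(ℝ, ℝ)) (𝓡 3) ∞ (Prod.fst : M × ℝ → M)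
      (u.proj, fiberCoord X u) := contMDiffAt_fst
    have s1 := (contMDiffAt_of_mem_maximalAtlas (n := ∞) (IsManifold.subset_maximalAtlas hφ)
      (k1 hu')).comp (u.proj, fiberCoord X u) f1
    have s2 := (hc.contMDiffAt (hW'.mem_nhds hu')).comp (u.proj, fiberCoord X u) f1
    exact s1.prodMk_space (s2.mul contMDiffAt_snd)
  have hp := (contMDiffAt_proj u).mdifferentiableAt (by simp)
  have hq := (contMDiffAt_fiberCoord h hu).mdifferentiableAt (by simp)
  have e1 : mfderiv 𝓘(ℝ, E3 × ℝ) 𝓘(ℝ, E3 × ℝ) (extChartAt 𝓘(ℝ, E3 × ℝ) u) u =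
      mfderiv 𝓘(ℝ, E3 × ℝ) 𝓘(ℝ, E3 × ℝ) (F ∘ fun u : η.B ↦ (u.proj, fiberCoord X u)) u := by
    refine Filter.EventuallyEq.mfderiv_eq ?_
    filter_upwards [continuous_proj.continuousAt (hW'.mem_nhds hu')] with v hv
    exact (h5 v hv).2
  rw [mfderiv_extChartAt_self, mfderiv_comp u (hF.mdifferentiableAt (by simp))
    (hp.prodMk hq), mfderiv_prodMk hp hq] at e1
  have e2 := DFunLike.congr_fun e1 v
  refine e2.trans ?_
  have e3 : (mfderiv 𝓘(ℝ, E3 × ℝ) (𝓡 3) (B.proj : η.B → M) u v,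
    mfderiv 𝓘(ℝ, E3 × ℝ) 𝓘(ℝ, ℝ) (fiberCoord X : η.B → ℝ) u v) = ((0 : E3), (0 : ℝ)) :=
    Prod.ext h1 h2
  refine (congrArg (mfderiv ((𝓡 3).prod 𝓘(ℝ, ℝ)) 𝓘(ℝ, E3 × ℝ) F
    (u.proj, fiberCoord X u)) e3).trans ?_
  exact map_zero (mfderiv ((𝓡 3).prod 𝓘(ℝ, ℝ)) 𝓘(ℝ, E3 × ℝ) F (u.proj, fiberCoord X u))

end ContactForm

end PathGeometry
end
end PathGeom

/-! ### Coordinates on $SD^*$, and smoothness of $J$. -/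

namespace PathGeom

noncomputable section

set_option linter.unusedSectionVars false

namespace PathGeometry

variable {M : Type*} [TopologicalSpace M] [ChartedSpace E3 M] [IsManifold (𝓡 3) ∞ M]
  {P : PathGeometry M}

namespace SDStar

theorem chartAt_spec (p : P.SDStar) : ∃ φ ∈ atlas E3 M, ∃ (W : Set M) (X₁ X₂ : VField M)
    (h₁ : IsLocalFrame P.L₁ X₁ W) (h₂ : IsLocalFrame P.L₂ X₂ W), W ⊆ φ.source ∧
    (chartAt (E3 × ℝ) p).source = {p | ∃ x hx t ht, p = frameRay h₁ h₂ x hx t ht} ∧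
    ∀ x hx t ht, chartAt (E3 × ℝ) p (frameRay h₁ h₂ x hx t ht) = (φ x, t) := by
  obtain ⟨φ, hφ, W, X₁, X₂, h₁, h₂, h1, h2, -, h3⟩ := ((sdAtlas P).cover p).choose_spec.1
  exact ⟨φ, hφ, W, X₁, X₂, h₁, h₂, h1, h2, h3⟩

theorem contMDiffAt_proj (p : P.SDStar) :
    ContMDiffAt 𝓘(ℝ, E3 × ℝ) (𝓡 3) ∞ (proj : P.SDStar → M) p := by
  obtain ⟨φ, hφ, W, X₁, X₂, h₁, h₂, h1, h2, h3⟩ := chartAt_spec p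
  have hp : p ∈ (chartAt (E3 × ℝ) p).source := mem_chart_source _ _
  have hp' := hp
  rw [h2] at hp'
  obtain ⟨x, hx, t, ht, e⟩ := hp'
  have s1 : ContMDiffAt 𝓘(ℝ, E3 × ℝ) 𝓘(ℝ, E3 × ℝ) ∞ (chartAt (E3 × ℝ) p) p :=
    contMDiffAt_of_mem_maximalAtlas (IsManifold.chart_mem_maximalAtlas p) hp
  have s2 : ContMDiffAt 𝓘(ℝ, E3) (𝓡 3) ∞ φ.symm (chartAt (E3 × ℝ) p p).1 := by
    have e' : (chartAt (E3 × ℝ) p p).1 = φ x := by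
      have := h3 x hx t ht
      rw [← e] at this
      rw [this]
    rw [e']
    exact contMDiffAt_symm_of_mem_maximalAtlas (IsManifold.subset_maximalAtlas hφ)
      (φ.map_source (h1 hx))
  refine (s2.comp p ((contDiff_fst.contMDiff.contMDiffAt).comp p s1)).congr_of_eventuallyEq ?_
  filter_upwards [(chartAt (E3 × ℝ) p).open_source.mem_nhds hp] with q hq
  rw [h2] at hq
  obtain ⟨y, hy, r, hr, rfl⟩ := hq
  change y = φ.symm (chartAt (E3 × ℝ) p (frameRay h₁ h₂ y hy r hr)).1
  rw [h3, φ.left_inv (h1 hy)]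

theorem continuous_proj : Continuous (proj : P.SDStar → M) :=
  continuous_iff_continuousAt.2 fun u ↦ (contMDiffAt_proj u).continuousAt

/-- Local form of a ray as `[r X₁ + X₂]`, with `r` a smooth function. -/
theorem exists_frameRay (p : P.SDStar) : ∃ (W : Set M) (X₁ X₂ : VField M)
    (h₁ : IsLocalFrame P.L₁ X₁ W) (h₂ : IsLocalFrame P.L₂ X₂ W) (r : P.SDStar → ℝ),
    proj p ∈ W ∧ ContMDiffAt 𝓘(ℝ, E3 × ℝ) 𝓘(ℝ, ℝ) ∞ r p ∧
    ∀ᶠ q in 𝓝 p, ∃ hx ht, q = frameRay h₁ h₂ (proj q) hx (r q) ht := by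
  obtain ⟨φ, hφ, W, X₁, X₂, h₁, h₂, h1, h2, h3⟩ := chartAt_spec p
  have hp : p ∈ (chartAt (E3 × ℝ) p).source := mem_chart_source _ _
  have s1 : ContMDiffAt 𝓘(ℝ, E3 × ℝ) 𝓘(ℝ, E3 × ℝ) ∞ (chartAt (E3 × ℝ) p) p :=
    contMDiffAt_of_mem_maximalAtlas (IsManifold.chart_mem_maximalAtlas p) hp
  have hev : ∀ᶠ q in 𝓝 p, ∃ hx ht,
      q = frameRay h₁ h₂ (proj q) hx ((chartAt (E3 × ℝ) p q).2) ht := by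
    filter_upwards [(chartAt (E3 × ℝ) p).open_source.mem_nhds hp] with q hq
    rw [h2] at hq
    obtain ⟨y, hy, r, hr, rfl⟩ := hq
    have e : (chartAt (E3 × ℝ) p (frameRay h₁ h₂ y hy r hr)).2 = r := by rw [h3]
    refine ⟨hy, by rw [e]; exact hr, ?_⟩
    change _ = frameRay h₁ h₂ y hy _ _
    congr 1
    exact e.symm
  obtain ⟨hx, ht, -⟩ := hev.self_of_nhds
  exact ⟨W, X₁, X₂, h₁, h₂, fun q ↦ (chartAt (E3 × ℝ) p q).2, hx,
    contDiff_snd.contMDiff.contMDiffAt.comp p s1, hev⟩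

/-- Multiplying $tX_1+X_2$ by $c_2$ gives the normal form in the new frames. Positivity of $c_2$ is
essential, since only positive multiples span the same ray. -/
theorem frameRay_change {X₁ X₂ X₁' X₂' : VField M} {W W' : Set M} {h₁ : IsLocalFrame P.L₁ X₁ W}
    {h₂ : IsLocalFrame P.L₂ X₂ W} (h₁' : IsLocalFrame P.L₁ X₁' W')
    (h₂' : IsLocalFrame P.L₂ X₂' W') {x : M} {c₁ c₂ : ℝ} (hx : x ∈ W) (hx' : x ∈ W')
    (hc₁ : c₁ ≠ 0) (hc₂ : 0 < c₂) (e₁ : X₁' x = c₁ • X₁ x) (e₂ : X₂' x = c₂ • X₂ x)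
    {t : ℝ} (ht : t ≠ 0) :
    frameRay h₁ h₂ x hx t ht = frameRay h₁' h₂' x hx' (c₂ / c₁ * t)
      (mul_ne_zero (div_ne_zero hc₂.ne' hc₁) ht) := by
  refine DStar.ray_eq_iff.2 ⟨Units.mk0 c₂ hc₂.ne', hc₂, ?_⟩
  simp only [DStar.scale, Units.val_mk0, DStar.mk.injEq, true_and]
  refine ⟨?_, e₂⟩
  rw [e₁, smul_smul, smul_smul]
  congr 1
  field_simp

section Maps

variable {E : Type*} [NormedAddCommGroup E] [NormedSpace ℝ E] {H : Type*} [TopologicalSpace H]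
  {I : ModelWithCorners ℝ E H} {N : Type*} [TopologicalSpace N] [ChartedSpace H N]

/-- The analogue of `contMDiffAt_B` for $SD^*$: the base point and the coefficient of $X_1$, in
arbitrary frames, decide smoothness. -/
theorem contMDiffAt_of_frameRay {f : N → P.SDStar} {n : N} {X₁ X₂ : VField M} {W : Set M}
    (h₁ : IsLocalFrame P.L₁ X₁ W) (h₂ : IsLocalFrame P.L₂ X₂ W) {r : N → ℝ}
    (hr : ContMDiffAt I 𝓘(ℝ, ℝ) ∞ r n) (hp : ContMDiffAt I (𝓡 3) ∞ (fun y ↦ proj (f y)) n)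
    (hf : ∀ᶠ y in 𝓝 n, ∃ hx ht, f y = frameRay h₁ h₂ (proj (f y)) hx (r y) ht) :
    ContMDiffAt I 𝓘(ℝ, E3 × ℝ) ∞ f n := by
  obtain ⟨φ, hφ, W', X₁', X₂', h₁', h₂', k1, k2, k3⟩ := chartAt_spec (f n)
  obtain ⟨c₁, hc₁, e₁⟩ := h₁.exists_ratio h₁'
  obtain ⟨c₂, hc₂, e₂⟩ := h₂.exists_ratio h₂'
  obtain ⟨hx, ht, hfn⟩ := hf.self_of_nhds
  have hm : f n ∈ (chartAt (E3 × ℝ) (f n)).source := mem_chart_source _ _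
  rw [k2] at hm
  obtain ⟨y, hy, s, hs, ey⟩ := hm
  have hx' : proj (f n) ∈ W' := by rw [ey]; exact hy
  have hWW : IsOpen (W ∩ W') := h₁.isOpen.inter h₁'.isOpen
  -- Both pairs of frames write the ray `f n` with coefficient $+1$ on the second vector, so the
  -- ratio of the second vectors is positive at this point, and by continuity nearby.
  have hc2 : 0 < c₂ (proj (f n)) := by
    obtain ⟨c, hc, e⟩ := DStar.ray_eq_iff.1 (hfn.symm.trans ey)
    simp only [DStar.scale, DStar.mk.injEq] at e
    obtain ⟨rfl, -, e2⟩ := e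
    rw [(e₂ _ ⟨hx, hx'⟩).2] at e2
    have : c₂ (proj (f n)) = c := by
      by_contra hn
      have h0 : (c₂ (proj (f n)) - c) • X₂ (proj (f n)) = 0 := by rw [sub_smul, e2, sub_self]
      exact (smul_ne_zero (sub_ne_zero.2 hn) (h₂.ne_zero _ hx)) h0
    rw [this]; exact hc
  have s2 : ContMDiffAt I 𝓘(ℝ, ℝ) ∞ (fun y ↦ c₂ (proj (f y))) n :=
    (hc₂.contMDiffAt (hWW.mem_nhds ⟨hx, hx'⟩)).comp n hp
  have s1 : ContMDiffAt I 𝓘(ℝ, ℝ) ∞ (fun y ↦ c₁ (proj (f y))) n :=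
    (hc₁.contMDiffAt (hWW.mem_nhds ⟨hx, hx'⟩)).comp n hp
  have s3 : ContMDiffAt I 𝓘(ℝ, E3) ∞ (fun y ↦ φ (proj (f y))) n :=
    (contMDiffAt_of_mem_maximalAtlas (IsManifold.subset_maximalAtlas hφ) (k1 hx')).comp n hp
  have s4 : ContMDiffAt I 𝓘(ℝ, E3 × ℝ) ∞ (fun y ↦ ((φ (proj (f y)),
      c₂ (proj (f y)) / c₁ (proj (f y)) * r y) : E3 × ℝ)) n :=
    s3.prodMk_space ((s2.div₀ s1 (e₁ _ ⟨hx, hx'⟩).1).mul hr)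
  have hev : ∀ᶠ y in 𝓝 n, f y ∈ (chartAt (E3 × ℝ) (f n)).source ∧
      chartAt (E3 × ℝ) (f n) (f y) = (φ (proj (f y)),
        c₂ (proj (f y)) / c₁ (proj (f y)) * r y) := by
    filter_upwards [hf, s2.continuousAt.eventually (lt_mem_nhds hc2),
      hp.continuousAt (hWW.mem_nhds ⟨hx, hx'⟩)] with y hy hy2 hy3
    obtain ⟨hx, ht, hy⟩ := hy
    have h := hy.trans (frameRay_change h₁' h₂' hx hy3.2 (e₁ _ hy3).1 hy2 (e₁ _ hy3).2
      (e₂ _ hy3).2 ht)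
    constructor
    · rw [k2]
      exact ⟨_, _, _, _, h⟩
    · refine (congrArg _ h).trans (k3 _ _ _ _)
  have hev0 := hev.self_of_nhds.2
  rw [contMDiffAt_iff_target]
  constructor
  · have t1 := s4.continuousAt.tendsto
    rw [← hev0] at t1
    have t2 := ((chartAt (E3 × ℝ) (f n)).continuousAt_symm
      (mem_chart_target _ (f n))).tendsto.comp t1
    rw [(chartAt (E3 × ℝ) (f n)).left_inv (mem_chart_source _ (f n))] at t2
    refine t2.congr' ?_
    filter_upwards [hev] with y hy
    change (chartAt (E3 × ℝ) (f n)).symm (φ (proj (f y)), _) = _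
    rw [← hy.2, (chartAt (E3 × ℝ) (f n)).left_inv hy.1]
  · refine s4.congr_of_eventuallyEq ?_
    filter_upwards [hev] with y hy
    exact hy.2

end Maps

theorem J_J (p : P.SDStar) : p.J.J = p := by
  obtain ⟨X, rfl⟩ : ∃ X : P.DStar, X.ray = p := Quotient.exists_rep p
  simp [J, DStar.scale_scale, DStar.scale_one]

theorem proj_J (p : P.SDStar) : proj p.J = proj p := by
  obtain ⟨X, rfl⟩ : ∃ X : P.DStar, X.ray = p := Quotient.exists_rep p
  rfl

theorem J_act (s : ℝˣ) (p : P.SDStar) : (act s p).J = act s p.J := by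
  obtain ⟨X, rfl⟩ : ∃ X : P.DStar, X.ray = p := Quotient.exists_rep p
  simp [J, act, DStar.scale_scale]

/-- $J[rX_1+X_2]=[rX_1-X_2]$, so with respect to the frames $X_1,-X_2$ the image has the same
coordinate `r`. -/
theorem contMDiff_J : ContMDiff 𝓘(ℝ, E3 × ℝ) 𝓘(ℝ, E3 × ℝ) ∞ (J : P.SDStar → P.SDStar) := by
  intro p
  obtain ⟨W, X₁, X₂, h₁, h₂, r, hp, hr, hev⟩ := exists_frameRay p
  refine contMDiffAt_of_frameRay h₁ h₂.neg hr ?_ ?_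
  · simp only [proj_J]
    exact contMDiffAt_proj p
  · filter_upwards [hev] with q hq
    obtain ⟨hx, ht, hq⟩ := hq
    refine ⟨by rw [proj_J]; exact hx, ht, ?_⟩
    have e : ∀ y (hy : y = proj q) (hy' : y ∈ W), q.J = frameRay h₁ h₂.neg y hy' (r q) ht := by
      rintro _ rfl hy'
      refine (congrArg J hq).trans ?_
      simp [J, frameRay, DStar.scale]
    exact e _ (proj_J q) _

end SDStar

end PathGeometry
end
end PathGeom

/-! ### Structure equations on the base $M$. -/

namespace PathGeom

noncomputable section

set_option linter.unusedSectionVars false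

section Coframe

variable {V : Type*} [NormedAddCommGroup V] [NormedSpace ℝ V]
  {N : Type*} [TopologicalSpace N] [ChartedSpace V N] [IsManifold 𝓘(ℝ, V) ∞ N]

theorem OneForm.d_eq_coframe {θ : Fin 3 → OneForm V N} {x : N}
    (h : (coframeMap θ x).IsInvertible) (α : OneForm V N) (v w : TangentSpace 𝓘(ℝ, V) x) :
    α.d x v w = α.d x (dualFrame θ 0 x) (dualFrame θ 1 x) * (θ 0).wedge (θ 1) x v w +
      α.d x (dualFrame θ 1 x) (dualFrame θ 2 x) * (θ 1).wedge (θ 2) x v w +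
      α.d x (dualFrame θ 2 x) (dualFrame θ 0 x) * (θ 2).wedge (θ 0) x v w := by
  have hv := eq_sum_dualFrame h v
  have hw := eq_sum_dualFrame h w
  rw [Fin.sum_univ_three] at hv hw
  have key : α.d x v w = α.d x
      (θ 0 x v • dualFrame θ 0 x + θ 1 x v • dualFrame θ 1 x + θ 2 x v • dualFrame θ 2 x)
      (θ 0 x w • dualFrame θ 0 x + θ 1 x w • dualFrame θ 1 x + θ 2 x w • dualFrame θ 2 x) := by
    rw [← hv, ← hw]
  rw [key]
  simp only [OneForm.d_add_left, OneForm.d_smul_left, OneForm.d_add_right,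
    OneForm.d_smul_right, OneForm.d_self, OneForm.wedge]
  rw [α.d_swap x (dualFrame θ 1 x) (dualFrame θ 0 x), α.d_swap x (dualFrame θ 2 x)
    (dualFrame θ 1 x), α.d_swap x (dualFrame θ 0 x) (dualFrame θ 2 x)]
  ring

/-- The structure equations of a coframe `θ` and a form `A` near `x₀`. -/
structure StructureEq (θ : Fin 3 → OneForm V N) (A : OneForm V N) (K : N → ℝ) (x₀ : N) : Prop where
  smooth : ∀ᶠ y in 𝓝 x₀, ∀ i, (θ i).SmoothAt y
  invertible : ∀ᶠ y in 𝓝 x₀, (coframeMap θ y).IsInvertible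
  smooth_A : ∀ᶠ y in 𝓝 x₀, A.SmoothAt y
  smooth_K : ContMDiffAt 𝓘(ℝ, V) 𝓘(ℝ, ℝ) ∞ K x₀
  d_zero : ∀ᶠ y in 𝓝 x₀, ∃ a : ℝ, ∀ v w,
    (θ 0).d y v w = -(A.wedge (θ 0) y v w) + a * (θ 1).wedge (θ 2) y v w
  d_one : ∀ᶠ y in 𝓝 x₀, ∃ a : ℝ, ∀ v w,
    (θ 1).d y v w = A.wedge (θ 1) y v w + a * (θ 2).wedge (θ 0) y v w
  d_two : ∀ᶠ y in 𝓝 x₀, ∀ v w, (θ 2).d y v w = (θ 0).wedge (θ 1) y v w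
  d_A : ∀ᶠ y in 𝓝 x₀, ∃ b₁ b₂ : ℝ, ∀ v w, A.d y v w = b₁ * (θ 1).wedge (θ 2) y v w +
    b₂ * (θ 2).wedge (θ 0) y v w + K y * (θ 0).wedge (θ 1) y v w

/-- There are four conditions on the three coefficients of `A`. The redundant one, that both
equations prescribe the same $\theta_2$ coefficient, is $d(\theta_0\wedge\theta_1)=0$. -/
theorem exists_structureEq [CompleteSpace V] {θ : Fin 3 → OneForm V N} {x₀ : N}
    (hθ : ∀ᶠ y in 𝓝 x₀, ∀ i, (θ i).SmoothAt y) (h : (coframeMap θ x₀).IsInvertible)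
    (hd : ∀ᶠ y in 𝓝 x₀, ∀ v w, (θ 2).d y v w = (θ 0).wedge (θ 1) y v w) :
    ∃ A K, StructureEq θ A K x₀ := by
  have hi := eventually_isInvertible hθ.self_of_nhds h
  let e := dualFrame θ
  have hs : ∀ᶠ y in 𝓝 x₀, ∀ i, ∀ᶠ z in 𝓝 y, (θ i).SmoothAt z :=
    hθ.eventually_nhds.mono fun y hy i ↦ hy.mono fun z hz ↦ hz i
  -- The $\theta_0$ coefficient is forced by $d\theta_1$, the other two by $d\theta_0$.
  let A : OneForm V N :=
    (OneForm.fmul (fun y ↦ (θ 1).d y (e 0 y) (e 1 y)) (θ 0)).add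
      ((OneForm.fmul (fun y ↦ (θ 0).d y (e 0 y) (e 1 y)) (θ 1)).add
        (OneForm.fmul (fun y ↦ (θ 0).d y (e 0 y) (e 2 y)) (θ 2)))
  have hA : ∀ᶠ y in 𝓝 x₀, A.SmoothAt y := by
    filter_upwards [hs, hθ, hi] with y h1 h2 h3
    have hf := smoothVFieldAt_dualFrame h2 h3
    exact ((h2 0).fmul (OneForm.smoothAt_d_vField (h1 1) (hf 0) (hf 1))).add
      (((h2 1).fmul (OneForm.smoothAt_d_vField (h1 0) (hf 0) (hf 1))).add
      ((h2 2).fmul (OneForm.smoothAt_d_vField (h1 0) (hf 0) (hf 2))))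
  have hf := smoothVFieldAt_dualFrame hθ.self_of_nhds h
  have hApply : ∀ y v, A y v = (θ 1).d y (e 0 y) (e 1 y) * θ 0 y v +
      ((θ 0).d y (e 0 y) (e 1 y) * θ 1 y v + (θ 0).d y (e 0 y) (e 2 y) * θ 2 y v) :=
    fun y v ↦ rfl
  refine ⟨A, fun y ↦ A.d y (e 0 y) (e 1 y), hθ, hi, hA,
    OneForm.smoothAt_d_vField hA (hf 0) (hf 1), ?_, ?_, hd, ?_⟩
  · filter_upwards [hi] with y hy
    refine ⟨(θ 0).d y (e 1 y) (e 2 y), fun v w ↦ ?_⟩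
    rw [(θ 0).d_eq_coframe hy]
    change (θ 0).d y (e 0 y) (e 1 y) * _ + (θ 0).d y (e 1 y) (e 2 y) * _ +
      (θ 0).d y (e 2 y) (e 0 y) * _ = _
    rw [(θ 0).d_swap y (e 2 y) (e 0 y)]
    simp only [OneForm.wedge, hApply]
    ring
  · filter_upwards [hi, hs, hθ, hd.eventually_nhds] with y hy h1 h2 h3
    refine ⟨(θ 1).d y (e 2 y) (e 0 y), fun v w ↦ ?_⟩
    -- On the dual frame this reads $d\theta_0(e_2,e_0)=d\theta_1(e_1,e_2)$, the compatibility
    -- needed for the second equation.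
    have c := cyclic_of_d_eq_wedge (h1 2) (h2 0) (h2 1) h3 (e 0 y) (e 1 y) (e 2 y)
    have E := fun i j ↦ apply_dualFrame (θ := θ) hy i j
    change ∀ i j, θ i y (e j y) = if i = j then 1 else 0 at E
    simp only [E] at c
    norm_num at c
    rw [if_neg (by decide), if_neg (by decide), (θ 0).d_swap y (e 2 y) (e 0 y)] at c
    rw [(θ 1).d_eq_coframe hy]
    change (θ 1).d y (e 0 y) (e 1 y) * _ + (θ 1).d y (e 1 y) (e 2 y) * _ +
      (θ 1).d y (e 2 y) (e 0 y) * _ = _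
    simp only [OneForm.wedge, hApply]
    linear_combination (-(θ 1 y v * θ 2 y w - θ 1 y w * θ 2 y v)) * c
  · filter_upwards [hi] with y hy
    refine ⟨A.d y (e 1 y) (e 2 y), A.d y (e 2 y) (e 0 y), fun v w ↦ ?_⟩
    rw [A.d_eq_coframe hy]
    change A.d y (e 0 y) (e 1 y) * _ + A.d y (e 1 y) (e 2 y) * _ +
      A.d y (e 2 y) (e 0 y) * _ = _
    ring

end Coframe

namespace PathGeometry

variable {M : Type*} [TopologicalSpace M] [ChartedSpace E3 M] [IsManifold (𝓡 3) ∞ M]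
  {P : PathGeometry M}

theorem _root_.PathGeom.IsLocalFrame.mem {L : ∀ x : M, Submodule ℝ (TangentSpace (𝓡 3) x)}
    {X : VField M} {W : Set M} (h : IsLocalFrame L X W) {x : M} (hx : x ∈ W) : X x ∈ L x :=
  h.span x hx ▸ Submodule.mem_span_singleton_self _

theorem _root_.PathGeom.IsLocalFrame.smoothVFieldAt
    {L : ∀ x : M, Submodule ℝ (TangentSpace (𝓡 3) x)}
    {X : VField M} {W : Set M} (h : IsLocalFrame L X W) {x : M} (hx : x ∈ W) :
    SmoothVFieldAt X x :=
  smoothVFieldAt_of_section (h.smooth.contMDiffAt (h.isOpen.mem_nhds hx))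

namespace ContactForm

variable {η : P.ContactForm}

theorem form_smoothAt {x : M} (hx : x ∈ η.domain) : η.form.SmoothAt x :=
  (OneForm.smoothOn_iff η.form η.isContact.isOpen).1 η.isContact.smooth x hx

theorem eventually_form_smoothAt {x : M} (hx : x ∈ η.domain) :
    ∀ᶠ y in 𝓝 x, η.form.SmoothAt y :=
  Filter.eventually_of_mem (η.isContact.isOpen.mem_nhds hx) fun _ hy ↦ form_smoothAt hy

variable (η) in
/-- The coframe `(dη(·, X₂) / dη(X₁, X₂), dη(X₁, ·), η)`. -/
def localCoframe (X₁ X₂ : VField M) : Fin 3 → OneForm E3 M :=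
  ![OneForm.fmul (fun y ↦ -(η.form.d y (X₁ y) (X₂ y))⁻¹) (η.form.contractD X₂),
    η.form.contractD X₁, η.form]

theorem localCoframe_zero (X₁ X₂ : VField M) (x : M) (v : TangentSpace (𝓡 3) x) :
    localCoframe η X₁ X₂ 0 x v = (η.form.d x (X₁ x) (X₂ x))⁻¹ * η.form.d x v (X₂ x) := by
  have e : localCoframe η X₁ X₂ 0 x v =
    -(η.form.d x (X₁ x) (X₂ x))⁻¹ * η.form.contractD X₂ x v := rfl
  rw [e, OneForm.contractD_apply, η.form.d_swap x v]
  ring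

theorem localCoframe_one (X₁ X₂ : VField M) (x : M) (v : TangentSpace (𝓡 3) x) :
    localCoframe η X₁ X₂ 1 x v = η.form.d x (X₁ x) v :=
  OneForm.contractD_apply _ _ _ _

theorem localCoframe_two (X₁ X₂ : VField M) (x : M) (v : TangentSpace (𝓡 3) x) :
    localCoframe η X₁ X₂ 2 x v = η.form x v := rfl

theorem localCoframe_smoothAt {X₁ X₂ : VField M} {W₁ W₂ : Set M} (h₁ : IsLocalFrame P.L₁ X₁ W₁)
    (h₂ : IsLocalFrame P.L₂ X₂ W₂) {x : M} (hx : x ∈ η.domain) (hx₁ : x ∈ W₁) (hx₂ : x ∈ W₂)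
    (i : Fin 3) : (localCoframe η X₁ X₂ i).SmoothAt x := by
  have hη := eventually_form_smoothAt hx
  have s₁ := h₁.smoothVFieldAt hx₁
  have s₂ := h₂.smoothVFieldAt hx₂
  have hm := d_ne_zero hx (h₁.mem hx₁) (h₂.mem hx₂) (h₁.ne_zero x hx₁) (h₂.ne_zero x hx₂)
  have hd : ContMDiffAt (𝓡 3) 𝓘(ℝ, ℝ) ∞ (fun y ↦ η.form.d y (X₁ y) (X₂ y)) x :=
    OneForm.smoothAt_d_vField hη s₁ s₂
  fin_cases i
  · exact (OneForm.contractD_smoothAt hη s₂).fmul (hd.inv₀ hm).neg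
  · exact OneForm.contractD_smoothAt hη s₁
  · exact form_smoothAt hx

/-- Inserting $X_2$, respectively $X_1$, in $d\eta=u^1\wedge u^2$ kills one of the two terms. Hence
$u$ differs from the local coframe by the diagonal action, with factor $u^1(X_1)$. -/
theorem IsAdapted.eq_localCoframe {X₁ X₂ : VField M} {x : M} (m₁ : X₁ x ∈ P.L₁ x)
    (m₂ : X₂ x ∈ P.L₂ x) (n₁ : X₁ x ≠ 0) (n₂ : X₂ x ≠ 0)
    {u : TangentSpace (𝓡 3) x →L[ℝ] (Fin 3 → ℝ)} (h : η.IsAdapted x u)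
    (v : TangentSpace (𝓡 3) x) :
    u v 0 = u (X₁ x) 0 * localCoframe η X₁ X₂ 0 x v ∧
    u v 1 = (u (X₁ x) 0)⁻¹ * localCoframe η X₁ X₂ 1 x v ∧
    u v 2 = localCoframe η X₁ X₂ 2 x v := by
  have hm := d_ne_zero h.mem_domain m₁ m₂ n₁ n₂
  have hτ := h.first_ne_zero m₁ n₁
  rw [localCoframe_zero, localCoframe_one, localCoframe_two, h.third]
  rw [h.wedge] at hm
  simp only [h.wedge, h.first_L₂ _ m₂, h.second_L₁ _ m₁, zero_mul, mul_zero, sub_zero] at hm ⊢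
  refine ⟨?_, ?_, trivial⟩
  · have := right_ne_zero_of_mul hm
    field_simp
  · field_simp

/-- The adapted coframe normalized by $u^1(X_1)=1$ coincides with the local coframe. -/
theorem localCoframe_isInvertible {X₁ X₂ : VField M} {x : M} (hx : x ∈ η.domain)
    (m₁ : X₁ x ∈ P.L₁ x) (m₂ : X₂ x ∈ P.L₂ x) (n₁ : X₁ x ≠ 0) (n₂ : X₂ x ≠ 0) :
    (coframeMap (localCoframe η X₁ X₂) x).IsInvertible := by
  obtain ⟨u, hu, e⟩ := exists_isAdapted hx m₁ n₁ one_ne_zero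
  refine coframeMap_isInvertible (by simp) fun v hv ↦ hu.bijective.1 ?_
  obtain ⟨e0, e1, e2⟩ := hu.eq_localCoframe m₁ m₂ n₁ n₂ v
  rw [map_zero]
  ext i
  fin_cases i
  · exact e0.trans (by rw [hv 0, mul_zero]; rfl)
  · exact e1.trans (by rw [hv 1, mul_zero]; rfl)
  · exact e2.trans (hv 2)

theorem d_form_eq_wedge {X₁ X₂ : VField M} {x : M} (hx : x ∈ η.domain)
    (m₁ : X₁ x ∈ P.L₁ x) (m₂ : X₂ x ∈ P.L₂ x) (n₁ : X₁ x ≠ 0) (n₂ : X₂ x ≠ 0)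
    (v w : TangentSpace (𝓡 3) x) :
    η.form.d x v w = (localCoframe η X₁ X₂ 0).wedge (localCoframe η X₁ X₂ 1) x v w := by
  obtain ⟨u, hu, e⟩ := exists_isAdapted hx m₁ n₁ one_ne_zero
  obtain ⟨v0, v1, -⟩ := hu.eq_localCoframe m₁ m₂ n₁ n₂ v
  obtain ⟨w0, w1, -⟩ := hu.eq_localCoframe m₁ m₂ n₁ n₂ w
  rw [hu.wedge, v0, v1, w0, w1, e, OneForm.wedge]
  ring

theorem exists_localCoframe {X₁ X₂ : VField M} {W₁ W₂ : Set M} (h₁ : IsLocalFrame P.L₁ X₁ W₁)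
    (h₂ : IsLocalFrame P.L₂ X₂ W₂) {x : M} (hx : x ∈ η.domain) (hx₁ : x ∈ W₁) (hx₂ : x ∈ W₂) :
    ∃ A K, StructureEq (localCoframe η X₁ X₂) A K x := by
  have hev : ∀ᶠ y in 𝓝 x, y ∈ η.domain ∧ y ∈ W₁ ∧ y ∈ W₂ :=
    (η.isContact.isOpen.eventually_mem hx).and
      ((h₁.isOpen.eventually_mem hx₁).and (h₂.isOpen.eventually_mem hx₂))
  refine exists_structureEq ?_ ?_ ?_
  · exact hev.mono fun y hy i ↦ localCoframe_smoothAt h₁ h₂ hy.1 hy.2.1 hy.2.2 i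
  · exact localCoframe_isInvertible hx (h₁.mem hx₁) (h₂.mem hx₂) (h₁.ne_zero x hx₁)
      (h₂.ne_zero x hx₂)
  · exact hev.mono fun y hy v w ↦ d_form_eq_wedge hy.1 (h₁.mem hy.2.1) (h₂.mem hy.2.2)
      (h₁.ne_zero y hy.2.1) (h₂.ne_zero y hy.2.2) v w

end ContactForm

end PathGeometry
end
end PathGeom

/-! ### Structure equations on $B$ in local frames. -/

namespace PathGeom

noncomputable section

set_option linter.unusedSectionVars false

section Forms

variable {V : Type*} [NormedAddCommGroup V] [NormedSpace ℝ V]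
  {N : Type*} [TopologicalSpace N] [ChartedSpace V N] [IsManifold 𝓘(ℝ, V) ∞ N]
  {V' : Type*} [NormedAddCommGroup V'] [NormedSpace ℝ V']
  {N' : Type*} [TopologicalSpace N'] [ChartedSpace V' N'] [IsManifold 𝓘(ℝ, V') ∞ N']

theorem dform_comp {g : ℝ → ℝ} {g' : ℝ} {f : N → ℝ} {x : N} (hg : HasDerivAt g g' (f x))
    (hf : ContMDiffAt 𝓘(ℝ, V) 𝓘(ℝ, ℝ) ∞ f x) (v : TangentSpace 𝓘(ℝ, V) x) :
    dform (fun y ↦ g (f y)) x v = g' * dform f x v := by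
  have h1 : HasMFDerivAt 𝓘(ℝ, ℝ) 𝓘(ℝ, ℝ) g (f x) (ContinuousLinearMap.toSpanSingleton ℝ g') :=
    hg.hasFDerivAt.hasMFDerivAt
  have h2 := h1.comp x (hf.mdifferentiableAt (by simp)).hasMFDerivAt
  have e : dform (fun y ↦ g (f y)) x v = _ := DFunLike.congr_fun h2.mfderiv v
  rw [e]
  exact mul_comm _ _

theorem dform_const (c : ℝ) (x : N) (v : TangentSpace 𝓘(ℝ, V) x) :
    dform (fun _ : N ↦ c) x v = 0 :=
  DFunLike.congr_fun (mfderiv_const (I := 𝓘(ℝ, V)) (I' := 𝓘(ℝ, ℝ)) (c := c) (x := x)) v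

theorem OneForm.d_const_fmul (c : ℝ) {α : OneForm V N} {x : N} (hα : α.SmoothAt x)
    (v w : TangentSpace 𝓘(ℝ, V) x) : (OneForm.fmul (fun _ ↦ c) α).d x v w = c * α.d x v w := by
  rw [OneForm.d_fmul contMDiffAt_const hα, OneForm.wedge, dform_const, dform_const]
  ring

theorem OneForm.pullback_apply (f : N → N') (α : OneForm V' N') (x : N)
    (v : TangentSpace 𝓘(ℝ, V) x) :
    OneForm.pullback f α x v = α (f x) (mfderiv 𝓘(ℝ, V) 𝓘(ℝ, V') f x v) := rfl

theorem dform_pullback {f : N → N'} {g : N' → ℝ} {x : N}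
    (hg : ContMDiffAt 𝓘(ℝ, V') 𝓘(ℝ, ℝ) ∞ g (f x))
    (hf : ContMDiffAt 𝓘(ℝ, V) 𝓘(ℝ, V') ∞ f x) (v : TangentSpace 𝓘(ℝ, V) x) :
    dform (fun y ↦ g (f y)) x v = dform g (f x) (mfderiv 𝓘(ℝ, V) 𝓘(ℝ, V') f x v) :=
  DFunLike.congr_fun (mfderiv_comp x (hg.mdifferentiableAt (by simp))
    (hf.mdifferentiableAt (by simp))) v

end Forms

namespace PathGeometry

variable {M : Type*} [TopologicalSpace M] [ChartedSpace E3 M] [IsManifold (𝓡 3) ∞ M]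
  {P : PathGeometry M}

namespace ContactForm

variable {η : P.ContactForm}

theorem mfderiv_proj_eq_zero {u : η.B} {v : TangentSpace 𝓘(ℝ, E3 × ℝ) u}
    (hv : ∀ i, η.taut i u v = 0) :
    mfderiv 𝓘(ℝ, E3 × ℝ) (𝓡 3) (B.proj : η.B → M) u v = 0 := by
  refine u.adapted.bijective.1 ?_
  rw [map_zero]
  ext i
  exact hv i

/-- The covector `a` satisfies the first two normalized structure equations at `u`. -/
def NormalizedAt (u : η.B) (a : TangentSpace 𝓘(ℝ, E3 × ℝ) u →L[ℝ] ℝ) : Prop :=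
  (∃ c : ℝ, ∀ v w, (η.taut 0).d u v w =
    -(a v * η.taut 0 u w - a w * η.taut 0 u v) + c * (η.taut 1).wedge (η.taut 2) u v w) ∧
  ∃ c : ℝ, ∀ v w, (η.taut 1).d u v w =
    (a v * η.taut 1 u w - a w * η.taut 1 u v) + c * (η.taut 2).wedge (η.taut 0) u v w

variable (η) in
/-- The tautological forms together with a 1-form `α`. -/
def coframe4 (α : OneForm (E3 × ℝ) η.B) : Fin 4 → OneForm (E3 × ℝ) η.B :=
  ![η.taut 0, η.taut 1, η.taut 2, α]

/-- `α` and `K` satisfy all the structure equations near `u₀`. -/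
structure LocalStructure (α : OneForm (E3 × ℝ) η.B) (K : η.B → ℝ) (u₀ : η.B) : Prop where
  smooth : ∀ᶠ u in 𝓝 u₀, ∀ i, (coframe4 η α i).SmoothAt u
  invertible : ∀ᶠ u in 𝓝 u₀, (coframeMap (coframe4 η α) u).IsInvertible
  smooth_K : ContMDiffAt 𝓘(ℝ, E3 × ℝ) 𝓘(ℝ, ℝ) ∞ K u₀
  normalized : ∀ᶠ u in 𝓝 u₀, NormalizedAt u (α u)
  d_two : ∀ᶠ u in 𝓝 u₀, ∀ v w, (η.taut 2).d u v w = (η.taut 0).wedge (η.taut 1) u v w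
  d_conn : ∀ᶠ u in 𝓝 u₀, ∃ b₁ b₂ : ℝ, ∀ v w, α.d u v w =
    b₁ * (η.taut 1).wedge (η.taut 2) u v w + b₂ * (η.taut 2).wedge (η.taut 0) u v w +
      K u * (η.taut 0).wedge (η.taut 1) u v w

/-- The first equation on the pairs $(e_0,e_j)$, $j\ne0$, gives the value of `a` on $e_j$; the
second on $(e_0,e_1)$ gives its value on $e_0$. The form `α` only completes the frame and need not
be normalized. -/
theorem eq_of_normalizedAt {u : η.B} {a a' : TangentSpace 𝓘(ℝ, E3 × ℝ) u →L[ℝ] ℝ}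
    {α : OneForm (E3 × ℝ) η.B} (hi : (coframeMap (coframe4 η α) u).IsInvertible)
    (h : NormalizedAt u a) (h' : NormalizedAt u a') : a = a' := by
  obtain ⟨⟨c₁, h₁⟩, c₂, h₂⟩ := h
  obtain ⟨⟨c₁', h₁'⟩, c₂', h₂'⟩ := h'
  let e := dualFrame (coframe4 η α)
  have E0 : ∀ j, η.taut 0 u (e j u) = if 0 = j then 1 else 0 := fun j ↦ apply_dualFrame hi 0 j
  have E1 : ∀ j, η.taut 1 u (e j u) = if 1 = j then 1 else 0 := fun j ↦ apply_dualFrame hi 1 j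
  have E2 : ∀ j, η.taut 2 u (e j u) = if 2 = j then 1 else 0 := fun j ↦ apply_dualFrame hi 2 j
  have k1 := fun i j ↦ (h₁ (e i u) (e j u)).symm.trans (h₁' (e i u) (e j u))
  have k2 := (h₂ (e 0 u) (e 1 u)).symm.trans (h₂' (e 0 u) (e 1 u))
  have z : ∀ j, a (e j u) = a' (e j u) := by
    have k01 := k1 0 1
    have k02 := k1 0 2
    have k03 := k1 0 3
    simp [OneForm.wedge, E0, E1, E2] at k01 k02 k03 k2
    intro j
    fin_cases j
    · exact k2
    · exact k01
    · exact k02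
    · exact k03
  ext v
  rw [eq_sum_dualFrame hi v, map_sum, map_sum]
  refine Finset.sum_congr rfl fun j _ ↦ ?_
  rw [map_smul, map_smul]
  exact congrArg _ (z j)

section Local

variable {X₁ X₂ : VField M} {W₁ W₂ : Set M}

theorem taut_eq (h₁ : IsLocalFrame P.L₁ X₁ W₁) (h₂ : IsLocalFrame P.L₂ X₂ W₂) {u : η.B}
    (hu₁ : u.proj ∈ W₁) (hu₂ : u.proj ∈ W₂) :
    η.taut 0 u = OneForm.fmul (fiberCoord X₁)
      (OneForm.pullback B.proj (localCoframe η X₁ X₂ 0)) u ∧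
    η.taut 1 u = OneForm.fmul (fun u ↦ (fiberCoord X₁ u)⁻¹)
      (OneForm.pullback B.proj (localCoframe η X₁ X₂ 1)) u ∧
    η.taut 2 u = OneForm.pullback B.proj (localCoframe η X₁ X₂ 2) u := by
  have k := u.adapted.eq_localCoframe (h₁.mem hu₁) (h₂.mem hu₂) (h₁.ne_zero _ hu₁)
    (h₂.ne_zero _ hu₂)
  refine ⟨?_, ?_, ?_⟩
  · ext v; exact (k _).1
  · ext v; exact (k _).2.1
  · ext v; exact (k _).2.2

/-- The normalized connection form in local frames. -/
def localConn (X₁ : VField M) (A : OneForm E3 M) : OneForm (E3 × ℝ) η.B :=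
  (dform fun u ↦ -Real.log (fiberCoord X₁ u)).add (OneForm.pullback B.proj A)

theorem localConn_apply (h₁ : IsLocalFrame P.L₁ X₁ W₁) (A : OneForm E3 M) {u : η.B}
    (hu : u.proj ∈ W₁) (v : TangentSpace 𝓘(ℝ, E3 × ℝ) u) :
    localConn X₁ A u v = -(fiberCoord X₁ u)⁻¹ * dform (fiberCoord X₁) u v +
      OneForm.pullback B.proj A u v := by
  rw [localConn, OneForm.add_apply, dform_comp (g := fun t ↦ -Real.log t)
    (Real.hasDerivAt_log (fiberCoord_ne_zero h₁ hu)).neg (contMDiffAt_fiberCoord h₁ hu)]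

/-- Differentiating $\omega^1=\tau\theta_0$ and $\omega^2=\tau^{-1}\theta_1$ produces $\pm
d\log|\tau|$, which the first term of the connection absorbs. That term is exact, so $d\alpha$ is
the pull-back of $dA$. -/
theorem localStructure (h₁ : IsLocalFrame P.L₁ X₁ W₁) (h₂ : IsLocalFrame P.L₂ X₂ W₂) {u₀ : η.B}
    (hu₁ : u₀.proj ∈ W₁) (hu₂ : u₀.proj ∈ W₂) {A : OneForm E3 M} {K : M → ℝ}
    (h : StructureEq (localCoframe η X₁ X₂) A K u₀.proj) :
    LocalStructure (localConn X₁ A) (fun u ↦ K u.proj) u₀ := by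
  set θ := localCoframe η X₁ X₂ with hθ
  have hev : ∀ᶠ u : η.B in 𝓝 u₀, u.proj ∈ W₁ ∧ u.proj ∈ W₂ :=
    continuous_proj.continuousAt.eventually ((h₁.isOpen.eventually_mem hu₁).and
      (h₂.isOpen.eventually_mem hu₂))
  have up : ∀ {p : M → Prop}, (∀ᶠ y in 𝓝 u₀.proj, p y) → ∀ᶠ u : η.B in 𝓝 u₀, p u.proj :=
    fun hp ↦ continuous_proj.continuousAt.eventually hp
  have hteq := hev.mono fun u hu ↦ taut_eq (η := η) h₁ h₂ hu.1 hu.2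
  have hτ : ∀ᶠ u : η.B in 𝓝 u₀, ContMDiffAt 𝓘(ℝ, E3 × ℝ) 𝓘(ℝ, ℝ) ∞ (fiberCoord X₁ : η.B → ℝ) u :=
    hev.mono fun u hu ↦ contMDiffAt_fiberCoord h₁ hu.1
  have hτ' : ∀ᶠ u : η.B in 𝓝 u₀,
      ContMDiffAt 𝓘(ℝ, E3 × ℝ) 𝓘(ℝ, ℝ) ∞ (fun u : η.B ↦ (fiberCoord X₁ u)⁻¹) u :=
    (hτ.and hev).mono fun u hu ↦ hu.1.inv₀ (fiberCoord_ne_zero h₁ hu.2.1)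
  have hlog : ∀ᶠ u : η.B in 𝓝 u₀, ContMDiffAt 𝓘(ℝ, E3 × ℝ) 𝓘(ℝ, ℝ) ∞
      (fun u : η.B ↦ -Real.log (fiberCoord X₁ u)) u :=
    (hτ.and hev).mono fun u hu ↦ ((Real.contDiffAt_log.2
      (fiberCoord_ne_zero h₁ hu.2.1)).contMDiffAt.comp u hu.1).neg
  have hpθ : ∀ᶠ u : η.B in 𝓝 u₀, ∀ i, (OneForm.pullback (B.proj : η.B → M) (θ i)).SmoothAt u :=
    (up h.smooth).mono fun u hu i ↦ (hu i).pullback (contMDiffAt_proj u)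
  have hpA : ∀ᶠ u : η.B in 𝓝 u₀, (OneForm.pullback (B.proj : η.B → M) A).SmoothAt u :=
    (up h.smooth_A).mono fun u hu ↦ hu.pullback (contMDiffAt_proj u)
  have st : ∀ᶠ u : η.B in 𝓝 u₀, ∀ i, (η.taut i).SmoothAt u := by
    filter_upwards [hteq.eventually_nhds, hτ, hτ', hpθ] with u e t t' p i
    fin_cases i
    · exact (OneForm.SmoothAt.fmul t (p 0)).congr (e.mono fun _ h ↦ h.1)
    · exact (OneForm.SmoothAt.fmul t' (p 1)).congr (e.mono fun _ h ↦ h.2.1)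
    · exact (p 2).congr (e.mono fun _ h ↦ h.2.2)
  have sα : ∀ᶠ u : η.B in 𝓝 u₀, (localConn X₁ A : OneForm _ η.B).SmoothAt u := by
    filter_upwards [hlog, hpA] with u l p
    exact (dform_smoothAt l).add p
  refine ⟨?_, ?_, h.smooth_K.comp u₀ (contMDiffAt_proj u₀), ?_, ?_, ?_⟩
  · filter_upwards [st, sα] with u h1 h2 i
    fin_cases i
    exacts [h1 0, h1 1, h1 2, h2]
  · filter_upwards [hev] with u hu
    refine coframeMap_isInvertible (by simp) fun v hv ↦ ?_
    -- A vector killed by all four forms is vertical, so $\pi^*A$ vanishes on it as well; what is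
    -- left of $\alpha$ is a multiple of $d\tau$.
    have hp : mfderiv 𝓘(ℝ, E3 × ℝ) (𝓡 3) (B.proj : η.B → M) u v = 0 := by
      refine mfderiv_proj_eq_zero fun i ↦ ?_
      fin_cases i
      exacts [hv 0, hv 1, hv 2]
    refine eq_zero_of_mfderiv h₁ hu.1 hp ?_
    have h3 : localConn X₁ A u v = 0 := hv 3
    have h4 : OneForm.pullback (B.proj : η.B → M) A u v = 0 :=
      (congrArg (A u.proj) hp).trans (map_zero _)
    rw [localConn_apply h₁ A hu.1, h4, add_zero] at h3
    exact (mul_eq_zero.1 h3).resolve_left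
      (neg_ne_zero.2 (inv_ne_zero (fiberCoord_ne_zero h₁ hu.1)))
  · filter_upwards [hev, hteq, hteq.eventually_nhds, hτ, hτ', hpθ, st, up h.d_zero, up h.d_one,
      up h.smooth] with u hu e e' t t' p s d0 d1 sθ
    obtain ⟨c, d0⟩ := d0
    obtain ⟨c', d1⟩ := d1
    have τ0 := fiberCoord_ne_zero (η := η) h₁ hu.1
    have e0 := fun v ↦ DFunLike.congr_fun e.1 v
    have e1 := fun v ↦ DFunLike.congr_fun e.2.1 v
    have e2 := fun v ↦ DFunLike.congr_fun e.2.2 v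
    simp only [OneForm.fmul_apply] at e0 e1
    -- One factor $\tau^{\pm1}$ comes from the form being differentiated, the other from rewriting
    -- the 2-form in terms of the $\omega^i$.
    refine ⟨⟨c * fiberCoord X₁ u ^ 2, fun v w ↦ ?_⟩, c' * (fiberCoord X₁ u ^ 2)⁻¹, fun v w ↦ ?_⟩
    · rw [OneForm.d_congr (e'.mono fun _ h ↦ h.1), OneForm.d_fmul t (p 0),
        OneForm.d_pullback (contMDiffAt_proj u) (sθ 0), d0]
      simp only [OneForm.wedge, localConn_apply h₁ A hu.1, e0, e1, e2, OneForm.pullback_apply]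
      field_simp
      ring
    · rw [OneForm.d_congr (e'.mono fun _ h ↦ h.2.1), OneForm.d_fmul t' (p 1),
        OneForm.d_pullback (contMDiffAt_proj u) (sθ 1), d1]
      have i1 : ∀ v, dform (fun u : η.B ↦ (fiberCoord X₁ u)⁻¹) u v =
          -(fiberCoord X₁ u ^ 2)⁻¹ * dform (fiberCoord X₁) u v :=
        fun v ↦ dform_comp (hasDerivAt_inv τ0) t v
      simp only [OneForm.wedge, localConn_apply h₁ A hu.1, e0, e1, e2, OneForm.pullback_apply, i1]
      field_simp
      ring
  · filter_upwards [hev, hteq, hteq.eventually_nhds, up h.d_two, up h.smooth] with u hu e e' d2 sθ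
    intro v w
    have τ0 := fiberCoord_ne_zero (η := η) h₁ hu.1
    rw [OneForm.d_congr (e'.mono fun _ h ↦ h.2.2), OneForm.d_pullback (contMDiffAt_proj u) (sθ 2),
      d2]
    simp only [OneForm.wedge, e.1, e.2.1, OneForm.fmul_apply, OneForm.pullback_apply]
    field_simp
    rfl
  · filter_upwards [hev, hteq, hlog, hpA, up h.smooth_A, up h.d_A] with u hu e l p sA dA
    obtain ⟨b₁, b₂, dA⟩ := dA
    have τ0 := fiberCoord_ne_zero (η := η) h₁ hu.1
    -- Only $b_1,b_2$ are rescaled: $\omega^1\wedge\omega^2=\theta_0\wedge\theta_1$ carries no power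
    -- of $\tau$, so $K$ is simply pulled back.
    refine ⟨b₁ * fiberCoord X₁ u, b₂ * (fiberCoord X₁ u)⁻¹, fun v w ↦ ?_⟩
    rw [localConn, OneForm.d_add (dform_smoothAt l) p, d_dform l,
      OneForm.d_pullback (contMDiffAt_proj u) sA, dA]
    simp only [OneForm.wedge, e.1, e.2.1, e.2.2, OneForm.fmul_apply, OneForm.pullback_apply]
    field_simp
    ring

end Local

end ContactForm

end PathGeometry
end
end PathGeom

/-! ### The normalized connection, its curvature, and the metric on $B$. -/

namespace PathGeom

noncomputable section

set_option linter.unusedSectionVars false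

namespace PathGeometry

variable {M : Type*} [TopologicalSpace M] [ChartedSpace E3 M] [IsManifold (𝓡 3) ∞ M]
  {P : PathGeometry M}

namespace ContactForm

variable {η : P.ContactForm}

theorem B.exists_frames (u : η.B) : ∃ (X₁ X₂ : VField M) (W₁ W₂ : Set M),
    IsLocalFrame P.L₁ X₁ W₁ ∧ IsLocalFrame P.L₂ X₂ W₂ ∧ u.proj ∈ W₁ ∧ u.proj ∈ W₂ := by
  obtain ⟨X₁, W₁, hx₁, h₁⟩ := P.smooth₁ u.proj
  obtain ⟨X₂, W₂, hx₂, h₂⟩ := P.smooth₂ u.proj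
  exact ⟨X₁, X₂, W₁, W₂, h₁, h₂, hx₁, hx₂⟩

theorem exists_localStructure (u : η.B) : ∃ (X₁ : VField M) (W₁ : Set M) (A : OneForm E3 M)
    (K : η.B → ℝ), IsLocalFrame P.L₁ X₁ W₁ ∧ u.proj ∈ W₁ ∧ LocalStructure (localConn X₁ A) K u := by
  obtain ⟨X₁, X₂, W₁, W₂, h₁, h₂, hu₁, hu₂⟩ := u.exists_frames
  obtain ⟨A, K, h⟩ := exists_localCoframe h₁ h₂ u.adapted.mem_domain hu₁ hu₂
  exact ⟨X₁, W₁, A, _, h₁, hu₁, localStructure h₁ h₂ hu₁ hu₂ h⟩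

theorem exists_normalizedAt (u : η.B) : ∃ a, NormalizedAt u a := by
  obtain ⟨X₁, W₁, A, K, -, -, h⟩ := exists_localStructure u
  exact ⟨_, h.normalized.self_of_nhds⟩

theorem normalizedAt_unique {u : η.B} {a a' : TangentSpace 𝓘(ℝ, E3 × ℝ) u →L[ℝ] ℝ}
    (h : NormalizedAt u a) (h' : NormalizedAt u a') : a = a' := by
  obtain ⟨X₁, W₁, A, K, -, -, k⟩ := exists_localStructure u
  exact eq_of_normalizedAt k.invertible.self_of_nhds h h'

variable (η) in
/-- The normalized connection form. -/
def conn : OneForm (E3 × ℝ) η.B := fun u ↦ (exists_normalizedAt u).choose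

theorem conn_normalizedAt (u : η.B) : NormalizedAt u (η.conn u) :=
  (exists_normalizedAt u).choose_spec

variable (η) in
/-- The curvature function of the normalized connection form. -/
def curv (u : η.B) : ℝ :=
  η.conn.d u (dualFrame (coframe4 η η.conn) 0 u) (dualFrame (coframe4 η η.conn) 1 u)

/-- By pointwise uniqueness the form defined by choice agrees near each point with the explicit
local one, which supplies its smoothness and its exterior derivative. -/
theorem LocalStructure.eventually_eq {α : OneForm (E3 × ℝ) η.B} {K : η.B → ℝ} {u₀ : η.B}
    (h : LocalStructure α K u₀) : ∀ᶠ u in 𝓝 u₀, η.conn u = α u :=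
  h.normalized.mono fun u hu ↦ normalizedAt_unique (conn_normalizedAt u) hu

theorem coeff_eq_d {α : OneForm (E3 × ℝ) η.B} {u : η.B}
    (hi : (coframeMap (coframe4 η α) u).IsInvertible)
    {β : OneForm (E3 × ℝ) η.B} {b₁ b₂ K : ℝ} (h : ∀ v w, β.d u v w =
    b₁ * (η.taut 1).wedge (η.taut 2) u v w + b₂ * (η.taut 2).wedge (η.taut 0) u v w +
      K * (η.taut 0).wedge (η.taut 1) u v w) :
    K = β.d u (dualFrame (coframe4 η α) 0 u) (dualFrame (coframe4 η α) 1 u) := by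
  let e := dualFrame (coframe4 η α)
  have E0 : ∀ j, η.taut 0 u (e j u) = if 0 = j then 1 else 0 := fun j ↦ apply_dualFrame hi 0 j
  have E1 : ∀ j, η.taut 1 u (e j u) = if 1 = j then 1 else 0 := fun j ↦ apply_dualFrame hi 1 j
  have E2 : ∀ j, η.taut 2 u (e j u) = if 2 = j then 1 else 0 := fun j ↦ apply_dualFrame hi 2 j
  have k := h (e 0 u) (e 1 u)
  simp [OneForm.wedge, E0, E1, E2] at k
  exact k.symm

/-- Near each point, the normalized connection form satisfies the structure equations. -/
theorem localStructure_conn (u₀ : η.B) : LocalStructure η.conn η.curv u₀ := by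
  obtain ⟨X₁, W₁, A, K, -, -, h⟩ := exists_localStructure u₀
  set α : OneForm (E3 × ℝ) η.B := localConn X₁ A
  have e := h.eventually_eq
  have s : ∀ᶠ u in 𝓝 u₀, ∀ i, (coframe4 η η.conn i).SmoothAt u := by
    filter_upwards [h.smooth, e.eventually_nhds] with u h1 h2 i
    fin_cases i
    exacts [h1 0, h1 1, h1 2, OneForm.SmoothAt.congr (h1 3) h2]
  have inv : ∀ᶠ u in 𝓝 u₀, coframeMap (coframe4 η η.conn) u = coframeMap (coframe4 η α) u := by
    filter_upwards [e] with u h2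
    ext v i
    fin_cases i
    exacts [rfl, rfl, rfl, DFunLike.congr_fun h2 v]
  have hd : ∀ᶠ u in 𝓝 u₀, ∀ v w, η.conn.d u v w = α.d u v w :=
    e.eventually_nhds.mono fun u hu v w ↦ OneForm.d_congr hu v w
  have hinv : ∀ᶠ u in 𝓝 u₀, (coframeMap (coframe4 η η.conn) u).IsInvertible := by
    filter_upwards [h.invertible, inv] with u h1 h2
    rw [h2]; exact h1
  have hK : ∀ᶠ u in 𝓝 u₀, η.curv u = K u := by
    filter_upwards [h.d_conn, hd, hinv] with u h1 h2 h3
    obtain ⟨b₁, b₂, h1⟩ := h1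
    refine (coeff_eq_d h3 (β := η.conn) (b₁ := b₁) (b₂ := b₂) fun v w ↦ ?_).symm
    rw [h2, h1]
  refine ⟨s, hinv, h.smooth_K.congr_of_eventuallyEq hK,
    Filter.Eventually.of_forall conn_normalizedAt, h.d_two, ?_⟩
  filter_upwards [h.d_conn, hd, hK] with u h1 h2 h3
  rw [h3]
  obtain ⟨b₁, b₂, h1⟩ := h1
  exact ⟨b₁, b₂, fun v w ↦ (h2 v w).trans (h1 v w)⟩

theorem taut_smoothAt (i : Fin 3) (u : η.B) : (η.taut i).SmoothAt u := by
  have := (localStructure_conn u).smooth.self_of_nhds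
  fin_cases i
  exacts [this 0, this 1, this 2]

theorem conn_smoothAt (u : η.B) : η.conn.SmoothAt u :=
  (localStructure_conn u).smooth.self_of_nhds 3

theorem isInvertible_coframe4 (u : η.B) : (coframeMap (coframe4 η η.conn) u).IsInvertible :=
  (localStructure_conn u).invertible.self_of_nhds

theorem contMDiffAt_smul_const (s : ℝˣ) (u : η.B) :
    ContMDiffAt 𝓘(ℝ, E3 × ℝ) 𝓘(ℝ, E3 × ℝ) ∞ (fun u : η.B ↦ s • u) u := by
  obtain ⟨X, W, h, hu⟩ := u.exists_frame
  exact contMDiffAt_B h (f := fun u : η.B ↦ s • u) hu (contMDiffAt_proj u)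
    (contMDiffAt_const.mul (contMDiffAt_fiberCoord h hu))

theorem taut_smul (s : ℝˣ) (i : Fin 3) :
    OneForm.pullback (fun u : η.B ↦ s • u) (η.taut i) =
      OneForm.fmul (fun _ ↦ ![((s⁻¹ : ℝˣ) : ℝ), (s : ℝ), 1] i) (η.taut i) := by
  funext u
  ext v
  have h : mfderiv 𝓘(ℝ, E3 × ℝ) (𝓡 3) (fun u : η.B ↦ (s • u).proj) u v =
      mfderiv 𝓘(ℝ, E3 × ℝ) (𝓡 3) (B.proj : η.B → M) (s • u)
        (mfderiv 𝓘(ℝ, E3 × ℝ) 𝓘(ℝ, E3 × ℝ) (fun u : η.B ↦ s • u) u v) :=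
    DFunLike.congr_fun (mfderiv_comp u ((contMDiffAt_proj (s • u)).mdifferentiableAt (by simp))
      ((contMDiffAt_smul_const s u).mdifferentiableAt (by simp))) v
  change (s • u).coframe (mfderiv 𝓘(ℝ, E3 × ℝ) (𝓡 3) (B.proj : η.B → M) (s • u)
        (mfderiv 𝓘(ℝ, E3 × ℝ) 𝓘(ℝ, E3 × ℝ) (fun u : η.B ↦ s • u) u v)) i = _
  rw [← h, B.coframe_smul]
  rfl

/-- The action multiplies each $\omega^i$ by a constant, so the pulled-back form satisfies the same
normalized equations, and uniqueness applies. -/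
theorem conn_invariant (s : ℝˣ) : OneForm.pullback (fun u : η.B ↦ s • u) η.conn = η.conn := by
  funext u
  refine normalizedAt_unique ?_ (conn_normalizedAt u)
  have hS := contMDiffAt_smul_const s u
  have hs := s.ne_zero
  obtain ⟨⟨c, h0⟩, c', h1⟩ := conn_normalizedAt (s • u)
  have d0 := fun v w ↦ OneForm.d_pullback hS (taut_smoothAt 0 (s • u)) v w
  have d1 := fun v w ↦ OneForm.d_pullback hS (taut_smoothAt 1 (s • u)) v w
  rw [taut_smul] at d0 d1
  simp only [OneForm.d_const_fmul _ (taut_smoothAt _ u)] at d0 d1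
  have e : ∀ i v, η.taut i (s • u)
      (mfderiv 𝓘(ℝ, E3 × ℝ) 𝓘(ℝ, E3 × ℝ) (fun u : η.B ↦ s • u) u v) =
      ![((s⁻¹ : ℝˣ) : ℝ), (s : ℝ), 1] i * η.taut i u v := fun i v ↦
    DFunLike.congr_fun (congrFun (taut_smul s i) u) v
  simp only [h0, h1, OneForm.wedge, e] at d0 d1
  simp only [Matrix.cons_val_zero, Matrix.cons_val_one, Units.val_inv_eq_inv_val,
    Matrix.cons_val] at d0 d1
  -- On $\omega^2\wedge\omega^3$ the action has weight $s$ and on $\omega^1$ weight $s^{-1}$, whence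
  -- $s^2$; the other equation gives the inverse.
  refine ⟨⟨c * s ^ 2, fun v w ↦ ?_⟩, c' * (s ^ 2 : ℝ)⁻¹, fun v w ↦ ?_⟩
  · have := d0 v w
    rw [inv_mul_eq_iff_eq_mul₀ hs] at this
    rw [this]
    simp only [OneForm.wedge, OneForm.pullback_apply]
    field_simp
  · have := d1 v w
    rw [← eq_inv_mul_iff_mul_eq₀ hs] at this
    rw [this]
    simp only [OneForm.wedge, OneForm.pullback_apply]
    field_simp

theorem contMDiffAt_orbit (u : η.B) (t : ℝ) :
    ContMDiffAt 𝓘(ℝ, ℝ) 𝓘(ℝ, E3 × ℝ) ∞ (orbit u) t := by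
  obtain ⟨X, W, h, hu⟩ := u.exists_frame
  refine contMDiffAt_B h (f := orbit u) hu contMDiffAt_const ?_
  have : ContDiff ℝ ∞ fun t ↦ (Real.exp t)⁻¹ * fiberCoord X u :=
    (Real.contDiff_exp.inv Real.exp_ne_zero).mul contDiff_const
  exact this.contMDiff.contMDiffAt

/-- Along the orbit $\tau$ is multiplied by $e^{-t}$, so $-\log|\tau|$ grows at unit rate, while the
projection, and with it $\pi^*A$, does not contribute. -/
theorem conn_fundamental (u : η.B) :
    η.conn (orbit u 0) (mfderiv 𝓘(ℝ, ℝ) 𝓘(ℝ, E3 × ℝ) (orbit u) 0 (1 : ℝ)) = 1 := by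
  obtain ⟨X, W, A, K, hX, hW, h⟩ := exists_localStructure (orbit u 0)
  have hW' : u.proj ∈ W := hW
  have τ0 := fiberCoord_ne_zero (η := η) hX hW
  have τ1 := fiberCoord_ne_zero (η := η) hX hW'
  have ho := contMDiffAt_orbit u 0
  rw [h.eventually_eq.self_of_nhds, localConn, OneForm.add_apply]
  have hl : ContMDiffAt 𝓘(ℝ, E3 × ℝ) 𝓘(ℝ, ℝ) ∞
      (fun u : η.B ↦ -Real.log (fiberCoord X u)) (orbit u 0) :=
    ((Real.contDiffAt_log.2 τ0).contMDiffAt.comp (orbit u 0)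
      (contMDiffAt_fiberCoord hX hW)).neg
  have ed := dform_pullback hl ho (1 : ℝ)
  have e1 : (fun t ↦ -Real.log (fiberCoord X (orbit u t))) =
      fun t ↦ t + -Real.log (fiberCoord X u) := by
    funext t
    change -Real.log ((Real.exp t)⁻¹ * fiberCoord X u) = _
    rw [Real.log_mul (inv_ne_zero (Real.exp_ne_zero t)) τ1, Real.log_inv, Real.log_exp]
    ring
  have e2 : dform (fun t : ℝ ↦ -Real.log (fiberCoord X (orbit u t))) (0 : ℝ) (1 : ℝ) = 1 := by
    rw [e1]
    have : HasDerivAt (fun t : ℝ ↦ t + -Real.log (fiberCoord X u)) 1 0 :=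
      (hasDerivAt_id 0).add_const _
    have e3 := DFunLike.congr_fun this.hasFDerivAt.hasMFDerivAt.mfderiv (1 : ℝ)
    exact e3.trans (show ContinuousLinearMap.toSpanSingleton ℝ (1 : ℝ) (1 : ℝ) = 1 by simp)
  have e4 : mfderiv 𝓘(ℝ, E3 × ℝ) (𝓡 3) (B.proj : η.B → M) (orbit u 0)
      (mfderiv 𝓘(ℝ, ℝ) 𝓘(ℝ, E3 × ℝ) (orbit u) 0 (1 : ℝ)) = 0 := by
    have e5 := DFunLike.congr_fun (mfderiv_comp (0 : ℝ)
      ((contMDiffAt_proj (orbit u 0)).mdifferentiableAt (by simp))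
      (ho.mdifferentiableAt (by simp))) (1 : ℝ)
    refine e5.symm.trans ?_
    exact DFunLike.congr_fun (mfderiv_const (I := 𝓘(ℝ, ℝ)) (I' := 𝓡 3) (c := u.proj)
      (x := (0 : ℝ))) (1 : ℝ)
  have e6 : OneForm.pullback (B.proj : η.B → M) A (orbit u 0)
      (mfderiv 𝓘(ℝ, ℝ) 𝓘(ℝ, E3 × ℝ) (orbit u) 0 (1 : ℝ)) = 0 :=
    (congrArg (A (orbit u 0).proj) e4).trans (map_zero _)
  exact (congrArg₂ (· + ·) (ed.symm.trans e2) e6).trans (add_zero 1)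

theorem isNormalizedConnection_conn : η.IsNormalizedConnection η.conn where
  smooth := (OneForm.smoothOn_iff _ isOpen_univ).2 fun u _ ↦ conn_smoothAt u
  invariant := conn_invariant
  fundamental := conn_fundamental
  structure_eq := by
    choose a₁ h₁ using fun u : η.B ↦ (conn_normalizedAt u).1
    choose a₂ h₂ using fun u : η.B ↦ (conn_normalizedAt u).2
    exact ⟨a₁, a₂, fun u v w ↦ ⟨h₁ u v w, h₂ u v w,
      (localStructure_conn u).d_two.self_of_nhds v w⟩⟩

theorem IsNormalizedConnection.eq_conn {α : OneForm (E3 × ℝ) η.B}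
    (h : η.IsNormalizedConnection α) : α = η.conn := by
  obtain ⟨a₁, a₂, h⟩ := h.structure_eq
  funext u
  exact normalizedAt_unique ⟨⟨a₁ u, fun v w ↦ (h u v w).1⟩, a₂ u, fun v w ↦ (h u v w).2.1⟩
    (conn_normalizedAt u)

theorem isCurvature_curv : η.IsCurvature η.conn η.curv := by
  choose b₁ b₂ h using fun u : η.B ↦ (localStructure_conn u).d_conn.self_of_nhds
  exact ⟨b₁, b₂, h⟩

theorem IsCurvature.eq_curv {K : η.B → ℝ} (h : η.IsCurvature η.conn K) : K = η.curv := by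
  obtain ⟨b₁, b₂, h⟩ := h
  funext u
  exact coeff_eq_d (isInvertible_coframe4 u) (h u)

variable (η) in
/-- The metric `g` of `B`. -/
def metric : BilinField (E3 × ℝ) η.B := η.feffermanMetric η.conn η.curv

theorem metric_smoothAt (u : η.B) : η.metric.SmoothAt u := by
  refine smoothAt_symProd_add (taut_smoothAt 0 u) (taut_smoothAt 1 u) (taut_smoothAt 2 u) ?_
  exact OneForm.SmoothAt.add (OneForm.SmoothAt.fmul contMDiffAt_const (conn_smoothAt u))
    (OneForm.SmoothAt.fmul (contMDiffAt_const.mul (localStructure_conn u).smooth_K)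
      (taut_smoothAt 2 u))

theorem sigma_apply (α : OneForm (E3 × ℝ) η.B) (K : η.B → ℝ) (u : η.B)
    (v : TangentSpace 𝓘(ℝ, E3 × ℝ) u) :
    sigma η α K u v = -(2 / 3) * α u v + 1 / 6 * K u * η.taut 2 u v := rfl

theorem metric_apply (u : η.B) (v w : TangentSpace 𝓘(ℝ, E3 × ℝ) u) :
    η.metric u v w = 2⁻¹ * (η.taut 0 u v * η.taut 1 u w + η.taut 1 u v * η.taut 0 u w) +
      2⁻¹ * (η.taut 2 u v * sigma η η.conn η.curv u w +
        sigma η η.conn η.curv u v * η.taut 2 u w) := rfl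

/-- The forms $\omega^1,\omega^2,\omega^3,\sigma$ have no common kernel, because $\alpha$ enters
$\sigma$ with the non-zero coefficient $-\tfrac23$. -/
theorem metric_hasSignature (u : η.B) : HasSignature (V := E3 × ℝ) 2 2 (η.metric u) := by
  refine hasSignature_of_coframe (by simp)
    (a := ![η.taut 0 u, η.taut 1 u, η.taut 2 u, sigma η η.conn η.curv u]) ?_
    (fun v w ↦ metric_apply u v w)
  intro (v : TangentSpace 𝓘(ℝ, E3 × ℝ) u) hv
  have h0 : η.taut 0 u v = 0 := hv 0
  have h1 : η.taut 1 u v = 0 := hv 1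
  have h2 : η.taut 2 u v = 0 := hv 2
  have h3 : sigma η η.conn η.curv u v = 0 := hv 3
  rw [sigma_apply, h2, mul_zero, add_zero] at h3
  have h4 : η.conn u v = 0 := (mul_eq_zero.1 h3).resolve_left (by norm_num)
  have hi := isInvertible_coframe4 u
  refine (eq_sum_dualFrame hi v).trans (Finset.sum_eq_zero fun j _ ↦ ?_)
  have : coframe4 η η.conn j u v = 0 := by
    fin_cases j
    exacts [h0, h1, h2, h4]
  rw [this, zero_smul]

theorem metric_isMetric22On : η.metric.IsMetric22On univ :=
  ⟨BilinField.smoothOn_of_smoothAt fun u _ ↦ metric_smoothAt u, fun u _ ↦ metric_hasSignature u⟩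

end ContactForm

end PathGeometry
end
end PathGeom

/-! ### The isomorphisms $h$ and $J\circ h$. -/

namespace PathGeom

noncomputable section

set_option linter.unusedSectionVars false

namespace PathGeometry

variable {M : Type*} [TopologicalSpace M] [ChartedSpace E3 M] [IsManifold (𝓡 3) ∞ M]
  {P : PathGeometry M}

namespace ContactForm

variable {η : P.ContactForm}

/-- The component in `L₁` of the vector `u.vector`. -/
def B.e₁ (u : η.B) : TangentSpace (𝓡 3) u.proj := u.vector.v₁

/-- The component in `L₂` of the vector `u.vector`. -/
def B.e₂ (u : η.B) : TangentSpace (𝓡 3) u.proj := u.vector.v₂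

theorem B.coframe_e₁ (u : η.B) : u.coframe u.e₁ = ![1, 0, 0] :=
  u.exists_mem_L₁.choose_spec.2

theorem B.coframe_e₂ (u : η.B) : u.coframe u.e₂ = ![0, 1, 0] :=
  u.exists_mem_L₂.choose_spec.2

theorem B.e₁_mem (u : η.B) : u.e₁ ∈ P.L₁ u.proj := u.vector.mem₁

theorem B.e₂_mem (u : η.B) : u.e₂ ∈ P.L₂ u.proj := u.vector.mem₂

theorem B.e₁_ne_zero (u : η.B) : u.e₁ ≠ 0 := u.vector.ne₁

theorem B.e₂_ne_zero (u : η.B) : u.e₂ ≠ 0 := u.vector.ne₂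

/-- An adapted coframe is injective, so the vectors picked by choice in `B.vector` are identified by
their components. -/
theorem B.vector_eq (u : η.B) {v₁ v₂ : TangentSpace (𝓡 3) u.proj} (m₁ : v₁ ∈ P.L₁ u.proj)
    (m₂ : v₂ ∈ P.L₂ u.proj) (n₁ : v₁ ≠ 0) (n₂ : v₂ ≠ 0) (e₁ : u.coframe v₁ = ![1, 0, 0])
    (e₂ : u.coframe v₂ = ![0, 1, 0]) : u.vector = ⟨u.proj, v₁, v₂, m₁, m₂, n₁, n₂⟩ := by
  obtain rfl : v₁ = u.e₁ := u.adapted.bijective.1 (e₁.trans u.coframe_e₁.symm)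
  obtain rfl : v₂ = u.e₂ := u.adapted.bijective.1 (e₂.trans u.coframe_e₂.symm)
  rfl

theorem IsAdapted.apply_mem_L₁ {x : M} {u : TangentSpace (𝓡 3) x →L[ℝ] (Fin 3 → ℝ)}
    (h : η.IsAdapted x u) {v : TangentSpace (𝓡 3) x} (hv : v ∈ P.L₁ x) :
    u v = ![u v 0, 0, 0] := by
  have z : v ∈ (η.form x).toLinearMap.ker := by
    rw [η.isContact.ker_eq _ h.mem_domain]; exact Submodule.mem_sup_left hv
  ext i
  fin_cases i
  exacts [rfl, h.second_L₁ v hv, (h.third v).trans z]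

theorem IsAdapted.apply_mem_L₂ {x : M} {u : TangentSpace (𝓡 3) x →L[ℝ] (Fin 3 → ℝ)}
    (h : η.IsAdapted x u) {v : TangentSpace (𝓡 3) x} (hv : v ∈ P.L₂ x) :
    u v = ![0, u v 1, 0] := by
  have z : v ∈ (η.form x).toLinearMap.ker := by
    rw [η.isContact.ker_eq _ h.mem_domain]; exact Submodule.mem_sup_right hv
  ext i
  fin_cases i
  exacts [h.first_L₂ v hv, rfl, (h.third v).trans z]

theorem h_eq_ray (u : η.B) {v₁ v₂ : TangentSpace (𝓡 3) u.proj} (m₁ : v₁ ∈ P.L₁ u.proj)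
    (m₂ : v₂ ∈ P.L₂ u.proj) (n₁ : v₁ ≠ 0) (n₂ : v₂ ≠ 0)
    (hpos : 0 < u.coframe v₁ 0) (e : u.coframe v₂ 1 = u.coframe v₁ 0) :
    η.h u = DStar.ray ⟨u.proj, v₁, v₂, m₁, m₂, n₁, n₂⟩ := by
  set c := u.coframe v₁ 0 with hc
  have e₁ := u.adapted.apply_mem_L₁ m₁
  have e₂ := u.adapted.apply_mem_L₂ m₂
  have k := u.vector_eq (v₁ := c⁻¹ • v₁) (v₂ := c⁻¹ • v₂) (Submodule.smul_mem _ _ m₁)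
    (Submodule.smul_mem _ _ m₂) (smul_ne_zero (inv_ne_zero hpos.ne') n₁)
    (smul_ne_zero (inv_ne_zero hpos.ne') n₂) (by
      rw [map_smul, e₁, ← hc]; simp [hpos.ne']) (by
      rw [map_smul, e₂, e]; simp [hpos.ne'])
  rw [h, k]
  refine DStar.ray_eq_iff.2 ⟨Units.mk0 c hpos.ne', hpos, ?_⟩
  simp [DStar.scale, hpos.ne']

theorem h_eq_ray_iff (u : η.B) {v₁ v₂ : TangentSpace (𝓡 3) u.proj} (m₁ : v₁ ∈ P.L₁ u.proj)
    (m₂ : v₂ ∈ P.L₂ u.proj) (n₁ : v₁ ≠ 0) (n₂ : v₂ ≠ 0) :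
    η.h u = DStar.ray ⟨u.proj, v₁, v₂, m₁, m₂, n₁, n₂⟩ ↔
      0 < u.coframe v₁ 0 ∧ u.coframe v₂ 1 = u.coframe v₁ 0 := by
  refine ⟨fun hu ↦ ?_, fun hu ↦ h_eq_ray u m₁ m₂ n₁ n₂ hu.1 hu.2⟩
  obtain ⟨c, hc, e⟩ := DStar.ray_eq_iff.1 hu
  have e1 : v₁ = (c : ℝ) • u.e₁ := (DStar.mk.inj e).2.1
  have e2 : v₂ = (c : ℝ) • u.e₂ := (DStar.mk.inj e).2.2
  have f1 : u.coframe v₁ 0 = c := by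
    rw [e1, map_smul, u.coframe_e₁]; simp
  have f2 : u.coframe v₂ 1 = c := by
    rw [e2, map_smul, u.coframe_e₂]; simp
  exact ⟨f1 ▸ hc, f2.trans f1.symm⟩

/-- The vectors dual to $s^{-1}u^1$ and $su^2$ are $s$ and $s^{-1}$ times the original ones, which
is the action on $SD^*$. -/
theorem h_equivariant (s : ℝˣ) (u : η.B) : η.h (s • u) = SDStar.act s (η.h u) := by
  have k := (s • u).vector_eq (v₁ := (s : ℝ) • u.e₁) (v₂ := ((s⁻¹ : ℝˣ) : ℝ) • u.e₂)
    (Submodule.smul_mem _ _ u.e₁_mem) (Submodule.smul_mem _ _ u.e₂_mem)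
    (smul_ne_zero s.ne_zero u.e₁_ne_zero) (smul_ne_zero s⁻¹.ne_zero u.e₂_ne_zero)
    (by
      refine (map_smul (scaleCoframe s u.coframe) (s : ℝ) u.e₁).trans ?_
      ext i
      simp only [Pi.smul_apply, scaleCoframe_apply, u.coframe_e₁]
      fin_cases i <;> simp)
    (by
      refine (map_smul (scaleCoframe s u.coframe) ((s⁻¹ : ℝˣ) : ℝ) u.e₂).trans ?_
      ext i
      simp only [Pi.smul_apply, scaleCoframe_apply, u.coframe_e₂]
      fin_cases i <;> simp)
  rw [h, k]
  rfl

theorem ray_mem_SDPos_iff (X : P.DStar) :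
    X.ray ∈ η.SDPos ↔ X.base ∈ η.domain ∧ 0 < η.form.d X.base X.v₁ X.v₂ := by
  -- $d\eta(v_1-v_2,\,v_1+v_2)=2\,d\eta(v_1,v_2)$, so the sign can be tested on $d\eta(v_1,v_2)$.
  have key : ∀ X : P.DStar, η.form.d X.base (X.v₁ - X.v₂) (X.v₁ + X.v₂) =
      2 * η.form.d X.base X.v₁ X.v₂ := by
    intro X
    rw [sub_eq_add_neg, ← neg_one_smul ℝ X.v₂]
    simp only [OneForm.d_add_left, OneForm.d_smul_left, OneForm.d_add_right, OneForm.d_self,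
      η.form.d_swap _ X.v₂ X.v₁]
    ring
  constructor
  · rintro ⟨Y, e, hb, hY⟩
    rw [key] at hY
    obtain ⟨c, hc, rfl⟩ := DStar.ray_eq_iff.1 e
    refine ⟨hb, ?_⟩
    change 0 < η.form.d Y.base ((c : ℝ) • Y.v₁) ((c : ℝ) • Y.v₂)
    rw [OneForm.d_smul_left, OneForm.d_smul_right]
    have : 0 < η.form.d Y.base Y.v₁ Y.v₂ := by linarith
    positivity
  · rintro ⟨hb, hX⟩
    exact ⟨X, rfl, hb, by rw [key]; linarith⟩

theorem ray_mem_SDNeg_iff (X : P.DStar) :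
    X.ray ∈ η.SDNeg ↔ X.base ∈ η.domain ∧ η.form.d X.base X.v₁ X.v₂ < 0 := by
  have key : ∀ X : P.DStar, η.form.d X.base (X.v₁ - X.v₂) (X.v₁ + X.v₂) =
      2 * η.form.d X.base X.v₁ X.v₂ := by
    intro X
    rw [sub_eq_add_neg, ← neg_one_smul ℝ X.v₂]
    simp only [OneForm.d_add_left, OneForm.d_smul_left, OneForm.d_add_right, OneForm.d_self,
      η.form.d_swap _ X.v₂ X.v₁]
    ring
  constructor
  · rintro ⟨Y, e, hb, hY⟩
    rw [key] at hY
    obtain ⟨c, hc, rfl⟩ := DStar.ray_eq_iff.1 e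
    refine ⟨hb, ?_⟩
    change η.form.d Y.base ((c : ℝ) • Y.v₁) ((c : ℝ) • Y.v₂) < 0
    rw [OneForm.d_smul_left, OneForm.d_smul_right]
    have : η.form.d Y.base Y.v₁ Y.v₂ < 0 := by linarith
    exact mul_neg_of_pos_of_neg hc (mul_neg_of_pos_of_neg hc this)
  · rintro ⟨hb, hX⟩
    exact ⟨X, rfl, hb, by rw [key]; linarith⟩

theorem SDPos_union_SDNeg : η.SDPos ∪ η.SDNeg = η.SDOver := by
  ext p
  obtain ⟨X, rfl⟩ : ∃ X : P.DStar, X.ray = p := Quotient.exists_rep p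
  rw [mem_union, ray_mem_SDPos_iff, ray_mem_SDNeg_iff, ← and_or_left]
  refine ⟨fun h ↦ h.1, fun h ↦ ⟨h, ?_⟩⟩
  exact (d_ne_zero h X.mem₁ X.mem₂ X.ne₁ X.ne₂).lt_or_gt.symm

theorem disjoint_SDPos_SDNeg : Disjoint η.SDPos η.SDNeg := by
  rw [Set.disjoint_left]
  intro p
  obtain ⟨X, rfl⟩ : ∃ X : P.DStar, X.ray = p := Quotient.exists_rep p
  rw [ray_mem_SDPos_iff, ray_mem_SDNeg_iff]
  exact fun h h' ↦ lt_asymm h.2 h'.2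

theorem J_mem_SDNeg_iff (p : P.SDStar) : p.J ∈ η.SDNeg ↔ p ∈ η.SDPos := by
  obtain ⟨X, rfl⟩ : ∃ X : P.DStar, X.ray = p := Quotient.exists_rep p
  have e : X.ray.J = (X.scale 1 (-1)).ray := rfl
  rw [e, ray_mem_SDPos_iff, ray_mem_SDNeg_iff]
  change _ ∧ η.form.d X.base ((((1 : ℝˣ) : ℝ)) • X.v₁) (((-1 : ℝˣ) : ℝ) • X.v₂) < 0 ↔ _
  rw [OneForm.d_smul_left, OneForm.d_smul_right]
  simp [DStar.scale]

theorem h_mem_SDPos (u : η.B) : η.h u ∈ η.SDPos := by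
  refine (ray_mem_SDPos_iff u.vector).2 ⟨u.adapted.mem_domain, ?_⟩
  refine lt_of_lt_of_eq one_pos ((u.adapted.wedge u.e₁ u.e₂).trans ?_).symm
  simp [u.coframe_e₁, u.coframe_e₂]

theorem range_h : range η.h = η.SDPos := by
  refine Subset.antisymm (range_subset_iff.2 h_mem_SDPos) fun p hp ↦ ?_
  obtain ⟨⟨x, v₁, v₂, m₁, m₂, n₁, n₂⟩, rfl⟩ : ∃ X : P.DStar, X.ray = p := Quotient.exists_rep p
  obtain ⟨hx, hd⟩ := (ray_mem_SDPos_iff _).1 hp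
  dsimp only at hx hd
  have hs := Real.sqrt_pos.2 hd
  -- Since $u^1(v_1)\,u^2(v_2)=d\eta(v_1,v_2)$, choosing $u^1(v_1)$ as the square root of the right
  -- side makes the two factors equal.
  obtain ⟨u, hu, e⟩ := exists_isAdapted hx m₁ n₁ hs.ne'
  refine ⟨⟨⟨x, u⟩, hu⟩, h_eq_ray _ m₁ m₂ n₁ n₂ ?_ ?_⟩
  · exact hs.trans_eq e.symm
  · change u v₂ 1 = u v₁ 0
    have w := hu.wedge v₁ v₂
    rw [hu.first_L₂ _ m₂, zero_mul, sub_zero, e] at w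
    rw [e]
    have := Real.mul_self_sqrt hd.le
    exact mul_left_cancel₀ hs.ne' (w.symm.trans this.symm)

theorem h_injective : Function.Injective η.h := by
  rintro ⟨⟨x, u⟩, hu⟩ ⟨⟨y, u'⟩, hu'⟩ e
  obtain rfl : x = y := congrArg SDStar.proj e
  let U : η.B := ⟨⟨x, u⟩, hu⟩
  let U' : η.B := ⟨⟨x, u'⟩, hu'⟩
  have e' : η.h U' = DStar.ray ⟨U'.proj, U.e₁, U.e₂, U.e₁_mem, U.e₂_mem,
    U.e₁_ne_zero, U.e₂_ne_zero⟩ := e.symm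
  obtain ⟨k1, k2⟩ := (h_eq_ray_iff U' _ _ _ _).1 e'
  have w := hu.wedge U.e₁ U.e₂
  have w' := hu'.wedge U.e₁ U.e₂
  have c1 : u U.e₁ = ![1, 0, 0] := U.coframe_e₁
  have c2 : u U.e₂ = ![0, 1, 0] := U.coframe_e₂
  rw [c1, c2] at w
  rw [hu'.first_L₂ _ U.e₂_mem] at w'
  change 0 < u' U.e₁ 0 at k1
  change u' U.e₂ 1 = u' U.e₁ 0 at k2
  rw [k2, w] at w'
  simp at w'
  -- The common value of $u'^1(e_1)$ and $u'^2(e_2)$ is positive with square $d\eta(e_1,e_2)=1$.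
  have one : u' U.e₁ 0 = 1 := by nlinarith
  have := hu.eq_of_first hu' U.e₁_mem U.e₁_ne_zero (by rw [one, c1]; rfl)
  subst this
  rfl

/-- From $u^1(X_1)\,u^2(X_2)=d\eta(X_1,X_2)$ and the requirement $u^2(X_2)=t\,u^1(X_1)>0$. Read for
`t` it describes $h$ in coordinates, read for the fibre coordinate it describes the inverse. -/
theorem h_eq_frameRay_iff {X₁ X₂ : VField M} {W : Set M} (h₁ : IsLocalFrame P.L₁ X₁ W)
    (h₂ : IsLocalFrame P.L₂ X₂ W) {u : η.B} (hu : u.proj ∈ W) {t : ℝ} (ht : t ≠ 0) :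
    η.h u = frameRay h₁ h₂ u.proj hu t ht ↔ 0 < t * fiberCoord X₁ u ∧
      t * fiberCoord X₁ u ^ 2 = η.form.d u.proj (X₁ u.proj) (X₂ u.proj) := by
  refine (h_eq_ray_iff u _ _ _ _).trans ?_
  have τ0 := fiberCoord_ne_zero h₁ hu
  have w := u.adapted.wedge (X₁ u.proj) (X₂ u.proj)
  rw [u.adapted.first_L₂ _ (h₂.mem hu), zero_mul, sub_zero] at w
  rw [w, map_smul]
  change 0 < t * fiberCoord X₁ u ∧ _ = t * fiberCoord X₁ u ↔
    _ ∧ _ = fiberCoord X₁ u * u.coframe (X₂ u.proj) 1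
  refine and_congr_right fun _ ↦ ⟨fun h ↦ by rw [h]; ring, fun h ↦ ?_⟩
  exact mul_left_cancel₀ τ0 (h.symm.trans (by ring))

theorem contMDiffAt_d_frames {X₁ X₂ : VField M} {W : Set M} (h₁ : IsLocalFrame P.L₁ X₁ W)
    (h₂ : IsLocalFrame P.L₂ X₂ W) {x : M} (hx : x ∈ η.domain) (hW : x ∈ W) :
    ContMDiffAt (𝓡 3) 𝓘(ℝ, ℝ) ∞ (fun y ↦ η.form.d y (X₁ y) (X₂ y)) x :=
  OneForm.smoothAt_d_vField (eventually_form_smoothAt hx) (h₁.smoothVFieldAt hW)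
    (h₂.smoothVFieldAt hW)

theorem contMDiff_h : ContMDiff 𝓘(ℝ, E3 × ℝ) 𝓘(ℝ, E3 × ℝ) ∞ η.h := by
  intro u
  obtain ⟨X₁, X₂', W₁, W₂, h₁, h₂, hu₁, hu₂⟩ := u.exists_frames
  -- The ray $h(u)$ is a positive multiple of some $tX_1+X_2$ only when $u^2(X_2)>0$; replacing
  -- $X_2$ by $-X_2$ if necessary arranges this sign.
  obtain ⟨X₂, h₂, hpos⟩ : ∃ (X₂ : VField M) (h₂ : IsLocalFrame P.L₂ X₂ W₂),
      0 < fiberCoord X₁ u * η.form.d u.proj (X₁ u.proj) (X₂ u.proj) := by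
    have hne := mul_ne_zero (fiberCoord_ne_zero h₁ hu₁)
      (d_ne_zero u.adapted.mem_domain (h₁.mem hu₁) (h₂.mem hu₂) (h₁.ne_zero _ hu₁)
      (h₂.ne_zero _ hu₂))
    rcases hne.lt_or_gt with h | h
    · refine ⟨_, h₂.neg, ?_⟩
      rw [← neg_one_smul ℝ (X₂' u.proj), OneForm.d_smul_right]
      linarith
    · exact ⟨_, h₂, h⟩
  have h₁ := h₁.restrict (h₁.isOpen.inter h₂.isOpen) inter_subset_left
  have h₂ := h₂.restrict (h₁.isOpen) inter_subset_right
  have hu : u.proj ∈ W₁ ∩ W₂ := ⟨hu₁, hu₂⟩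
  have τ := contMDiffAt_fiberCoord h₁ hu
  have m := (contMDiffAt_d_frames h₁ h₂ u.adapted.mem_domain hu).comp u (contMDiffAt_proj u)
  have hW : ∀ᶠ v : η.B in 𝓝 u, v.proj ∈ W₁ ∩ W₂ :=
    continuous_proj.continuousAt.eventually (h₁.isOpen.eventually_mem hu)
  have τ0 := fiberCoord_ne_zero h₁ hu
  refine SDStar.contMDiffAt_of_frameRay h₁ h₂ (m.div₀ (τ.pow 2) (pow_ne_zero 2 τ0))
    (contMDiffAt_proj u) ?_
  filter_upwards [hW, (τ.mul m).continuousAt.eventually (lt_mem_nhds hpos)] with v hv hp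
  have τ1 := fiberCoord_ne_zero h₁ hv
  have m1 := d_ne_zero v.adapted.mem_domain (h₁.mem hv) (h₂.mem hv) (h₁.ne_zero _ hv)
      (h₂.ne_zero _ hv)
  change 0 < fiberCoord X₁ v * η.form.d v.proj (X₁ v.proj) (X₂ v.proj) at hp
  refine ⟨hv, div_ne_zero m1 (pow_ne_zero 2 τ1), (h_eq_frameRay_iff h₁ h₂ hv _).2 ⟨?_, ?_⟩⟩
  · change 0 < η.form.d v.proj (X₁ v.proj) (X₂ v.proj) / fiberCoord X₁ v ^ 2 * fiberCoord X₁ v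
    have : η.form.d v.proj (X₁ v.proj) (X₂ v.proj) / fiberCoord X₁ v ^ 2 * fiberCoord X₁ v =
        fiberCoord X₁ v * η.form.d v.proj (X₁ v.proj) (X₂ v.proj) / fiberCoord X₁ v ^ 2 := by
      ring
    rw [this]
    exact div_pos hp (by positivity)
  · exact div_mul_cancel₀ _ (pow_ne_zero 2 τ1)

/-- The ray `[t X₁ + X₂]` lies in `SD⁺` iff `t dη(X₁, X₂) > 0`. -/
theorem frameRay_mem_SDPos_iff {X₁ X₂ : VField M} {W : Set M} (h₁ : IsLocalFrame P.L₁ X₁ W)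
    (h₂ : IsLocalFrame P.L₂ X₂ W) {x : M} (hx : x ∈ W) {t : ℝ} (ht : t ≠ 0) :
    frameRay h₁ h₂ x hx t ht ∈ η.SDPos ↔ x ∈ η.domain ∧ 0 < t * η.form.d x (X₁ x) (X₂ x) := by
  refine (ray_mem_SDPos_iff _).trans ?_
  rw [OneForm.d_smul_left]

/-- Local data for inverting $h$. The condition on $r(q)r(p_0)$ fixes the sign of the coordinate
near $p_0$. -/
theorem SDStar_eventually {p₀ : P.SDStar} (hp₀ : p₀ ∈ η.SDPos) :
    ∃ (W : Set M) (X₁ X₂ : VField M) (h₁ : IsLocalFrame P.L₁ X₁ W)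
    (h₂ : IsLocalFrame P.L₂ X₂ W) (r : P.SDStar → ℝ), p₀.proj ∈ W ∧
    ContMDiffAt 𝓘(ℝ, E3 × ℝ) 𝓘(ℝ, ℝ) ∞ r p₀ ∧
    ContMDiffAt 𝓘(ℝ, E3 × ℝ) 𝓘(ℝ, ℝ) ∞
      (fun q : P.SDStar ↦ η.form.d q.proj (X₁ q.proj) (X₂ q.proj)) p₀ ∧
    (0 < r p₀ * η.form.d p₀.proj (X₁ p₀.proj) (X₂ p₀.proj)) ∧
    ∀ᶠ q in 𝓝 p₀, q ∈ η.SDPos ∧ 0 < r q * r p₀ ∧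
      ∃ hx ht, q = frameRay h₁ h₂ (SDStar.proj q) hx (r q) ht := by
  obtain ⟨W, X₁, X₂, h₁, h₂, r, hp, hr, hev⟩ := SDStar.exists_frameRay p₀
  obtain ⟨hx, ht, e⟩ := hev.self_of_nhds
  have hp₁ := hp₀
  rw [e, frameRay_mem_SDPos_iff] at hp₁
  have m := (contMDiffAt_d_frames h₁ h₂ hp₁.1 hx).comp p₀ (SDStar.contMDiffAt_proj p₀)
  refine ⟨W, X₁, X₂, h₁, h₂, r, hp, hr, m, hp₁.2, ?_⟩
  have hdom : ∀ᶠ q : P.SDStar in 𝓝 p₀, q.proj ∈ η.domain :=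
    SDStar.continuous_proj.continuousAt.eventually (η.isContact.isOpen.eventually_mem hp₁.1)
  have hrr : ∀ᶠ q in 𝓝 p₀, 0 < r q * r p₀ :=
    (hr.continuousAt.mul continuousAt_const).eventually (lt_mem_nhds (mul_self_pos.2 ht))
  filter_upwards [hev, (hr.mul m).continuousAt.eventually (lt_mem_nhds hp₁.2), hdom, hrr]
    with q hq hpos hd hq2
  obtain ⟨hx', ht', e'⟩ := hq
  refine ⟨?_, hq2, hx', ht', e'⟩
  rw [e', frameRay_mem_SDPos_iff]
  exact ⟨hd, hpos⟩

theorem isOpen_SDPos : IsOpen η.SDPos := by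
  rw [isOpen_iff_eventually (X := P.SDStar)]
  intro p hp
  obtain ⟨W, X₁, X₂, h₁, h₂, r, -, -, -, -, hev⟩ := SDStar_eventually hp
  exact hev.mono fun q hq ↦ hq.1

/-- A right inverse of `h` is smooth. -/
theorem contMDiffOn_inv_h {k : P.SDStar → η.B} (hk : ∀ p ∈ η.SDPos, η.h (k p) = p) :
    ContMDiffOn 𝓘(ℝ, E3 × ℝ) 𝓘(ℝ, E3 × ℝ) ∞ k η.SDPos := by
  intro p hp
  refine ContMDiffAt.contMDiffWithinAt ?_
  obtain ⟨W, X₁, X₂, h₁, h₂, r, hpW, hr, hm, hpos, hev⟩ := SDStar_eventually hp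
  have hproj : ∀ q ∈ η.SDPos, (k q).proj = q.proj := fun q hq ↦ congrArg SDStar.proj (hk q hq)
  obtain ⟨-, hr0, -⟩ := hev.self_of_nhds
  have r0 : r p ≠ 0 := by rintro h; simp [h] at hr0
  refine contMDiffAt_B h₁ (by rw [hproj p hp]; exact hpW) ?_ ?_
  · refine (SDStar.contMDiffAt_proj p).congr_of_eventuallyEq (hev.mono fun q hq ↦ hproj q hq.1)
  · have hsq : ContMDiffAt 𝓘(ℝ, E3 × ℝ) 𝓘(ℝ, ℝ) ∞ (fun q : P.SDStar ↦
        SignType.sign (r p) * Real.sqrt (η.form.d q.proj (X₁ q.proj) (X₂ q.proj) / r q)) p := by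
      refine contMDiffAt_const.mul ((Real.contDiffAt_sqrt ?_).contMDiffAt.comp p
        (hm.div₀ hr r0))
      exact div_ne_zero (right_ne_zero_of_mul hpos.ne') r0
    refine hsq.congr_of_eventuallyEq ?_
    filter_upwards [hev] with q hq
    obtain ⟨hqS, hq2, hx, ht, e⟩ := hq
    have hx' : (k q).proj ∈ W := by rw [hproj q hqS]; exact hx
    have e' : η.h (k q) = frameRay h₁ h₂ (k q).proj hx' (r q) ht := by
      have : ∀ y (hy : y = q.proj) (hy' : y ∈ W), q = frameRay h₁ h₂ y hy' (r q) ht := by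
        rintro _ rfl hy'
        exact e
      exact (hk q hqS).trans (this _ (hproj q hqS) hx')
    obtain ⟨p1, p2⟩ := (h_eq_frameRay_iff h₁ h₂ hx' ht).1 e'
    rw [hproj q hqS] at p2
    rw [← p2, mul_div_cancel_left₀ _ ht, Real.sqrt_sq_eq_abs]
    -- $r(q)\tau>0$ and $r(q)$ has the sign of $r(p)$, so $\tau$ has that sign too.
    have p3 : 0 < r p * fiberCoord X₁ (k q) := by
      by_contra hcon
      push Not at hcon
      nlinarith [mul_pos p1 hq2, mul_self_pos.2 ht, mul_nonneg_of_nonpos_of_nonpos hcon hcon]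
    rcases r0.lt_or_gt with h | h
    · have := neg_of_mul_pos_right p3 h.le
      rw [sign_neg h, abs_of_neg this]
      simp
    · have := pos_of_mul_pos_right p3 h.le
      rw [sign_pos h, abs_of_pos this]
      simp

theorem isLocalDiffeomorph_h :
    IsLocalDiffeomorph 𝓘(ℝ, E3 × ℝ) 𝓘(ℝ, E3 × ℝ) ∞ (η.h : η.B → P.SDStar) := by
  intro u
  have : Nonempty η.B := ⟨u⟩
  have hk : ∀ p : P.SDStar, p ∈ η.SDPos → η.h (Function.invFun η.h p) = p := fun p hp ↦
    Function.invFun_eq ((range_h (η := η)).symm.subset hp)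
  exact ⟨{  toFun := η.h
            invFun := Function.invFun η.h
            source := univ
            target := η.SDPos
            map_source' := fun u _ ↦ h_mem_SDPos u
            map_target' := fun _ _ ↦ mem_univ _
            left_inv' := fun u _ ↦ Function.leftInverse_invFun h_injective u
            right_inv' := hk
            open_source := isOpen_univ
            open_target := isOpen_SDPos
            contMDiffOn_toFun := contMDiff_h.contMDiffOn
            contMDiffOn_invFun := contMDiffOn_inv_h hk }, mem_univ u, fun _ _ ↦ rfl⟩

theorem isBundleIso_h : η.IsBundleIso η.h η.SDPos :=
  ⟨isLocalDiffeomorph_h, h_injective, range_h, fun _ ↦ rfl, h_equivariant⟩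

variable (P) in
/-- The involution `J` as a diffeomorphism. -/
def _root_.PathGeom.PathGeometry.SDStar.JDiffeo :
    P.SDStar ≃ₘ^∞⟮𝓘(ℝ, E3 × ℝ), 𝓘(ℝ, E3 × ℝ)⟯ P.SDStar where
  toFun := SDStar.J
  invFun := SDStar.J
  left_inv := SDStar.J_J
  right_inv := SDStar.J_J
  contMDiff_toFun := SDStar.contMDiff_J
  contMDiff_invFun := SDStar.contMDiff_J

theorem isBundleIso_J_h : η.IsBundleIso (fun u : η.B ↦ (η.h u).J) η.SDNeg where
  isLocalDiffeomorph u := IsLocalDiffeomorphAt.comp (hf := isLocalDiffeomorph_h u)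
    (hg := (SDStar.JDiffeo P).isLocalDiffeomorph (η.h u))
  injective u v e := h_injective (by
    have := congrArg SDStar.J e
    dsimp only at this
    rwa [SDStar.J_J, SDStar.J_J] at this)
  range_eq := by
    ext p
    constructor
    · rintro ⟨u, rfl⟩
      exact (J_mem_SDNeg_iff _).2 (h_mem_SDPos u)
    · intro hp
      rw [← p.J_J, J_mem_SDNeg_iff, ← range_h] at hp
      obtain ⟨u, hu⟩ := hp
      exact ⟨u, by dsimp only; rw [hu, SDStar.J_J]⟩
  proj_eq u := SDStar.proj_J _
  equivariant s u := by
    rw [h_equivariant, SDStar.J_act]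

end ContactForm

end PathGeometry
end
end PathGeom

/-! ### $B$ as a reduction of the coframe bundle. -/

namespace PathGeom

noncomputable section

set_option linter.unusedSectionVars false

namespace PathGeometry

variable {M : Type*} [TopologicalSpace M] [ChartedSpace E3 M] [IsManifold (𝓡 3) ∞ M]
  {P : PathGeometry M}

namespace ContactForm

variable {η : P.ContactForm}

/-- Evaluation of the first component of a homomorphism `TM → ℝ³` on a vector field. -/
def evalFirst (X : VField M) (w : HomBundle M) : ℝ := (w.2 (X w.proj) : Fin 3 → ℝ) 0

theorem contMDiffAt_evalFirst {X : VField M} {W : Set M} (h : IsLocalFrame P.L₁ X W)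
    {w : HomBundle M} (hw : w.proj ∈ W) :
    ContMDiffAt ((𝓡 3).prod 𝓘(ℝ, E3 →L[ℝ] (Fin 3 → ℝ))) 𝓘(ℝ, ℝ) ∞
      (evalFirst X : HomBundle M → ℝ) w := by
  have hX := (h.smooth.contMDiffAt (h.isOpen.mem_nhds hw)).comp w
    (Bundle.contMDiffAt_proj (IB := 𝓡 3) (F := E3 →L[ℝ] (Fin 3 → ℝ)) (n := ∞)
      (fun x : M ↦ TangentSpace (𝓡 3) x →L[ℝ] Bundle.Trivial M (Fin 3 → ℝ) x))
  have hid : ContMDiffAt ((𝓡 3).prod 𝓘(ℝ, E3 →L[ℝ] (Fin 3 → ℝ)))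
    ((𝓡 3).prod 𝓘(ℝ, E3 →L[ℝ] (Fin 3 → ℝ))) ∞ (fun w : HomBundle M ↦
      TotalSpace.mk' (E3 →L[ℝ] (Fin 3 → ℝ))
      (E := fun x : M ↦ TangentSpace (𝓡 3) x →L[ℝ] Bundle.Trivial M (Fin 3 → ℝ) x)
      w.proj w.2) w := contMDiffAt_id
  have k := (contMDiffAt_totalSpace.1 (ContMDiffAt.clm_bundle_apply hid hX)).2
  exact (ContinuousLinearMap.proj (R := ℝ) (φ := fun _ : Fin 3 ↦ ℝ) 0).contMDiff.contMDiffAt.comp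
    w k

/-- In a trivialization the coframe is $(\tau\theta_0,\tau^{-1}\theta_1,\theta_2)$ written in
coordinates, a smooth expression in the fibre coordinate and the base point. -/
theorem contMDiff_incl : ContMDiff 𝓘(ℝ, E3 × ℝ) ((𝓡 3).prod 𝓘(ℝ, E3 →L[ℝ] (Fin 3 → ℝ))) ∞
    (B.incl : η.B → HomBundle M) := by
  intro u
  obtain ⟨X₁, X₂, W₁, W₂, h₁, h₂, hu₁, hu₂⟩ := u.exists_frames
  rw [contMDiffAt_hom_bundle]
  refine ⟨contMDiffAt_proj u, ?_⟩
  set x₀ := u.proj with hx₀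
  have hτ := contMDiffAt_fiberCoord h₁ hu₁
  have hθ : ∀ i, ContMDiffAt 𝓘(ℝ, E3 × ℝ) 𝓘(ℝ, E3 →L[ℝ] ℝ) ∞ (fun v : η.B ↦
      (localCoframe η X₁ X₂ i).inChart x₀ (extChartAt (𝓡 3) x₀ v.proj)) u := by
    intro i
    have h0 := localCoframe_smoothAt h₁ h₂ u.adapted.mem_domain hu₁ hu₂ i
    exact (ContDiffAt.contMDiffAt h0).comp u
      (contMDiffAt_extChartAt.comp u (contMDiffAt_proj u))
  let c : Fin 3 → η.B → ℝ := ![fiberCoord X₁, fun v ↦ (fiberCoord X₁ v)⁻¹, fun _ ↦ 1]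
  have hc : ∀ i, ContMDiffAt 𝓘(ℝ, E3 × ℝ) 𝓘(ℝ, ℝ) ∞ (c i) u := by
    intro i
    fin_cases i
    exacts [hτ, hτ.inv₀ (fiberCoord_ne_zero h₁ hu₁), contMDiffAt_const]
  have hsum : ContMDiffAt 𝓘(ℝ, E3 × ℝ) 𝓘(ℝ, E3 →L[ℝ] (Fin 3 → ℝ)) ∞ (fun v : η.B ↦
      ∑ i, ((c i v • (localCoframe η X₁ X₂ i).inChart x₀
        (extChartAt (𝓡 3) x₀ v.proj)).smulRight (Pi.single i (1 : ℝ) : Fin 3 → ℝ))) u := by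
    refine ContMDiffAt.sum fun i _ ↦ ?_
    have hL : ContDiff ℝ ∞ (fun L : E3 →L[ℝ] ℝ ↦
      L.smulRight (Pi.single i (1 : ℝ) : Fin 3 → ℝ)) := contDiff_id.smulRight contDiff_const
    exact hL.contMDiff.contMDiffAt.comp u ((hc i).smul (hθ i))
  refine hsum.congr_of_eventuallyEq ?_
  have hW : ∀ᶠ v : η.B in 𝓝 u, v.proj ∈ W₁ ∧ v.proj ∈ W₂ ∧
      v.proj ∈ (extChartAt (𝓡 3) x₀).source :=
    continuous_proj.continuousAt.eventually ((h₁.isOpen.eventually_mem hu₁).and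
      ((h₂.isOpen.eventually_mem hu₂).and (extChartAt_source_mem_nhds x₀)))
  filter_upwards [hW] with v hv
  have hs := TangentBundle.symmL_trivializationAt (I := 𝓡 3) (x₀ := x₀) (x := v.proj)
    (by simpa using hv.2.2)
  rw [modelWithCornersSelf_coe, range_id, mfderivWithin_univ] at hs
  have e := v.adapted.eq_localCoframe (h₁.mem hv.1) (h₂.mem hv.2.1) (h₁.ne_zero _ hv.1)
    (h₂.ne_zero _ hv.2.1)
  rw [ContinuousLinearMap.inCoordinates]
  change ((trivializationAt (Fin 3 → ℝ) (Bundle.Trivial M (Fin 3 → ℝ)) x₀).continuousLinearMapAt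
    ℝ v.proj).comp (v.coframe.comp (Trivialization.symmL ℝ (trivializationAt E3
      (TangentSpace (𝓡 3)) x₀) v.proj)) = _
  rw [hs]
  have key : ∀ (A : E3 →L[ℝ] (Fin 3 → ℝ)) (D : E3 →L[ℝ] E3) (θ : Fin 3 → E3 →L[ℝ] ℝ)
      (c : Fin 3 → ℝ), (∀ i v, A v i = c i * θ i v) →
      A.comp D = ∑ i, (c i • (θ i).comp D).smulRight (Pi.single i (1 : ℝ) : Fin 3 → ℝ) := by
    intro A D θ c hA
    ext v j
    simp [hA, Finset.sum_apply, Pi.single_apply]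
  have k := key v.coframe (mfderiv 𝓘(ℝ, E3) (𝓡 3) (extChartAt (𝓡 3) x₀).symm
    (extChartAt (𝓡 3) x₀ v.proj)) (fun i ↦ localCoframe η X₁ X₂ i v.proj) (fun i ↦ c i v) (by
      intro i w
      fin_cases i
      exacts [(e w).1, (e w).2.1, (e w).2.2.trans (one_mul _).symm])
  have k2 : ∀ i, (localCoframe η X₁ X₂ i).inChart x₀ (extChartAt (𝓡 3) x₀ v.proj) =
      (localCoframe η X₁ X₂ i v.proj).comp (mfderiv 𝓘(ℝ, E3) (𝓡 3) (extChartAt (𝓡 3) x₀).symm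
    (extChartAt (𝓡 3) x₀ v.proj)) := fun i ↦ OneForm.inChart_extChartAt _ hv.2.2
  simp only [k2]
  refine Eq.trans ?_ k
  ext w i
  simp
  rfl

/-- An adapted coframe is determined by $u^1$ on a non-zero vector of $L_1$. As $s$ acts there by
$s^{-1}$, the only candidate is the old value divided by the new one. -/
theorem existsUnique_scaleCoframe {x : M} {a a' : TangentSpace (𝓡 3) x →L[ℝ] (Fin 3 → ℝ)}
    (ha : η.IsAdapted x a) (ha' : η.IsAdapted x a') : ∃! s : ℝˣ, scaleCoframe s a = a' := by
  obtain ⟨v, m, n⟩ := exists_ne_zero_mem_L₁ P x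
  have ha0 : a v 0 ≠ 0 := ha.first_ne_zero m n
  have ha0' : a' v 0 ≠ 0 := ha'.first_ne_zero m n
  refine ⟨Units.mk0 (a v 0 / a' v 0) (div_ne_zero ha0 ha0'), ?_, ?_⟩
  · refine (ha.scale _).eq_of_first ha' m n ?_
    rw [scaleCoframe_apply]
    simp
    field_simp
  · intro s hs
    have e := scaleCoframe_apply s a v 0
    rw [hs] at e
    have hs0 := s.ne_zero
    ext
    rw [Units.val_mk0, e]
    simp
    field_simp

theorem existsUnique_smul (u u' : η.B) (h : u.proj = u'.proj) : ∃! s : ℝˣ, s • u = u' := by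
  obtain ⟨⟨x, a⟩, ha⟩ := u
  obtain ⟨⟨y, a'⟩, ha'⟩ := u'
  obtain rfl : x = y := h
  obtain ⟨s, hs, hu⟩ := existsUnique_scaleCoframe ha ha'
  refine ⟨s, Subtype.ext (congrArg (TotalSpace.mk x) hs), fun t ht ↦ hu t ?_⟩
  have h1 : (⟨x, scaleCoframe t a⟩ : HomBundle M) = ⟨x, a'⟩ := congrArg Subtype.val ht
  exact eq_of_heq (TotalSpace.mk.inj h1).2

/-- The projection and the fibre coordinate are restrictions of functions on the ambient bundle,
smooth over the frame domain (the bundle projection and `evalFirst`). Since they determine the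
topology and the tangent vectors of $B$, the inclusion is an embedding and an immersion. A local
section is the one with fibre coordinate $1$. -/
theorem isReduction : η.IsReduction where
  isEmbedding := by
    refine ⟨Topology.isInducing_iff_nhds.2 fun u ↦ le_antisymm ?_ ?_, Subtype.val_injective⟩
    · exact (contMDiff_incl.continuous.tendsto u).le_comap
    · obtain ⟨X, W, h, hu⟩ := u.exists_frame
      have hc : Filter.Tendsto (B.incl : η.B → HomBundle M)
        (Filter.comap B.incl (𝓝 (B.incl u))) (𝓝 (B.incl u)) := Filter.tendsto_comap
      refine Filter.tendsto_id'.1 (tendsto_B (f := id) h hu ?_ ?_)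
      · exact (FiberBundle.continuous_proj (E3 →L[ℝ] (Fin 3 → ℝ)) (fun x : M ↦
          TangentSpace (𝓡 3) x →L[ℝ] Bundle.Trivial M (Fin 3 → ℝ) x)).continuousAt.tendsto.comp hc
      · exact (contMDiffAt_evalFirst h (w := B.incl u) hu).continuousAt.tendsto.comp hc
  contMDiff_incl := contMDiff_incl
  immersion u := by
    have key : ∀ L : E3 × ℝ →L[ℝ] (E3 × (E3 →L[ℝ] (Fin 3 → ℝ))), (∀ v, L v = 0 → v = 0) →
      Function.Injective L := fun L hL ↦ (injective_iff_map_eq_zero L).2 hL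
    refine key _ fun v hv ↦ ?_
    obtain ⟨X, W, h, hu⟩ := u.exists_frame
    have hi := (contMDiff_incl (η := η)).contMDiffAt (x := u) |>.mdifferentiableAt (by simp)
    refine eq_zero_of_mfderiv h hu ?_ ?_
    · have hp := (Bundle.contMDiffAt_proj (IB := 𝓡 3) (F := E3 →L[ℝ] (Fin 3 → ℝ)) (n := ∞)
        (fun x : M ↦ TangentSpace (𝓡 3) x →L[ℝ] Bundle.Trivial M (Fin 3 → ℝ) x)
        (p := B.incl u)).mdifferentiableAt (by simp)
      refine (DFunLike.congr_fun (mfderiv_comp u hp hi) v).trans ?_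
      exact (congrArg (mfderiv _ (𝓡 3) _ (B.incl u)) hv).trans
        (ContinuousLinearMap.map_zero _)
    · have hp := (contMDiffAt_evalFirst h (w := B.incl u) hu).mdifferentiableAt (by simp)
      refine (DFunLike.congr_fun (mfderiv_comp u hp hi) v).trans ?_
      exact (congrArg (mfderiv _ 𝓘(ℝ, ℝ) _ (B.incl u)) hv).trans
        (ContinuousLinearMap.map_zero _)
  contMDiff_smul := by
    rintro ⟨s, u⟩
    obtain ⟨X, W, h, hu⟩ := u.exists_frame
    have h2 : ContMDiffAt (𝓘(ℝ, ℝ).prod 𝓘(ℝ, E3 × ℝ)) 𝓘(ℝ, E3 × ℝ) ∞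
      (Prod.snd : ℝˣ × η.B → η.B) (s, u) := contMDiffAt_snd
    have h1 : ContMDiffAt (𝓘(ℝ, ℝ).prod 𝓘(ℝ, E3 × ℝ)) 𝓘(ℝ, ℝ) ∞
      (fun q : ℝˣ × η.B ↦ ((q.1⁻¹ : ℝˣ) : ℝ)) (s, u) :=
      Units.contMDiff_val.contMDiffAt.comp (s, u)
        ((contMDiff_inv 𝓘(ℝ, ℝ) ∞).contMDiffAt.comp (s, u) contMDiffAt_fst)
    have h3 : ContMDiffAt (𝓘(ℝ, ℝ).prod 𝓘(ℝ, E3 × ℝ)) 𝓘(ℝ, ℝ) ∞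
        (fun q : ℝˣ × η.B ↦ fiberCoord X q.2) (s, u) :=
      ContMDiffAt.comp (s, u) (contMDiffAt_fiberCoord h hu) h2
    have h4 : ContMDiffAt (𝓘(ℝ, ℝ).prod 𝓘(ℝ, E3 × ℝ)) (𝓡 3) ∞
        (fun q : ℝˣ × η.B ↦ q.2.proj) (s, u) :=
      ContMDiffAt.comp (g := (B.proj : η.B → M)) (s, u) (contMDiffAt_proj u) h2
    exact contMDiffAt_B h (f := fun q : ℝˣ × η.B ↦ q.1 • q.2) hu h4 (h1.mul h3)
  existsUnique_smul := existsUnique_smul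
  exists_section x hx := by
    obtain ⟨X, W₁, hxW, h⟩ := P.smooth₁ x
    have hex : ∀ y : M, y ∈ W₁ ∩ η.domain → ∃ u : η.B, u.proj = y ∧ fiberCoord X u = 1 := by
      intro y hy
      obtain ⟨u, hu, e⟩ := exists_isAdapted hy.2 (h.mem hy.1) (h.ne_zero y hy.1) one_ne_zero
      exact ⟨⟨⟨y, u⟩, hu⟩, rfl, e⟩
    obtain ⟨u₀, -⟩ := hex x ⟨hxW, hx⟩
    have : ∀ y : M, ∃ u : η.B, y ∈ W₁ ∩ η.domain → u.proj = y ∧ fiberCoord X u = 1 := by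
      intro y
      by_cases hy : y ∈ W₁ ∩ η.domain
      · obtain ⟨u, hu⟩ := hex y hy
        exact ⟨u, fun _ ↦ hu⟩
      -- Away from the open set the section has an arbitrary value.
      · exact ⟨u₀, fun h ↦ (hy h).elim⟩
    choose σ hσ using this
    have ho : IsOpen (W₁ ∩ η.domain) := h.isOpen.inter η.isContact.isOpen
    refine ⟨W₁ ∩ η.domain, σ, ho, ⟨hxW, hx⟩, inter_subset_right, fun y hy ↦ ?_,
      fun y hy ↦ (hσ y hy).1⟩
    refine (contMDiffAt_B h (by rw [(hσ y hy).1]; exact hy.1) ?_ ?_).contMDiffWithinAt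
    · exact contMDiffAt_id.congr_of_eventuallyEq
        ((ho.eventually_mem hy).mono fun z hz ↦ (hσ z hz).1)
    · exact contMDiffAt_const.congr_of_eventuallyEq
        ((ho.eventually_mem hy).mono fun z hz ↦ (hσ z hz).2)

end ContactForm

end PathGeometry
end
end PathGeom

/-! ### The induced metric on $SD^*$, and ratios of contact forms. -/

namespace PathGeom

noncomputable section

set_option linter.unusedSectionVars false

section Forms

variable {V : Type*} [NormedAddCommGroup V] [NormedSpace ℝ V]
  {N : Type*} [TopologicalSpace N] [ChartedSpace V N] [IsManifold 𝓘(ℝ, V) ∞ N]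
  {V' : Type*} [NormedAddCommGroup V'] [NormedSpace ℝ V']
  {N' : Type*} [TopologicalSpace N'] [ChartedSpace V' N'] [IsManifold 𝓘(ℝ, V') ∞ N']

/-- Pulling back by a left inverse. -/
theorem OneForm.pullback_leftInverse {f : N → N'} {k : N' → N} {x : N}
    (hk : ContMDiffAt 𝓘(ℝ, V') 𝓘(ℝ, V) ∞ k (f x)) (hf : ContMDiffAt 𝓘(ℝ, V) 𝓘(ℝ, V') ∞ f x)
    (hkf : ∀ y, k (f y) = y) (α : OneForm V N) (v : TangentSpace 𝓘(ℝ, V) x) :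
    OneForm.pullback k α (f x) (mfderiv 𝓘(ℝ, V) 𝓘(ℝ, V') f x v) = α x v := by
  have e : mfderiv 𝓘(ℝ, V) 𝓘(ℝ, V) (k ∘ f) x v = v := by
    rw [show k ∘ f = id from funext hkf, mfderiv_id]
    rfl
  have e2 : mfderiv 𝓘(ℝ, V') 𝓘(ℝ, V) k (f x) (mfderiv 𝓘(ℝ, V) 𝓘(ℝ, V') f x v) = v :=
    (DFunLike.congr_fun (mfderiv_comp x (hk.mdifferentiableAt (by simp))
      (hf.mdifferentiableAt (by simp))) v).symm.trans e
  have key : ∀ y, y = x → ∀ w v : V, w = v → (α y : V →L[ℝ] ℝ) w = (α x : V →L[ℝ] ℝ) v := by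
    rintro y rfl w v rfl
    rfl
  exact key _ (hkf x) _ _ e2

theorem BilinField.IsPullback.eq {f : N → N'} {g g' : BilinField V' N'} {b : BilinField V N}
    (h : BilinField.IsPullback f g b) (h' : BilinField.IsPullback f g' b) {x : N}
    (hf : Function.Surjective (mfderiv 𝓘(ℝ, V) 𝓘(ℝ, V') f x)) : g (f x) = g' (f x) := by
  ext v w
  obtain ⟨v, rfl⟩ := hf v
  obtain ⟨w, rfl⟩ := hf w
  rw [← h, ← h']

end Forms

namespace PathGeometry

variable {M : Type*} [TopologicalSpace M] [ChartedSpace E3 M] [IsManifold (𝓡 3) ∞ M]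
  {P : PathGeometry M}

namespace ContactForm

variable {η : P.ContactForm}

/-- Uniqueness of the connection and of its curvature removes the existential quantifiers. -/
theorem isInducedMetric_iff {G : BilinField (E3 × ℝ) P.SDStar} : η.IsInducedMetric G ↔
    BilinField.IsPullback η.h G η.metric ∧
    BilinField.IsPullback (fun u : η.B ↦ (η.h u).J) G η.metric := by
  constructor
  · rintro ⟨α, K, hα, hK, h1, h2⟩
    obtain rfl := hα.eq_conn
    obtain rfl := hK.eq_curv
    exact ⟨h1, h2⟩
  · exact fun h ↦ ⟨η.conn, η.curv, isNormalizedConnection_conn, isCurvature_curv, h.1, h.2⟩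

theorem bijective_mfderiv {f : η.B → P.SDStar}
    (hf : IsLocalDiffeomorph 𝓘(ℝ, E3 × ℝ) 𝓘(ℝ, E3 × ℝ) ∞ f) (u : η.B) :
    Function.Bijective (mfderiv 𝓘(ℝ, E3 × ℝ) 𝓘(ℝ, E3 × ℝ) f u) :=
  (hf.mfderivToContinuousLinearEquiv (by simp) u).bijective

theorem isOpen_SDNeg : IsOpen η.SDNeg := by
  have e : η.SDNeg = SDStar.J ⁻¹' η.SDPos := by
    ext p
    rw [mem_preimage, ← J_mem_SDNeg_iff, SDStar.J_J]
  rw [e]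
  exact isOpen_SDPos.preimage SDStar.contMDiff_J.continuous

/-- The metric of `B` transported by a map with inverse `k`. -/
def transport (k : P.SDStar → η.B) : BilinField (E3 × ℝ) P.SDStar := fun p ↦
  (OneForm.pullback k (η.taut 0)).symProd (OneForm.pullback k (η.taut 1)) p +
    (OneForm.pullback k (η.taut 2)).symProd (OneForm.pullback k (sigma η η.conn η.curv)) p

theorem transport_smoothAt {k : P.SDStar → η.B} {p : P.SDStar}
    (hk : ContMDiffAt 𝓘(ℝ, E3 × ℝ) 𝓘(ℝ, E3 × ℝ) ∞ k p) : (transport k).SmoothAt p := by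
  refine smoothAt_symProd_add ((taut_smoothAt 0 _).pullback hk) ((taut_smoothAt 1 _).pullback hk)
    ((taut_smoothAt 2 _).pullback hk) (OneForm.SmoothAt.pullback hk ?_)
  exact OneForm.SmoothAt.add (OneForm.SmoothAt.fmul contMDiffAt_const (conn_smoothAt _))
    (OneForm.SmoothAt.fmul (contMDiffAt_const.mul (localStructure_conn _).smooth_K)
      (taut_smoothAt 2 _))

theorem transport_apply {k : P.SDStar → η.B} {f : η.B → P.SDStar} {u : η.B}
    (hk : ContMDiffAt 𝓘(ℝ, E3 × ℝ) 𝓘(ℝ, E3 × ℝ) ∞ k (f u))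
    (hf : ContMDiffAt 𝓘(ℝ, E3 × ℝ) 𝓘(ℝ, E3 × ℝ) ∞ f u) (hkf : ∀ u, k (f u) = u)
    (v w : TangentSpace 𝓘(ℝ, E3 × ℝ) u) :
    η.metric u v w = transport k (f u) (mfderiv 𝓘(ℝ, E3 × ℝ) 𝓘(ℝ, E3 × ℝ) f u v)
      (mfderiv 𝓘(ℝ, E3 × ℝ) 𝓘(ℝ, E3 × ℝ) f u w) := by
  have e := fun (α : OneForm (E3 × ℝ) η.B) v ↦ OneForm.pullback_leftInverse hk hf hkf α v
  have key : ∀ v w, transport k (f u) v w =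
      2⁻¹ * (OneForm.pullback k (η.taut 0) (f u) v * OneForm.pullback k (η.taut 1) (f u) w +
        OneForm.pullback k (η.taut 1) (f u) v * OneForm.pullback k (η.taut 0) (f u) w) +
      2⁻¹ * (OneForm.pullback k (η.taut 2) (f u) v *
        OneForm.pullback k (sigma η η.conn η.curv) (f u) w +
        OneForm.pullback k (sigma η η.conn η.curv) (f u) v *
          OneForm.pullback k (η.taut 2) (f u) w) := fun v w ↦ rfl
  rw [key, metric_apply, e, e, e, e, e, e, e, e]

theorem exists_inducedMetric : ∃ G : BilinField (E3 × ℝ) P.SDStar, η.IsInducedMetric G ∧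
    ∀ p ∈ η.SDOver, G.SmoothAt p := by
  classical
  -- If $B$ is empty there is no inverse map to transport with, but then nothing of $SD^*$ lies over
  -- the domain either.
  rcases isEmpty_or_nonempty η.B with hB | hB
  · refine ⟨fun _ ↦ 0, isInducedMetric_iff.2 ⟨fun u ↦ (hB.false u).elim,
      fun u ↦ (hB.false u).elim⟩, fun p hp ↦ ?_⟩
    rw [← SDPos_union_SDNeg, ← isBundleIso_h.range_eq, ← isBundleIso_J_h.range_eq] at hp
    rcases hp with ⟨u, -⟩ | ⟨u, -⟩ <;> exact (hB.false u).elim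
  let k : P.SDStar → η.B := Function.invFun η.h
  have hkh : ∀ u, k (η.h u) = u := Function.leftInverse_invFun h_injective
  have hk := contMDiffOn_inv_h (η := η) (k := k) fun p hp ↦
    Function.invFun_eq ((range_h (η := η)).symm.subset hp)
  have hk1 : ∀ p ∈ η.SDPos, ContMDiffAt 𝓘(ℝ, E3 × ℝ) 𝓘(ℝ, E3 × ℝ) ∞ k p := fun p hp ↦
    hk.contMDiffAt (isOpen_SDPos.mem_nhds hp)
  have hk2 : ∀ p ∈ η.SDNeg, ContMDiffAt 𝓘(ℝ, E3 × ℝ) 𝓘(ℝ, E3 × ℝ) ∞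
      (fun p : P.SDStar ↦ k p.J) p := fun p hp ↦
    (hk1 _ (by rwa [← J_mem_SDNeg_iff, SDStar.J_J])).comp p SDStar.contMDiff_J.contMDiffAt
  -- Transport by $h^{-1}$ on $SD^+$ and by $(J\circ h)^{-1}=h^{-1}\circ J$ on $SD^-$. Both sets are
  -- open and they are disjoint, so no matching is needed; the value outside their union is
  -- irrelevant.
  let G : BilinField (E3 × ℝ) P.SDStar := fun p ↦
    if p ∈ η.SDPos then transport k p else transport (fun p : P.SDStar ↦ k p.J) p
  have hG1 : ∀ p ∈ η.SDPos, G p = transport k p := fun p hp ↦ if_pos hp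
  have hG2 : ∀ p ∈ η.SDNeg, G p = transport (fun p : P.SDStar ↦ k p.J) p := fun p hp ↦
    if_neg fun h ↦ Set.disjoint_left.1 disjoint_SDPos_SDNeg h hp
  refine ⟨G, isInducedMetric_iff.2 ⟨fun u v w ↦ ?_, fun u v w ↦ ?_⟩, fun p hp ↦ ?_⟩
  · rw [hG1 _ (h_mem_SDPos u)]
    exact transport_apply (hk1 _ (h_mem_SDPos u)) contMDiff_h.contMDiffAt hkh v w
  · have hm : (η.h u).J ∈ η.SDNeg := (J_mem_SDNeg_iff _).2 (h_mem_SDPos u)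
    rw [hG2 _ hm]
    exact transport_apply (f := fun u : η.B ↦ (η.h u).J) (hk2 _ hm)
      (SDStar.contMDiff_J.contMDiffAt.comp u contMDiff_h.contMDiffAt)
      (fun u ↦ by rw [SDStar.J_J, hkh]) v w
  · rw [← SDPos_union_SDNeg] at hp
    rcases hp with hp | hp
    · exact (transport_smoothAt (hk1 p hp)).congr
        ((isOpen_SDPos.eventually_mem hp).mono hG1)
    · exact (transport_smoothAt (hk2 p hp)).congr
        ((isOpen_SDNeg.eventually_mem hp).mono hG2)

/-- Every point over the domain of `η` is in the image of `h` or `J ∘ h`. -/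
theorem exists_of_mem_SDOver {p : P.SDStar} (hp : p ∈ η.SDOver) :
    ∃ u : η.B, η.h u = p ∨ (η.h u).J = p := by
  rw [← SDPos_union_SDNeg, ← isBundleIso_h.range_eq, ← isBundleIso_J_h.range_eq] at hp
  rcases hp with ⟨u, h⟩ | ⟨u, h⟩
  exacts [⟨u, Or.inl h⟩, ⟨u, Or.inr h⟩]

theorem IsInducedMetric.eq {G G' : BilinField (E3 × ℝ) P.SDStar} (h : η.IsInducedMetric G)
    (h' : η.IsInducedMetric G') {p : P.SDStar} (hp : p ∈ η.SDOver) : G p = G' p := by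
  obtain ⟨h1, h2⟩ := isInducedMetric_iff.1 h
  obtain ⟨h1', h2'⟩ := isInducedMetric_iff.1 h'
  obtain ⟨u, rfl | rfl⟩ := exists_of_mem_SDOver hp
  · exact h1.eq h1' (bijective_mfderiv isBundleIso_h.isLocalDiffeomorph u).2
  · exact h2.eq h2' (bijective_mfderiv isBundleIso_J_h.isLocalDiffeomorph u).2

theorem IsInducedMetric.hasSignature {G : BilinField (E3 × ℝ) P.SDStar}
    (h : η.IsInducedMetric G) {p : P.SDStar} (hp : p ∈ η.SDOver) :
    HasSignature (V := E3 × ℝ) 2 2 (G p) := by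
  obtain ⟨h1, h2⟩ := isInducedMetric_iff.1 h
  obtain ⟨u, rfl | rfl⟩ := exists_of_mem_SDOver hp
  · exact HasSignature.comp (bijective_mfderiv isBundleIso_h.isLocalDiffeomorph u)
      (h1 u) (metric_hasSignature u)
  · exact HasSignature.comp (bijective_mfderiv isBundleIso_J_h.isLocalDiffeomorph u)
      (h2 u) (metric_hasSignature u)

theorem isOpen_SDOver : IsOpen η.SDOver :=
  η.isContact.isOpen.preimage SDStar.continuous_proj

theorem IsInducedMetric.isMetric22On {G : BilinField (E3 × ℝ) P.SDStar}
    (h : η.IsInducedMetric G) : G.IsMetric22On η.SDOver := by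
  obtain ⟨G', h', s⟩ := exists_inducedMetric (η := η)
  refine ⟨BilinField.smoothOn_of_smoothAt fun p hp ↦ (s p hp).congr ?_, fun p hp ↦
    h.hasSignature hp⟩
  exact (isOpen_SDOver.eventually_mem hp).mono fun q hq ↦ h.eq h' hq

theorem exists_rescaled (η : P.ContactForm) {f : M → ℝ}
    (hf : ContMDiffOn (𝓡 3) 𝓘(ℝ, ℝ) ∞ f η.domain) (hf0 : ∀ x ∈ η.domain, f x ≠ 0) :
    ∃ η' : P.ContactForm, η'.domain = η.domain ∧ ∀ x ∈ η.domain, η'.form x = f x • η.form x := by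
  have ho := η.isContact.isOpen
  have hfs : ∀ x ∈ η.domain, ContMDiffAt (𝓡 3) 𝓘(ℝ, ℝ) ∞ f x := fun x hx ↦
    hf.contMDiffAt (ho.mem_nhds hx)
  have hz : ∀ x ∈ η.domain, ∀ v ∈ P.D x, η.form x v = 0 := by
    intro x hx v hv
    have : v ∈ (η.form x).toLinearMap.ker := by rw [η.isContact.ker_eq x hx]; exact hv
    exact this
  refine ⟨⟨η.domain, OneForm.fmul f η.form, ⟨ho, ?_, fun x hx ↦ ?_, fun x hx v hv hvw ↦ ?_⟩⟩, rfl,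
    fun x _ ↦ rfl⟩
  · exact (OneForm.smoothOn_iff _ ho).2 fun x hx ↦ (form_smoothAt hx).fmul (hfs x hx)
  · rw [← η.isContact.ker_eq x hx]
    ext v
    exact mul_eq_zero.trans (or_iff_right (hf0 x hx))
  · refine η.isContact.nondegenerate x hx v hv fun w hw ↦ ?_
    have := hvw w hw
    -- The term $df\wedge\eta$ vanishes on pairs from $D$, so there $d(f\eta)=f\,d\eta$ and
    -- non-degeneracy is inherited.
    rw [OneForm.d_fmul (hfs x hx) (form_smoothAt hx), OneForm.wedge, hz x hx v hv,
      hz x hx w hw, mul_zero, mul_zero, sub_zero, zero_add] at this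
    exact (mul_eq_zero.1 this).resolve_left (hf0 x hx)

/-- The ratio of two contact forms is smooth and non-zero. -/
theorem ratio_smoothAt {η η' : P.ContactForm} {f : M → ℝ}
    (h : ∀ x ∈ η.domain ∩ η'.domain, η'.form x = f x • η.form x) {x : M}
    (hx : x ∈ η.domain) (hx' : x ∈ η'.domain) :
    f x ≠ 0 ∧ ContMDiffAt (𝓡 3) 𝓘(ℝ, ℝ) ∞ f x := by
  obtain ⟨X₁, W₁, hx₁, h₁⟩ := P.smooth₁ x
  obtain ⟨X₂, W₂, hx₂, h₂⟩ := P.smooth₂ x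
  have hi := localCoframe_isInvertible hx (h₁.mem hx₁) (h₂.mem hx₂) (h₁.ne_zero x hx₁)
    (h₂.ne_zero x hx₂)
  have hs := localCoframe_smoothAt (η := η) h₁ h₂ hx hx₁ hx₂
  refine ⟨fun h0 ↦ ?_, ?_⟩
  · have e : ∀ v, η'.form x v = 0 := by
      intro v
      rw [h x ⟨hx, hx'⟩, h0, zero_smul]
      rfl
    have m : X₁ x ∈ P.D x := Submodule.mem_sup_left (h₁.mem hx₁)
    -- If `f` vanished at `x`, the kernel $D$ of $\eta'$ would be the whole tangent space, against
    -- $\eta(e_2)=1$ for the dual frame.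
    have hD : ∀ v, v ∈ P.D x := fun v ↦ by
      rw [← η'.isContact.ker_eq x hx']
      exact e v
    have k := apply_dualFrame hi 2 2
    have := hD (dualFrame (localCoframe η X₁ X₂) 2 x)
    rw [← η.isContact.ker_eq x hx] at this
    have this' : localCoframe η X₁ X₂ 2 x (dualFrame (localCoframe η X₁ X₂) 2 x) = 0 := this
    rw [this'] at k
    simp at k
  -- `f` is the last coefficient of the smooth form $\eta'$ in the local coframe of $\eta$, the
  -- first two being zero.
  · refine coeff_smoothAt hs hi (form_smoothAt hx') (c := ![fun _ ↦ 0, fun _ ↦ 0, f]) ?_ 2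
    filter_upwards [η.isContact.isOpen.mem_nhds hx, η'.isContact.isOpen.mem_nhds hx']
      with y hy hy' v
    rw [h y ⟨hy, hy'⟩, Fin.sum_univ_three]
    change f y * η.form y v = 0 * _ + 0 * _ + f y * η.form y v
    ring

end ContactForm

end PathGeometry
end
end PathGeom

/-! ### Frame derivatives on $B$. -/

namespace PathGeom

noncomputable section

set_option linter.unusedSectionVars false

namespace PathGeometry

variable {M : Type*} [TopologicalSpace M] [ChartedSpace E3 M] [IsManifold (𝓡 3) ∞ M]
  {P : PathGeometry M}

namespace ContactForm

variable {η : P.ContactForm}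

variable (η) in
/-- The frame of `B` dual to `ω¹, ω², ω³, α`. -/
def frame (j : Fin 4) (u : η.B) : TangentSpace 𝓘(ℝ, E3 × ℝ) u :=
  dualFrame (coframe4 η η.conn) j u

theorem smoothVFieldAt_frame (j : Fin 4) (u : η.B) : SmoothVFieldAt (η.frame j) u :=
  smoothVFieldAt_dualFrame (localStructure_conn u).smooth.self_of_nhds (isInvertible_coframe4 u) j

theorem taut_frame (i : Fin 3) (j : Fin 4) (u : η.B) :
    η.taut i u (η.frame j u) = if i.castSucc = j then 1 else 0 := by
  have h := fun i ↦ apply_dualFrame (isInvertible_coframe4 u) i j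
  fin_cases i
  exacts [h 0, h 1, h 2]

theorem conn_frame (j : Fin 4) (u : η.B) : η.conn u (η.frame j u) = if 3 = j then 1 else 0 :=
  apply_dualFrame (isInvertible_coframe4 u) 3 j

theorem apply_eq_frame (u : η.B) (a : TangentSpace 𝓘(ℝ, E3 × ℝ) u →L[ℝ] ℝ)
    (v : TangentSpace 𝓘(ℝ, E3 × ℝ) u) : a v = a (η.frame 0 u) * η.taut 0 u v +
      a (η.frame 1 u) * η.taut 1 u v + a (η.frame 2 u) * η.taut 2 u v +
      a (η.frame 3 u) * η.conn u v := by
  have h := eq_sum_dualFrame (isInvertible_coframe4 u) v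
  rw [Fin.sum_univ_four] at h
  have key : ∀ (a : E3 × ℝ →L[ℝ] ℝ) (c0 c1 c2 c3 : ℝ) (v e0 e1 e2 e3 : E3 × ℝ),
      v = c0 • e0 + c1 • e1 + c2 • e2 + c3 • e3 →
      a v = a e0 * c0 + a e1 * c1 + a e2 * c2 + a e3 * c3 := by
    rintro a c0 c1 c2 c3 _ e0 e1 e2 e3 rfl
    simp only [map_add, map_smul, smul_eq_mul]
    ring
  exact key a _ _ _ _ _ _ _ _ _ h

theorem d_taut_two (u : η.B) (v w : TangentSpace 𝓘(ℝ, E3 × ℝ) u) :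
    (η.taut 2).d u v w = (η.taut 0).wedge (η.taut 1) u v w :=
  (localStructure_conn u).d_two.self_of_nhds v w

/-- The derivative of a function along the frame. -/
def frameDeriv (l : η.B → ℝ) (i : Fin 4) (u : η.B) : ℝ := dform l u (η.frame i u)

theorem contMDiffAt_frameDeriv {l : η.B → ℝ} {u : η.B}
    (hl : ContMDiffAt 𝓘(ℝ, E3 × ℝ) 𝓘(ℝ, ℝ) ∞ l u) (i : Fin 4) :
    ContMDiffAt 𝓘(ℝ, E3 × ℝ) 𝓘(ℝ, ℝ) ∞ (frameDeriv l i) u :=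
  (dform_smoothAt hl).apply_vField (smoothVFieldAt_frame i u)

theorem dform_eq_frame (l : η.B → ℝ) (u : η.B) (v : TangentSpace 𝓘(ℝ, E3 × ℝ) u) :
    dform l u v = frameDeriv l 0 u * η.taut 0 u v + frameDeriv l 1 u * η.taut 1 u v +
      frameDeriv l 2 u * η.taut 2 u v + frameDeriv l 3 u * η.conn u v :=
  apply_eq_frame u _ v

/-- The consequences of `ddl = 0` for the lift `l` of a function on `M`. -/
theorem frameDeriv_frameDeriv {l : η.B → ℝ} {U : Set η.B} (hU : IsOpen U)
    (hl : ∀ u ∈ U, ContMDiffAt 𝓘(ℝ, E3 × ℝ) 𝓘(ℝ, ℝ) ∞ l u)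
    (h3 : ∀ u ∈ U, frameDeriv l 3 u = 0) {u : η.B} (hu : u ∈ U) :
    frameDeriv (frameDeriv l 0) 3 u = frameDeriv l 0 u ∧
    frameDeriv (frameDeriv l 1) 3 u = -frameDeriv l 1 u ∧
    frameDeriv (frameDeriv l 0) 1 u = frameDeriv (frameDeriv l 1) 0 u + frameDeriv l 2 u := by
  have e : ∀ᶠ y in 𝓝 u, dform l y = ((OneForm.fmul (frameDeriv l 0) (η.taut 0)).add
      ((OneForm.fmul (frameDeriv l 1) (η.taut 1)).add
        (OneForm.fmul (frameDeriv l 2) (η.taut 2)))) y := by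
    filter_upwards [hU.mem_nhds hu] with y hy
    ext v
    rw [dform_eq_frame, h3 y hy]
    simp only [OneForm.add_apply, OneForm.fmul_apply]
    ring
  have s := fun i ↦ contMDiffAt_frameDeriv (hl u hu) i
  have t := fun i ↦ taut_smoothAt (η := η) i u
  -- Expansion of $0=ddl=d(l_0\omega^1+l_1\omega^2+l_2\omega^3)$, with subscripts 0, 1, 2 for the
  -- indices in the code; there is no $\alpha$ term because `l` is constant along the fibres.
  have D : ∀ v w, (0 : ℝ) = _ := fun v w ↦ (d_dform (hl u hu) v w).symm.trans
    ((OneForm.d_congr e v w).trans ((OneForm.d_add ((t 0).fmul (s 0))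
      (((t 1).fmul (s 1)).add ((t 2).fmul (s 2))) v w).trans
      (congrArg₂ (· + ·) (OneForm.d_fmul (s 0) (t 0) v w)
        ((OneForm.d_add ((t 1).fmul (s 1)) ((t 2).fmul (s 2)) v w).trans
          (congrArg₂ (· + ·) (OneForm.d_fmul (s 1) (t 1) v w)
            (OneForm.d_fmul (s 2) (t 2) v w))))))
  obtain ⟨⟨c, h0⟩, c', h1⟩ := conn_normalizedAt u
  simp only [h0, h1, d_taut_two, OneForm.wedge, dform_eq_frame (frameDeriv l 0),
    dform_eq_frame (frameDeriv l 1), dform_eq_frame (frameDeriv l 2)] at D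
  -- The pairs containing the vertical vector give the fibre weights $\pm1$ of $l_0$ and $l_1$; the
  -- pair $(e_0,e_1)$ gives the commutator, where $d\omega^3=\omega^1\wedge\omega^2$ contributes
  -- $l_2$.
  have D1 := D (η.frame 3 u) (η.frame 0 u)
  have D2 := D (η.frame 3 u) (η.frame 1 u)
  have D3 := D (η.frame 0 u) (η.frame 1 u)
  simp [taut_frame, conn_frame] at D1 D2 D3
  refine ⟨?_, ?_, ?_⟩ <;> linarith

end ContactForm

end PathGeometry
end
end PathGeom

/-! ### Rescaling of the structure equations, of the curvature and of the metric. -/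

namespace PathGeom

noncomputable section

set_option linter.unusedSectionVars false

namespace PathGeometry

variable {M : Type*} [TopologicalSpace M] [ChartedSpace E3 M] [IsManifold (𝓡 3) ∞ M]
  {P : PathGeometry M}

namespace ContactForm

variable {η : P.ContactForm}

section Rescale

/-- The tautological forms of the contact form `ε eˡ η`, in terms of those of `η`. -/
def rescaledTaut (l : η.B → ℝ) (ε : ℝ) : Fin 3 → OneForm (E3 × ℝ) η.B :=
  ![OneForm.fmul (fun u ↦ Real.exp (l u / 2))
      ((η.taut 0).add (OneForm.fmul (fun u ↦ -frameDeriv l 1 u) (η.taut 2))),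
    OneForm.fmul (fun u ↦ ε * Real.exp (l u / 2))
      ((η.taut 1).add (OneForm.fmul (frameDeriv l 0) (η.taut 2))),
    OneForm.fmul (fun u ↦ ε * Real.exp (l u / 2) ^ 2) (η.taut 2)]

/-- The coefficient of `ω³` in `rescaledConn`. -/
def connCoeff (l : η.B → ℝ) (u : η.B) : ℝ :=
  -frameDeriv (frameDeriv l 1) 0 u - 2 * frameDeriv l 0 u * frameDeriv l 1 u - frameDeriv l 2 u / 2

/-- The connection form of the contact form `ε eˡ η`, in terms of that of `η`. -/
def rescaledConn (l : η.B → ℝ) : OneForm (E3 × ℝ) η.B :=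
  η.conn.add ((OneForm.fmul (fun u ↦ 3 / 2 * frameDeriv l 0 u) (η.taut 0)).add
    ((OneForm.fmul (fun u ↦ -(3 / 2) * frameDeriv l 1 u) (η.taut 1)).add
      (OneForm.fmul (connCoeff l) (η.taut 2))))

theorem rescaledTaut_apply (l : η.B → ℝ) (ε : ℝ) (u : η.B) (v : TangentSpace 𝓘(ℝ, E3 × ℝ) u) :
    rescaledTaut l ε 0 u v =
      Real.exp (l u / 2) * (η.taut 0 u v + -frameDeriv l 1 u * η.taut 2 u v) ∧
    rescaledTaut l ε 1 u v =
      ε * Real.exp (l u / 2) * (η.taut 1 u v + frameDeriv l 0 u * η.taut 2 u v) ∧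
    rescaledTaut l ε 2 u v = ε * Real.exp (l u / 2) ^ 2 * η.taut 2 u v := ⟨rfl, rfl, rfl⟩

theorem rescaledConn_apply (l : η.B → ℝ) (u : η.B) (v : TangentSpace 𝓘(ℝ, E3 × ℝ) u) :
    rescaledConn l u v = η.conn u v + (3 / 2 * frameDeriv l 0 u * η.taut 0 u v +
      (-(3 / 2) * frameDeriv l 1 u * η.taut 1 u v + connCoeff l u * η.taut 2 u v)) := rfl

variable {l : η.B → ℝ}

theorem dform_exp_half {u : η.B} (hl : ContMDiffAt 𝓘(ℝ, E3 × ℝ) 𝓘(ℝ, ℝ) ∞ l u) (ε : ℝ)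
    (v : TangentSpace 𝓘(ℝ, E3 × ℝ) u) : dform (fun u ↦ ε * Real.exp (l u / 2)) u v =
      ε * Real.exp (l u / 2) / 2 * dform l u v := by
  refine dform_comp (g := fun t ↦ ε * Real.exp (t / 2)) ?_ hl v
  have := (((hasDerivAt_id (l u)).div_const 2).exp).const_mul ε
  exact this.congr_deriv (by simp; ring)

theorem contMDiffAt_exp_half {u : η.B} (hl : ContMDiffAt 𝓘(ℝ, E3 × ℝ) 𝓘(ℝ, ℝ) ∞ l u) (ε : ℝ) :
    ContMDiffAt 𝓘(ℝ, E3 × ℝ) 𝓘(ℝ, ℝ) ∞ (fun u ↦ ε * Real.exp (l u / 2)) u := by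
  have : ContDiff ℝ ∞ fun t : ℝ ↦ ε * Real.exp (t / 2) := by fun_prop
  exact this.contMDiff.contMDiffAt.comp u hl

theorem d_rescaledTaut_zero {U : Set η.B} (hU : IsOpen U)
    (hl : ∀ u ∈ U, ContMDiffAt 𝓘(ℝ, E3 × ℝ) 𝓘(ℝ, ℝ) ∞ l u)
    (h3 : ∀ u ∈ U, frameDeriv l 3 u = 0) {u : η.B} (hu : u ∈ U)
    {ε : ℝ} (hε : ε = 1 ∨ ε = -1) : ∃ c : ℝ, ∀ v w,
    (rescaledTaut l ε 0).d u v w = -(rescaledConn l u v * rescaledTaut l ε 0 u w -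
      rescaledConn l u w * rescaledTaut l ε 0 u v) +
      c * (rescaledTaut l ε 1).wedge (rescaledTaut l ε 2) u v w := by
  obtain ⟨-, r1, -⟩ := frameDeriv_frameDeriv hU hl h3 hu
  have s := fun i ↦ contMDiffAt_frameDeriv (hl u hu) i
  have t := fun i ↦ taut_smoothAt (η := η) i u
  obtain ⟨⟨c, h0⟩, -⟩ := conn_normalizedAt u
  have m0 := Real.exp_ne_zero (l u / 2)
  -- The $\omega^2\wedge\omega^3$ coefficient of the expansion, after division by the scale factors;
  -- the sign enters squared and so does not appear.
  refine ⟨(c - frameDeriv (frameDeriv l 1) 1 u + frameDeriv l 1 u ^ 2) /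
    Real.exp (l u / 2) ^ 2, fun v w ↦ ?_⟩
  have n1 : ContMDiffAt 𝓘(ℝ, E3 × ℝ) 𝓘(ℝ, ℝ) ∞ (fun u ↦ -frameDeriv l 1 u) u := (s 1).neg
  have n2 : ∀ v : TangentSpace 𝓘(ℝ, E3 × ℝ) u, dform (fun u ↦ -frameDeriv l 1 u) u v = -1 * dform (frameDeriv l 1) u v :=
    fun v ↦ dform_comp (g := fun t ↦ -t) (hasDerivAt_neg _) (s 1) v
  have e1 : ContMDiffAt 𝓘(ℝ, E3 × ℝ) 𝓘(ℝ, ℝ) ∞ (fun u ↦ Real.exp (l u / 2)) u := by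
    simpa using contMDiffAt_exp_half (hl u hu) 1
  have e2 : ∀ v : TangentSpace 𝓘(ℝ, E3 × ℝ) u, dform (fun u ↦ Real.exp (l u / 2)) u v =
      Real.exp (l u / 2) / 2 * dform l u v := by
    simpa using dform_exp_half (hl u hu) 1
  have E : (rescaledTaut l ε 0).d u v w = _ := (OneForm.d_fmul e1 ((t 0).add ((t 2).fmul n1)) v w).trans
    (congrArg₂ (· + ·) rfl (congrArg _ ((OneForm.d_add (t 0) ((t 2).fmul n1) v w).trans
      (congrArg₂ (· + ·) rfl (OneForm.d_fmul n1 (t 2) v w)))))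
  rw [E]
  have rt := rescaledTaut_apply l ε u
  simp only [OneForm.wedge, h0, d_taut_two, e2, n2, dform_eq_frame l, h3 u hu,
    dform_eq_frame (frameDeriv l 1), r1, (rt _).1, (rt _).2.1, (rt _).2.2, rescaledConn_apply,
    connCoeff, OneForm.add_apply, OneForm.fmul_apply]
  rcases hε with rfl | rfl
  · field_simp
    ring
  · field_simp
    ring

/-- Unlike the first equation, this one needs the commutator relation: the mixed derivative
$l_{0;1}$ has to be turned into $l_{1;0}+l_2$ to match `connCoeff`. -/
theorem d_rescaledTaut_one {U : Set η.B} (hU : IsOpen U)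
    (hl : ∀ u ∈ U, ContMDiffAt 𝓘(ℝ, E3 × ℝ) 𝓘(ℝ, ℝ) ∞ l u)
    (h3 : ∀ u ∈ U, frameDeriv l 3 u = 0) {u : η.B} (hu : u ∈ U)
    {ε : ℝ} (hε : ε = 1 ∨ ε = -1) : ∃ c : ℝ, ∀ v w,
    (rescaledTaut l ε 1).d u v w = (rescaledConn l u v * rescaledTaut l ε 1 u w -
      rescaledConn l u w * rescaledTaut l ε 1 u v) +
      c * (rescaledTaut l ε 2).wedge (rescaledTaut l ε 0) u v w := by
  obtain ⟨r0, -, r2⟩ := frameDeriv_frameDeriv hU hl h3 hu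
  have s := fun i ↦ contMDiffAt_frameDeriv (hl u hu) i
  have t := fun i ↦ taut_smoothAt (η := η) i u
  obtain ⟨-, c, h1⟩ := conn_normalizedAt u
  have m0 := Real.exp_ne_zero (l u / 2)
  refine ⟨(c - frameDeriv (frameDeriv l 0) 0 u + frameDeriv l 0 u ^ 2) /
    Real.exp (l u / 2) ^ 2, fun v w ↦ ?_⟩
  have e1 := contMDiffAt_exp_half (hl u hu) ε
  have e2 := dform_exp_half (hl u hu) ε
  have E : (rescaledTaut l ε 1).d u v w = _ :=
    (OneForm.d_fmul e1 ((t 1).add ((t 2).fmul (s 0))) v w).trans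
    (congrArg₂ (· + ·) rfl (congrArg _ ((OneForm.d_add (t 1) ((t 2).fmul (s 0)) v w).trans
      (congrArg₂ (· + ·) rfl (OneForm.d_fmul (s 0) (t 2) v w)))))
  rw [E]
  have rt := rescaledTaut_apply l ε u
  simp only [OneForm.wedge, h1, d_taut_two, e2, dform_eq_frame l, h3 u hu,
    dform_eq_frame (frameDeriv l 0), r0, r2, (rt _).1, (rt _).2.1, (rt _).2.2, rescaledConn_apply,
    connCoeff, OneForm.add_apply, OneForm.fmul_apply]
  rcases hε with rfl | rfl
  · field_simp
    ring
  · field_simp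
    ring

/-- Only this value is needed: $\omega^3$ vanishes on both frame vectors, so there the rescaled
2-forms reduce to the one whose coefficient is the new curvature. -/
theorem d_rescaledConn {U : Set η.B}
    (hl : ∀ u ∈ U, ContMDiffAt 𝓘(ℝ, E3 × ℝ) 𝓘(ℝ, ℝ) ∞ l u) {u : η.B} (hu : u ∈ U) :
    (rescaledConn l).d u (η.frame 0 u) (η.frame 1 u) =
    η.curv u - 3 / 2 * frameDeriv (frameDeriv l 0) 1 u -
      3 / 2 * frameDeriv (frameDeriv l 1) 0 u + connCoeff l u := by
  have s : ∀ i, ∀ u ∈ U, ContMDiffAt 𝓘(ℝ, E3 × ℝ) 𝓘(ℝ, ℝ) ∞ (frameDeriv l i) u :=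
    fun i u hu ↦ contMDiffAt_frameDeriv (hl u hu) i
  have t := fun i ↦ taut_smoothAt (η := η) i u
  have c0 : ∀ c : ℝ, ∀ i, ContMDiffAt 𝓘(ℝ, E3 × ℝ) 𝓘(ℝ, ℝ) ∞ (fun u ↦ c * frameDeriv l i u) u :=
    fun c i ↦ contMDiffAt_const.mul (s i u hu)
  have c1 : ∀ c : ℝ, ∀ i v, dform (fun u ↦ c * frameDeriv l i u) u v =
      c * dform (frameDeriv l i) u v := fun c i v ↦
    dform_comp (g := fun t ↦ c * t) (by simpa using (hasDerivAt_id _).const_mul c) (s i u hu) v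
  have cc : ContMDiffAt 𝓘(ℝ, E3 × ℝ) 𝓘(ℝ, ℝ) ∞ (connCoeff l) u :=
    ((contMDiffAt_frameDeriv (s 1 u hu) 0).neg.sub ((contMDiffAt_const.mul (s 0 u hu)).mul
      (s 1 u hu))).sub ((s 2 u hu).div_const 2)
  obtain ⟨⟨c, h0⟩, c', h1⟩ := conn_normalizedAt u
  have t1 := (t 0).fmul (c0 (3 / 2) 0)
  have t2 := (t 1).fmul (c0 (-(3 / 2)) 1)
  have t3 := (t 2).fmul cc
  rw [rescaledConn, OneForm.d_add (conn_smoothAt u) (t1.add (t2.add t3)),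
    OneForm.d_add t1 (t2.add t3), OneForm.d_add t2 t3, OneForm.d_fmul (c0 _ 0) (t 0),
    OneForm.d_fmul (c0 _ 1) (t 1), OneForm.d_fmul cc (t 2), h0, h1, d_taut_two]
  have hK : η.conn.d u (η.frame 0 u) (η.frame 1 u) = η.curv u := rfl
  rw [hK]
  simp only [OneForm.wedge, c1, taut_frame, conn_frame]
  simp [frameDeriv]
  ring

/-- A form satisfying the first two structure equations of `rescaledTaut` is determined. -/
theorem eq_rescaledConn {ε : ℝ} (hε : ε = 1 ∨ ε = -1) {u : η.B}
    {a b : TangentSpace 𝓘(ℝ, E3 × ℝ) u →L[ℝ] ℝ} {T0 T1 : TangentSpace 𝓘(ℝ, E3 × ℝ) u →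
      TangentSpace 𝓘(ℝ, E3 × ℝ) u → ℝ} {c0 c0' c1 c1' : ℝ}
    (ha0 : ∀ v w, T0 v w = -(a v * rescaledTaut l ε 0 u w - a w * rescaledTaut l ε 0 u v) +
      c0 * (rescaledTaut l ε 1).wedge (rescaledTaut l ε 2) u v w)
    (hb0 : ∀ v w, T0 v w = -(b v * rescaledTaut l ε 0 u w - b w * rescaledTaut l ε 0 u v) +
      c0' * (rescaledTaut l ε 1).wedge (rescaledTaut l ε 2) u v w)
    (ha1 : ∀ v w, T1 v w = (a v * rescaledTaut l ε 1 u w - a w * rescaledTaut l ε 1 u v) +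
      c1 * (rescaledTaut l ε 2).wedge (rescaledTaut l ε 0) u v w)
    (hb1 : ∀ v w, T1 v w = (b v * rescaledTaut l ε 1 u w - b w * rescaledTaut l ε 1 u v) +
      c1' * (rescaledTaut l ε 2).wedge (rescaledTaut l ε 0) u v w) : a = b := by
  have k0 := fun v w ↦ (ha0 v w).symm.trans (hb0 v w)
  have k1 := fun v w ↦ (ha1 v w).symm.trans (hb1 v w)
  have m0 := Real.exp_ne_zero (l u / 2)
  have ε0 : ε ≠ 0 := by rcases hε with rfl | rfl <;> norm_num
  have rt := rescaledTaut_apply l ε u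
  simp only [OneForm.wedge, (rt _).1, (rt _).2.1, (rt _).2.2] at k0 k1
  -- The frame is dual to the original forms, not to the rescaled ones. Because of the shift by
  -- $\omega^3$, the equation for $e_2$ still involves the value on $e_0$, which the second
  -- structure equation supplies.
  have q3 := k0 (η.frame 0 u) (η.frame 3 u)
  have q2 := k0 (η.frame 0 u) (η.frame 2 u)
  have q1 := k0 (η.frame 0 u) (η.frame 1 u)
  have q0 := k1 (η.frame 0 u) (η.frame 1 u)
  simp [taut_frame, ε0] at q0 q1 q2 q3
  rw [q0] at q2
  ext v
  rw [apply_eq_frame u a, apply_eq_frame u b, q0, q1, q3]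
  have : a (η.frame 2 u) = b (η.frame 2 u) := 
    mul_right_cancel₀ m0 (by linarith)
  rw [this]

/-- If `K` is the curvature computed from `rescaledConn` and `rescaledTaut`, the Fefferman form of
the rescaled data is `ε eˡ` times that of the original data. -/
theorem rescaled_metric {U : Set η.B} (hU : IsOpen U)
    (hl : ∀ u ∈ U, ContMDiffAt 𝓘(ℝ, E3 × ℝ) 𝓘(ℝ, ℝ) ∞ l u)
    (h3 : ∀ u ∈ U, frameDeriv l 3 u = 0) {u : η.B} (hu : u ∈ U) {ε : ℝ} (hε : ε = 1 ∨ ε = -1)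
    {K b₁ b₂ : ℝ} (hK : ∀ v w, (rescaledConn l).d u v w =
      b₁ * (rescaledTaut l ε 1).wedge (rescaledTaut l ε 2) u v w +
      b₂ * (rescaledTaut l ε 2).wedge (rescaledTaut l ε 0) u v w +
      K * (rescaledTaut l ε 0).wedge (rescaledTaut l ε 1) u v w)
    (v w : TangentSpace 𝓘(ℝ, E3 × ℝ) u) :
    2⁻¹ * (rescaledTaut l ε 0 u v * rescaledTaut l ε 1 u w +
        rescaledTaut l ε 1 u v * rescaledTaut l ε 0 u w) +
      2⁻¹ * (rescaledTaut l ε 2 u v *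
          (-(2 / 3) * rescaledConn l u w + 1 / 6 * K * rescaledTaut l ε 2 u w) +
        (-(2 / 3) * rescaledConn l u v + 1 / 6 * K * rescaledTaut l ε 2 u v) *
          rescaledTaut l ε 2 u w) =
      ε * Real.exp (l u / 2) ^ 2 * η.metric u v w := by
  obtain ⟨-, -, r2⟩ := frameDeriv_frameDeriv hU hl h3 hu
  have hd := (d_rescaledConn hl hu).symm.trans (hK _ _)
  have rt := rescaledTaut_apply l ε u
  have m0 := Real.exp_ne_zero (l u / 2)
  simp only [OneForm.wedge, (rt _).1, (rt _).2.1, (rt _).2.2, taut_frame] at hd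
  simp at hd
  rw [r2] at hd
  simp only [(rt _).1, (rt _).2.1, (rt _).2.2, rescaledConn_apply, metric_apply, sigma_apply]
  unfold connCoeff at hd ⊢
  rcases hε with rfl | rfl
  -- The new curvature, solved from its value on $(e_0,e_1)$. In the metric
  -- $-\tfrac23\cdot\tfrac32=-1$ cancels the cross terms of the shifted coframe, and the weight
  -- $\tfrac16$ cancels the remaining derivative terms multiplying $\omega^3\cdot\omega^3$.
  · have hk : K = (η.curv u - 4 * frameDeriv (frameDeriv l 1) 0 u -
        2 * frameDeriv l 0 u * frameDeriv l 1 u - 2 * frameDeriv l 2 u) /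
          Real.exp (l u / 2) ^ 2 := by
      field_simp
      linear_combination -hd
    rw [hk]
    field_simp
    ring
  · have hk : K = -(η.curv u - 4 * frameDeriv (frameDeriv l 1) 0 u -
        2 * frameDeriv l 0 u * frameDeriv l 1 u - 2 * frameDeriv l 2 u) /
          Real.exp (l u / 2) ^ 2 := by
      field_simp
      linear_combination hd
    rw [hk]
    field_simp
    ring

end Rescale

end ContactForm

end PathGeometry
end
end PathGeom

/-! ### Coframes adapted to a rescaled contact form. -/

namespace PathGeom

noncomputable section

set_option linter.unusedSectionVars false

section Forms

variable {V : Type*} [NormedAddCommGroup V] [NormedSpace ℝ V]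
  {N : Type*} [TopologicalSpace N] [ChartedSpace V N]
  {V' : Type*} [NormedAddCommGroup V'] [NormedSpace ℝ V']
  {N' : Type*} [TopologicalSpace N'] [ChartedSpace V' N']
  {V'' : Type*} [NormedAddCommGroup V''] [NormedSpace ℝ V'']
  {N'' : Type*} [TopologicalSpace N''] [ChartedSpace V'' N'']

/-- If `φ = φ' ∘ ψ` near `x` and `ψ` multiplies the forms pulled back by `φ'` and `φ` by `c`, then
the forms themselves differ by the factor `c` at `φ x`. -/
theorem BilinField.IsPullback.eq_smul {φ : N → N''} {ψ : N → N'} {φ' : N' → N''}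
    {G G' : BilinField V'' N''} {g : BilinField V N} {g' : BilinField V' N'} {x : N} {c : ℝ}
    (h : BilinField.IsPullback φ G g) (h' : BilinField.IsPullback φ' G' g')
    (e : φ =ᶠ[𝓝 x] φ' ∘ ψ) (hφ' : MDifferentiableAt 𝓘(ℝ, V') 𝓘(ℝ, V'') φ' (ψ x))
    (hψ : MDifferentiableAt 𝓘(ℝ, V) 𝓘(ℝ, V') ψ x)
    (hs : Function.Surjective (mfderiv 𝓘(ℝ, V) 𝓘(ℝ, V'') φ x))
    (hg : ∀ v w, g' (ψ x) (mfderiv 𝓘(ℝ, V) 𝓘(ℝ, V') ψ x v) (mfderiv 𝓘(ℝ, V) 𝓘(ℝ, V') ψ x w) =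
      c * g x v w) : G' (φ x) = c • G (φ x) := by
  have hd : ∀ v, (mfderiv 𝓘(ℝ, V) 𝓘(ℝ, V'') φ x v : V'') =
      mfderiv 𝓘(ℝ, V') 𝓘(ℝ, V'') φ' (ψ x) (mfderiv 𝓘(ℝ, V) 𝓘(ℝ, V') ψ x v) := fun v ↦
    DFunLike.congr_fun (F := V →L[ℝ] V'') (e.mfderiv_eq.trans (mfderiv_comp x hφ' hψ)) v
  have key : ∀ y, y = φ x → ∀ a a' b b' : V'', a = a' → b = b' →
      (G' (φ x) : V'' →L[ℝ] V'' →L[ℝ] ℝ) a b = (G' y : V'' →L[ℝ] V'' →L[ℝ] ℝ) a' b' := by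
    rintro y rfl a a' b b' rfl rfl
    rfl
  ext v w
  obtain ⟨v, rfl⟩ := hs v
  obtain ⟨w, rfl⟩ := hs w
  refine (key _ e.self_of_nhds.symm _ _ _ _ (hd v) (hd w)).trans ?_
  refine (h' _ _ _).symm.trans ((hg v w).trans ?_)
  rw [h x v w]
  rfl

end Forms

namespace PathGeometry

variable {M : Type*} [TopologicalSpace M] [ChartedSpace E3 M] [IsManifold (𝓡 3) ∞ M]
  {P : PathGeometry M}

namespace ContactForm

variable {η η' : P.ContactForm} {f : M → ℝ}

/-- The projection is a submersion; the dual frame gives an explicit horizontal lift. -/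
theorem B.exists_lift (u : η.B) (y : TangentSpace (𝓡 3) u.proj) : ∃ v : TangentSpace 𝓘(ℝ, E3 × ℝ) u,
    mfderiv 𝓘(ℝ, E3 × ℝ) (𝓡 3) (B.proj : η.B → M) u v = y := by
  refine ⟨u.coframe y 0 • η.frame 0 u + u.coframe y 1 • η.frame 1 u +
    u.coframe y 2 • η.frame 2 u, u.adapted.bijective.1 ?_⟩
  ext i
  change η.taut i u (u.coframe y 0 • η.frame 0 u + u.coframe y 1 • η.frame 1 u +
    u.coframe y 2 • η.frame 2 u) = u.coframe y i
  simp only [map_add, map_smul, taut_frame, smul_eq_mul]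
  fin_cases i <;> simp

/-- The logarithm of the factor between two contact forms, on the bundle `B`. -/
def logRatio (f : M → ℝ) (u : η.B) : ℝ := Real.log (f u.proj)

theorem contMDiffAt_logRatio {u : η.B} (hf : ContMDiffAt (𝓡 3) 𝓘(ℝ, ℝ) ∞ f u.proj)
    (h0 : f u.proj ≠ 0) : ContMDiffAt 𝓘(ℝ, E3 × ℝ) 𝓘(ℝ, ℝ) ∞ (logRatio f : η.B → ℝ) u :=
  (Real.contDiffAt_log.2 h0).contMDiffAt.comp u
    (ContMDiffAt.comp (g := f) (f := (B.proj : η.B → M)) u hf (contMDiffAt_proj u))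

theorem dform_logRatio {u : η.B} (hf : ContMDiffAt (𝓡 3) 𝓘(ℝ, ℝ) ∞ f u.proj)
    (h0 : f u.proj ≠ 0) (v : TangentSpace 𝓘(ℝ, E3 × ℝ) u) :
    dform (logRatio f : η.B → ℝ) u v =
      (f u.proj)⁻¹ * dform f u.proj (mfderiv 𝓘(ℝ, E3 × ℝ) (𝓡 3) (B.proj : η.B → M) u v) :=
  (dform_comp (f := fun w : η.B ↦ f w.proj) (g := Real.log) (Real.hasDerivAt_log h0)
    (ContMDiffAt.comp (g := f) (f := (B.proj : η.B → M)) u hf (contMDiffAt_proj u)) v).trans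
    (congrArg _ (dform_pullback (V' := E3) (g := f) (f := (B.proj : η.B → M)) hf
      (contMDiffAt_proj u) v))

/-- The last vector of the frame is vertical, and the logarithm of the ratio is pulled back from
$M$. -/
theorem frameDeriv_logRatio {u : η.B} (hf : ContMDiffAt (𝓡 3) 𝓘(ℝ, ℝ) ∞ f u.proj)
    (h0 : f u.proj ≠ 0) : frameDeriv (logRatio f : η.B → ℝ) 3 u = 0 := by
  have e := mfderiv_proj_eq_zero (u := u) (v := η.frame 3 u) fun i ↦ by
    rw [taut_frame]
    exact if_neg (by fin_cases i <;> decide)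
  rw [frameDeriv, dform_logRatio hf h0, e]
  exact (congrArg _ (ContinuousLinearMap.map_zero _)).trans (mul_zero _)

/-- This brings the derivatives of the logarithm along the frame of $B$ down to the differential of
`f` on $M$, where the wedge condition on coframes is stated. -/
theorem dform_ratio {u : η.B} (hf : ContMDiffAt (𝓡 3) 𝓘(ℝ, ℝ) ∞ f u.proj)
    (h0 : f u.proj ≠ 0) (y : TangentSpace (𝓡 3) u.proj) :
    dform f u.proj y = f u.proj * (frameDeriv (logRatio f : η.B → ℝ) 0 u * u.coframe y 0 +
      frameDeriv (logRatio f : η.B → ℝ) 1 u * u.coframe y 1 +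
      frameDeriv (logRatio f : η.B → ℝ) 2 u * u.coframe y 2) := by
  obtain ⟨v, rfl⟩ := u.exists_lift y
  have e := (dform_logRatio hf h0 v).symm.trans (dform_eq_frame _ u v)
  rw [frameDeriv_logRatio hf h0] at e
  rw [inv_mul_eq_iff_eq_mul₀ h0] at e
  refine e.trans (congrArg _ ?_)
  rw [zero_mul]
  simp only [add_zero]
  rfl

/-- The coframe `(m (u¹ - b u³), ε m (u² + a u³), ε m² u³)`. -/
def rescaledCoframe {x : M} (u : TangentSpace (𝓡 3) x →L[ℝ] (Fin 3 → ℝ)) (ε m a b : ℝ) :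
    TangentSpace (𝓡 3) x →L[ℝ] (Fin 3 → ℝ) :=
  let p := fun i ↦ (ContinuousLinearMap.proj (R := ℝ) (φ := fun _ : Fin 3 ↦ ℝ) i).comp u
  ContinuousLinearMap.pi
    ![m • (p 0 + (-b) • p 2), (ε * m) • (p 1 + a • p 2), (ε * m ^ 2) • p 2]

theorem rescaledCoframe_apply {x : M} (u : TangentSpace (𝓡 3) x →L[ℝ] (Fin 3 → ℝ)) (ε m a b : ℝ)
    (v : TangentSpace (𝓡 3) x) : rescaledCoframe u ε m a b v 0 = m * (u v 0 + -b * u v 2) ∧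
      rescaledCoframe u ε m a b v 1 = ε * m * (u v 1 + a * u v 2) ∧
      rescaledCoframe u ε m a b v 2 = ε * m ^ 2 * u v 2 := ⟨rfl, rfl, rfl⟩

/-- The shifts are chosen so that $(u^1-bu^3)\wedge(u^2+au^3)=u^1\wedge u^2+(au^1+bu^2)\wedge u^3$;
the extra term is $f^{-1}df\wedge\eta$, as in $d(f\eta)=df\wedge\eta+f\,d\eta$. -/
theorem isAdapted_rescaledCoframe
    (h : ∀ x ∈ η.domain ∩ η'.domain, η'.form x = f x • η.form x) (u : η.B)
    (hu : u.proj ∈ η'.domain) {ε m a b c : ℝ} (hε : ε ≠ 0) (hm : m ≠ 0)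
    (hf : f u.proj = ε * m ^ 2)
    (hd : ∀ y, dform f u.proj y =
      f u.proj * (a * u.coframe y 0 + b * u.coframe y 1 + c * u.coframe y 2)) :
    η'.IsAdapted u.proj (rescaledCoframe u.coframe ε m a b) := by
  have hx := u.adapted.mem_domain
  have ra := rescaledCoframe_apply u.coframe ε m a b
  have hs := (ratio_smoothAt h hx hu).2
  refine ⟨hu, ⟨?_, fun y ↦ ?_⟩, fun v ↦ ?_, fun v w ↦ ?_, fun v hv ↦ ?_, fun v hv ↦ ?_⟩
  · intro v w hvw
    have q0 := congrFun hvw 0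
    have q1 := congrFun hvw 1
    have q2 := congrFun hvw 2
    rw [(ra _).1, (ra _).1] at q0
    rw [(ra _).2.1, (ra _).2.1] at q1
    rw [(ra _).2.2, (ra _).2.2] at q2
    have q2 := mul_left_cancel₀ (mul_ne_zero hε (pow_ne_zero 2 hm)) q2
    have q1 := mul_left_cancel₀ (mul_ne_zero hε hm) q1
    have q0 := mul_left_cancel₀ hm q0
    rw [q2] at q0 q1
    refine u.adapted.bijective.1 ?_
    ext i
    fin_cases i
    exacts [add_right_cancel q0, add_right_cancel q1, q2]
  · obtain ⟨v, hv⟩ := u.adapted.bijective.2 ![y 0 / m + b * (y 2 / (ε * m ^ 2)),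
      y 1 / (ε * m) - a * (y 2 / (ε * m ^ 2)), y 2 / (ε * m ^ 2)]
    refine ⟨v, ?_⟩
    ext i
    fin_cases i
    · refine (ra v).1.trans ?_
      rw [hv]
      simp
      field_simp
    · refine (ra v).2.1.trans ?_
      rw [hv]
      simp
      field_simp
    · refine (ra v).2.2.trans ?_
      rw [hv]
      simp
      field_simp
  · rw [(ra v).2.2, u.adapted.third, h _ ⟨hx, hu⟩, hf]
    rfl
  · have ev : ∀ᶠ y in 𝓝 u.proj, η'.form y = OneForm.fmul f η.form y :=
      Filter.mem_of_superset ((η.isContact.isOpen.inter η'.isContact.isOpen).mem_nhds ⟨hx, hu⟩) h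
    rw [OneForm.d_congr ev, OneForm.d_fmul hs (form_smoothAt hx), u.adapted.wedge, (ra v).1,
      (ra v).2.1, (ra w).1, (ra w).2.1]
    change dform f u.proj v * η.form u.proj w - dform f u.proj w * η.form u.proj v + _ = _
    rw [hd, hd, ← u.adapted.third, ← u.adapted.third, hf]
    ring
  · rw [(ra v).1, u.adapted.apply_mem_L₂ hv]
    simp
  · rw [(ra v).2.1, u.adapted.apply_mem_L₁ hv]
    simp

end ContactForm

end PathGeometry
end
end PathGeom

/-! ### The rescaling map between the coframe bundles, and conformal invariance. -/

namespace PathGeom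

noncomputable section

set_option linter.unusedSectionVars false

namespace PathGeometry

variable {M : Type*} [TopologicalSpace M] [ChartedSpace E3 M] [IsManifold (𝓡 3) ∞ M]
  {P : PathGeometry M}

namespace ContactForm

variable {η η' : P.ContactForm} {f : M → ℝ}

variable (η η' f) in
/-- The part of `B` over which the factor `f` has the sign `ε`. -/
def signSet (ε : ℝ) : Set η.B := {u | u.proj ∈ η'.domain ∧ 0 < ε * f u.proj}

theorem isOpen_signSet (h : ∀ x ∈ η.domain ∩ η'.domain, η'.form x = f x • η.form x) (ε : ℝ) :
    IsOpen (signSet η η' f ε) := by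
  refine isOpen_iff_mem_nhds.2 fun u hu ↦ ?_
  have hf := (ratio_smoothAt h u.adapted.mem_domain hu.1).2
  have h1 := continuous_proj.continuousAt (η'.isContact.isOpen.mem_nhds hu.1)
  have h2 : ContinuousAt (fun w : η.B ↦ ε * f w.proj) u :=
    continuousAt_const.mul (ContinuousAt.comp (g := f) (f := (B.proj : η.B → M)) hf.continuousAt
      continuous_proj.continuousAt)
  filter_upwards [h1, h2.eventually (lt_mem_nhds hu.2)] with w h1 h2
  exact ⟨h1, h2⟩

/-- `Real.log` is the logarithm of the absolute value, so one formula serves both signs and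
$\varepsilon$ restores the sign. -/
theorem exp_logRatio {ε : ℝ} (hε : ε = 1 ∨ ε = -1) {u : η.B} (hu : u ∈ signSet η η' f ε) :
    f u.proj = ε * Real.exp (logRatio f u / 2) ^ 2 := by
  have h0 : f u.proj ≠ 0 := fun h0 ↦ by simpa [h0] using hu.2
  rw [← Real.exp_nat_mul, logRatio]
  have : ((2 : ℕ) : ℝ) * (Real.log (f u.proj) / 2) = Real.log (f u.proj) := by
    push_cast
    ring
  rw [this, Real.exp_log_eq_abs h0]
  have h2 := hu.2
  rcases hε with rfl | rfl
  · rw [abs_of_pos (by linarith), one_mul]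
  · rw [abs_of_neg (by linarith)]
    ring

/-- The coframe adapted to `f η` that corresponds to `u`. -/
def B.rescaledCoframe (f : M → ℝ) (ε : ℝ) (u : η.B) :
    TangentSpace (𝓡 3) u.proj →L[ℝ] (Fin 3 → ℝ) :=
  ContactForm.rescaledCoframe u.coframe ε (Real.exp (logRatio f u / 2))
    (frameDeriv (logRatio f) 0 u) (frameDeriv (logRatio f) 1 u)

theorem B.isAdapted_rescaledCoframe
    (h : ∀ x ∈ η.domain ∩ η'.domain, η'.form x = f x • η.form x) {ε : ℝ} (hε : ε = 1 ∨ ε = -1)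
    {u : η.B} (hu : u ∈ signSet η η' f ε) : η'.IsAdapted u.proj (u.rescaledCoframe f ε) := by
  have hf := ratio_smoothAt h u.adapted.mem_domain hu.1
  exact ContactForm.isAdapted_rescaledCoframe h u hu.1
    (by rcases hε with rfl | rfl <;> norm_num) (Real.exp_ne_zero _) (exp_logRatio hε hu)
    (dform_ratio hf.2 hf.1)

/-- `ψ` is, over the set where the factor `f` has sign `ε`, the isomorphism of the bundle of
coframes adapted to `η` with that of coframes adapted to `η' = f η`. -/
def IsRescaling (f : M → ℝ) (ε : ℝ) (ψ : η.B → η'.B) : Prop :=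
  ∀ u ∈ signSet η η' f ε, ∃ ha, ψ u = ⟨⟨u.proj, u.rescaledCoframe f ε⟩, ha⟩

theorem exists_isRescaling (h : ∀ x ∈ η.domain ∩ η'.domain, η'.form x = f x • η.form x) {ε : ℝ}
    (hε : ε = 1 ∨ ε = -1) (hne : (signSet η η' f ε).Nonempty) :
    ∃ ψ : η.B → η'.B, IsRescaling f ε ψ := by
  classical
  obtain ⟨u₀, h₀⟩ := hne
  -- The value at a fixed point of the set serves as a default elsewhere; only the germ on the open
  -- set matters.
  refine ⟨fun u ↦ if hu : u ∈ signSet η η' f ε then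
    ⟨⟨u.proj, u.rescaledCoframe f ε⟩, B.isAdapted_rescaledCoframe h hε hu⟩ else
    ⟨⟨u₀.proj, u₀.rescaledCoframe f ε⟩, B.isAdapted_rescaledCoframe h hε h₀⟩,
    fun u hu ↦ ⟨B.isAdapted_rescaledCoframe h hε hu, dif_pos hu⟩⟩

namespace IsRescaling

variable {ε : ℝ} {ψ : η.B → η'.B}

theorem proj_eq (hψ : IsRescaling f ε ψ) {u : η.B} (hu : u ∈ signSet η η' f ε) :
    (ψ u).proj = u.proj := by
  obtain ⟨ha, e⟩ := hψ u hu
  rw [e]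
  rfl

theorem coframe_eq (hψ : IsRescaling f ε ψ) {u : η.B} (hu : u ∈ signSet η η' f ε) (y : E3) :
    (show Fin 3 → ℝ from (ψ u).coframe y) = u.rescaledCoframe f ε y := by
  obtain ⟨ha, e⟩ := hψ u hu
  have key : ∀ w : η'.B, w = ⟨⟨u.proj, u.rescaledCoframe f ε⟩, ha⟩ →
      (show Fin 3 → ℝ from w.coframe y) = u.rescaledCoframe f ε y := by
    rintro w rfl
    rfl
  exact key _ e

theorem fiberCoord_eq (hψ : IsRescaling f ε ψ) {u : η.B} (hu : u ∈ signSet η η' f ε) {X : VField M}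
    (hX : X u.proj ∈ P.L₁ u.proj) :
    fiberCoord X (ψ u) = Real.exp (logRatio f u / 2) * fiberCoord X u := by
  obtain ⟨ha, e⟩ := hψ u hu
  rw [e]
  refine (rescaledCoframe_apply u.coframe _ _ _ _ (X u.proj)).1.trans ?_
  rw [u.adapted.apply_mem_L₁ hX]
  simp [fiberCoord]

theorem contMDiffAt (h : ∀ x ∈ η.domain ∩ η'.domain, η'.form x = f x • η.form x)
    (hψ : IsRescaling f ε ψ) {u : η.B} (hu : u ∈ signSet η η' f ε) :
    ContMDiffAt 𝓘(ℝ, E3 × ℝ) 𝓘(ℝ, E3 × ℝ) ∞ ψ u := by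
  obtain ⟨X, W, hX, hW⟩ := u.exists_frame
  have hf := ratio_smoothAt h u.adapted.mem_domain hu.1
  have ev := (isOpen_signSet h ε).mem_nhds hu
  refine contMDiffAt_B hX (by rwa [hψ.proj_eq hu]) ?_ ?_
  · refine (contMDiffAt_proj u).congr_of_eventuallyEq ?_
    filter_upwards [ev] with w hw
    exact hψ.proj_eq hw
  · have s := contMDiffAt_exp_half (contMDiffAt_logRatio hf.2 hf.1) 1
    refine (s.mul (contMDiffAt_fiberCoord hX hW)).congr_of_eventuallyEq ?_
    filter_upwards [ev, continuous_proj.continuousAt (hX.isOpen.mem_nhds hW)] with w hw hwW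
    refine (hψ.fiberCoord_eq hw (hX.mem hwW)).trans ?_
    simp

theorem taut_pullback (h : ∀ x ∈ η.domain ∩ η'.domain, η'.form x = f x • η.form x)
    (hψ : IsRescaling f ε ψ) {u : η.B} (hu : u ∈ signSet η η' f ε) (i : Fin 3) :
    OneForm.pullback ψ (η'.taut i) u = rescaledTaut (logRatio f) ε i u := by
  have ev : (B.proj : η'.B → M) ∘ ψ =ᶠ[𝓝 u] (B.proj : η.B → M) := by
    filter_upwards [(isOpen_signSet h ε).mem_nhds hu] with w hw
    exact hψ.proj_eq hw
  have e1 := ev.mfderiv_eq (I := 𝓘(ℝ, E3 × ℝ)) (I' := 𝓡 3)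
  rw [mfderiv_comp u ((contMDiffAt_proj _).mdifferentiableAt (by simp))
    ((hψ.contMDiffAt h hu).mdifferentiableAt (by simp))] at e1
  ext v
  have e2 := DFunLike.congr_fun (F := (E3 × ℝ) →L[ℝ] E3) e1 v
  have e3 : OneForm.pullback ψ (η'.taut i) u v = u.rescaledCoframe f ε
      (mfderiv 𝓘(ℝ, E3 × ℝ) (𝓡 3) (B.proj : η.B → M) u v) i :=
    (congrFun (hψ.coframe_eq hu _) i).trans
      (congrArg (fun y : E3 ↦ (show Fin 3 → ℝ from u.rescaledCoframe f ε y) i) e2)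
  rw [e3]
  fin_cases i <;> rfl

/-- The pull-back inherits the first two normalized equations from $\eta'$, and `rescaledConn`
satisfies the same ones by computation; together they determine the form. -/
theorem conn_pullback (h : ∀ x ∈ η.domain ∩ η'.domain, η'.form x = f x • η.form x)
    (hε : ε = 1 ∨ ε = -1) (hψ : IsRescaling f ε ψ) {u : η.B} (hu : u ∈ signSet η η' f ε) :
    OneForm.pullback ψ η'.conn u = rescaledConn (logRatio f) u := by
  have hO := isOpen_signSet h ε
  have hf := fun w (hw : w ∈ signSet η η' f ε) ↦ ratio_smoothAt h w.adapted.mem_domain hw.1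
  have hl := fun w hw ↦ contMDiffAt_logRatio (hf w hw).2 (hf w hw).1
  have h3 := fun w hw ↦ frameDeriv_logRatio (hf w hw).2 (hf w hw).1
  have ht := fun i ↦ Filter.mem_of_superset (hO.mem_nhds hu) fun w hw ↦ taut_pullback h hψ hw i
  have hd : ∀ i v w, (rescaledTaut (logRatio f) ε i).d u v w = (η'.taut i).d (ψ u)
      (mfderiv 𝓘(ℝ, E3 × ℝ) 𝓘(ℝ, E3 × ℝ) ψ u v) (mfderiv 𝓘(ℝ, E3 × ℝ) 𝓘(ℝ, E3 × ℝ) ψ u w) :=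
    fun i v w ↦ (OneForm.d_congr (ht i) v w).symm.trans
      (OneForm.d_pullback (hψ.contMDiffAt h hu) (taut_smoothAt i _) v w)
  have hv : ∀ i v, η'.taut i (ψ u) (mfderiv 𝓘(ℝ, E3 × ℝ) 𝓘(ℝ, E3 × ℝ) ψ u v) =
      rescaledTaut (logRatio f) ε i u v := fun i v ↦
    DFunLike.congr_fun (taut_pullback h hψ hu i) v
  obtain ⟨⟨c, h0⟩, c', h1⟩ := conn_normalizedAt (ψ u)
  obtain ⟨k, k0⟩ := d_rescaledTaut_zero hO hl h3 hu hε
  obtain ⟨k', k1⟩ := d_rescaledTaut_one hO hl h3 hu hε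
  refine eq_rescaledConn hε (T0 := fun v w ↦ (rescaledTaut (logRatio f) ε 0).d u v w)
    (T1 := fun v w ↦ (rescaledTaut (logRatio f) ε 1).d u v w) (c0 := c) (c1 := c') ?_ k0 ?_ k1
  · intro v w
    simp only [hd, h0, OneForm.wedge, hv]
    rfl
  · intro v w
    simp only [hd, h1, OneForm.wedge, hv]
    rfl

/-- The equation for $d\alpha'$ pulls back to an equation for `rescaledConn` with curvature value
$K'\circ\psi$, which is exactly what `rescaled_metric` requires. -/
theorem metric_pullback (h : ∀ x ∈ η.domain ∩ η'.domain, η'.form x = f x • η.form x)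
    (hε : ε = 1 ∨ ε = -1) (hψ : IsRescaling f ε ψ) {u : η.B} (hu : u ∈ signSet η η' f ε)
    (v w : TangentSpace 𝓘(ℝ, E3 × ℝ) u) :
    η'.metric (ψ u) (mfderiv 𝓘(ℝ, E3 × ℝ) 𝓘(ℝ, E3 × ℝ) ψ u v)
      (mfderiv 𝓘(ℝ, E3 × ℝ) 𝓘(ℝ, E3 × ℝ) ψ u w) = f u.proj * η.metric u v w := by
  have hO := isOpen_signSet h ε
  have hf := fun w (hw : w ∈ signSet η η' f ε) ↦ ratio_smoothAt h w.adapted.mem_domain hw.1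
  have hl := fun w hw ↦ contMDiffAt_logRatio (hf w hw).2 (hf w hw).1
  have h3 := fun w hw ↦ frameDeriv_logRatio (hf w hw).2 (hf w hw).1
  have hc := Filter.mem_of_superset (hO.mem_nhds hu) fun w hw ↦ conn_pullback h hε hψ hw
  have hd : ∀ v w, (rescaledConn (logRatio f)).d u v w = η'.conn.d (ψ u)
      (mfderiv 𝓘(ℝ, E3 × ℝ) 𝓘(ℝ, E3 × ℝ) ψ u v) (mfderiv 𝓘(ℝ, E3 × ℝ) 𝓘(ℝ, E3 × ℝ) ψ u w) :=
    fun v w ↦ (OneForm.d_congr hc v w).symm.trans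
      (OneForm.d_pullback (hψ.contMDiffAt h hu) (conn_smoothAt _) v w)
  have hv : ∀ i v, η'.taut i (ψ u) (mfderiv 𝓘(ℝ, E3 × ℝ) 𝓘(ℝ, E3 × ℝ) ψ u v) =
      rescaledTaut (logRatio f) ε i u v := fun i v ↦
    DFunLike.congr_fun (taut_pullback h hψ hu i) v
  have hcv : ∀ v, η'.conn (ψ u) (mfderiv 𝓘(ℝ, E3 × ℝ) 𝓘(ℝ, E3 × ℝ) ψ u v) =
      rescaledConn (logRatio f) u v := fun v ↦
    DFunLike.congr_fun (conn_pullback h hε hψ hu) v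
  obtain ⟨b₁, b₂, hK⟩ := (localStructure_conn (ψ u)).d_conn.self_of_nhds
  rw [exp_logRatio hε hu, ← rescaled_metric (K := η'.curv (ψ u)) (b₁ := b₁) (b₂ := b₂) hO hl h3 hu
    hε (fun v w ↦ by simp only [hd, hK, OneForm.wedge, hv]) v w]
  rw [metric_apply]
  simp only [sigma_apply, hv, hcv]

/-- The shifts by $u^3$ vanish on $D$, so there $u^1$ and $u^2$ are multiplied by the same positive
factor. -/
theorem h_eq (h1 : IsRescaling f 1 ψ) {u : η.B} (hu : u ∈ signSet η η' f 1) :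
    η'.h (ψ u) = η.h u := by
  obtain ⟨ha, e⟩ := h1 u hu
  rw [e]
  have r := rescaledCoframe_apply u.coframe 1 (Real.exp (logRatio f u / 2))
    (frameDeriv (logRatio f) 0 u) (frameDeriv (logRatio f) 1 u)
  have r1 : u.rescaledCoframe f 1 u.e₁ 0 = Real.exp (logRatio f u / 2) := by
    refine (r u.e₁).1.trans ?_
    simp [u.coframe_e₁]
  have r2 : u.rescaledCoframe f 1 u.e₂ 1 = Real.exp (logRatio f u / 2) := by
    refine (r u.e₂).2.1.trans ?_
    simp [u.coframe_e₂]
  exact h_eq_ray (η := η') ⟨⟨u.proj, u.rescaledCoframe f 1⟩, ha⟩ u.e₁_mem u.e₂_mem u.e₁_ne_zero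
    u.e₂_ne_zero (r1.symm ▸ Real.exp_pos _) (r2.trans r1.symm)

/-- For a negative factor $u^2$ changes sign relative to $u^1$ on $D$, which replaces $e_1+e_2$ by
$e_1-e_2$ up to a positive multiple. -/
theorem h_eq_J (h1 : IsRescaling f (-1) ψ) {u : η.B} (hu : u ∈ signSet η η' f (-1)) :
    η'.h (ψ u) = (η.h u).J := by
  obtain ⟨ha, e⟩ := h1 u hu
  rw [e]
  have r := rescaledCoframe_apply u.coframe (-1) (Real.exp (logRatio f u / 2))
    (frameDeriv (logRatio f) 0 u) (frameDeriv (logRatio f) 1 u)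
  have r1 : u.rescaledCoframe f (-1) (((1 : ℝˣ) : ℝ) • u.e₁) 0 = Real.exp (logRatio f u / 2) := by
    refine (r _).1.trans ?_
    simp [u.coframe_e₁]
  have r2 : u.rescaledCoframe f (-1) (((-1 : ℝˣ) : ℝ) • u.e₂) 1 =
      Real.exp (logRatio f u / 2) := by
    refine (r _).2.1.trans ?_
    simp [u.coframe_e₂]
  exact h_eq_ray (η := η') ⟨⟨u.proj, u.rescaledCoframe f (-1)⟩, ha⟩
    (Submodule.smul_mem _ _ u.e₁_mem) (Submodule.smul_mem _ _ u.e₂_mem)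
    (smul_ne_zero (Units.ne_zero _) u.e₁_ne_zero) (smul_ne_zero (Units.ne_zero _) u.e₂_ne_zero)
    (r1.symm ▸ Real.exp_pos _) (r2.trans r1.symm)

end IsRescaling

/-- Rescaling the contact form rescales the induced metric by the same factor. -/
theorem IsInducedMetric.eq_smul {G G' : BilinField (E3 × ℝ) P.SDStar}
    (h : ∀ x ∈ η.domain ∩ η'.domain, η'.form x = f x • η.form x) (hG : η.IsInducedMetric G)
    (hG' : η'.IsInducedMetric G') {p : P.SDStar} (hp : p ∈ η.SDOver) (hp' : p ∈ η'.SDOver) :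
    G' p = f p.proj • G p := by
  obtain ⟨g1, g2⟩ := isInducedMetric_iff.1 hG
  obtain ⟨g1', g2'⟩ := isInducedMetric_iff.1 hG'
  have d1' := (isBundleIso_h (η := η')).isLocalDiffeomorph.contMDiff
  have d2' := (isBundleIso_J_h (η := η')).isLocalDiffeomorph.contMDiff
  have b1 := fun u ↦ (bijective_mfderiv (isBundleIso_h (η := η)).isLocalDiffeomorph u).surjective
  have b2 := fun u ↦ (bijective_mfderiv (isBundleIso_J_h (η := η)).isLocalDiffeomorph u).surjective
  have hfp := (ratio_smoothAt h hp hp').1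
  obtain ⟨u, hu⟩ := exists_of_mem_SDOver hp
  have hpu : p.proj = u.proj := by
    rcases hu with rfl | rfl
    · rfl
    · exact SDStar.proj_J _
  obtain ⟨ε, hε, hs⟩ : ∃ ε : ℝ, (ε = 1 ∨ ε = -1) ∧ u ∈ signSet η η' f ε := by
    have hm : u.proj ∈ η'.domain := hpu ▸ hp'
    rw [hpu] at hfp
    rcases lt_or_gt_of_ne hfp with h0 | h0
    · exact ⟨-1, Or.inr rfl, hm, by linarith⟩
    · exact ⟨1, Or.inl rfl, hm, by linarith⟩
  obtain ⟨ψ, hψ⟩ := exists_isRescaling h hε ⟨u, hs⟩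
  have ev := (isOpen_signSet h ε).mem_nhds hs
  have dψ := (hψ.contMDiffAt h hs).mdifferentiableAt (by simp)
  have hm := hψ.metric_pullback h hε hs
  rw [hpu]
  -- For positive `f` the maps $h$ and $J\circ h$ correspond to their counterparts; for negative `f`
  -- they are exchanged.
  rcases hε with rfl | rfl <;> rcases hu with rfl | rfl
  · exact g1.eq_smul g1' (Filter.mem_of_superset ev fun w hw ↦ (hψ.h_eq hw).symm)
      (d1'.mdifferentiable (by simp) _) dψ (b1 u) hm
  · exact g2.eq_smul g2' (Filter.mem_of_superset ev fun w hw ↦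
      congrArg SDStar.J (hψ.h_eq hw).symm) (d2'.mdifferentiable (by simp) _) dψ (b2 u) hm
  · exact g1.eq_smul g2' (Filter.mem_of_superset ev fun w hw ↦
      ((congrArg SDStar.J (hψ.h_eq_J hw)).trans (SDStar.J_J _)).symm)
      (d2'.mdifferentiable (by simp) _) dψ (b1 u) hm
  · exact g2.eq_smul g1' (Filter.mem_of_superset ev fun w hw ↦ (hψ.h_eq_J hw).symm)
      (d1'.mdifferentiable (by simp) _) dψ (b2 u) hm

end ContactForm

end PathGeometry
end
end PathGeom

/-! ### The conformal class, and the theorem. -/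

namespace PathGeom

noncomputable section

set_option linter.unusedSectionVars false

namespace PathGeometry

variable {M : Type*} [TopologicalSpace M] [ChartedSpace E3 M] [IsManifold (𝓡 3) ∞ M]
  {P : PathGeometry M}

variable (P) in
theorem exists_contactForm (x : M) : ∃ η : P.ContactForm, x ∈ η.domain := by
  obtain ⟨θ, U, hx, h⟩ := P.contact x
  exact ⟨⟨U, θ, h⟩, hx⟩

namespace ContactForm

variable {η η' : P.ContactForm}

/-- Two contact forms of a path geometry are proportional. -/
theorem exists_ratio (η η' : P.ContactForm) :
    ∃ f : M → ℝ, ∀ x ∈ η.domain ∩ η'.domain, η'.form x = f x • η.form x := by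
  have key : ∀ x, ∃ c : ℝ, x ∈ η.domain ∩ η'.domain → η'.form x = c • η.form x := by
    intro x
    by_cases hx : x ∈ η.domain ∩ η'.domain
    · have hk : (η.form x).toLinearMap.ker ≤ (η'.form x).toLinearMap.ker := by
        rw [η.isContact.ker_eq x hx.1, η'.isContact.ker_eq x hx.2]
      have hm := mem_span_of_iInf_ker_le_ker (ι := Unit) (L := fun _ ↦ (η.form x).toLinearMap)
        (iInf_const.trans_le hk)
      rw [Set.range_const] at hm
      obtain ⟨c, hc⟩ := Submodule.mem_span_singleton.1 hm
      exact ⟨c, fun _ ↦ ContinuousLinearMap.coe_injective hc.symm⟩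
    · exact ⟨0, fun h ↦ (hx h).elim⟩
  choose f hf using key
  exact ⟨f, hf⟩

theorem IsInducedMetric.span_eq {G G' : BilinField (E3 × ℝ) P.SDStar} (hG : η.IsInducedMetric G)
    (hG' : η'.IsInducedMetric G') {p : P.SDStar} (hp : p ∈ η.SDOver) (hp' : p ∈ η'.SDOver) :
    Submodule.span ℝ {G' p} = Submodule.span ℝ {G p} := by
  obtain ⟨f, h⟩ := exists_ratio η η'
  rw [hG.eq_smul h hG' hp hp']
  exact Submodule.span_singleton_smul_eq (ratio_smoothAt h hp hp').1.isUnit _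

end ContactForm

variable (P) in
/-- The induced metrics define a conformal class on `SD*`. -/
theorem existsUnique_conformalClass :
    ∃! C : (∀ p : P.SDStar, Submodule ℝ (TangentSpace 𝓘(ℝ, E3 × ℝ) p →L[ℝ]
        TangentSpace 𝓘(ℝ, E3 × ℝ) p →L[ℝ] ℝ)),
      IsConformalClass22 C ∧
      ∀ (η : P.ContactForm) (G : BilinField (E3 × ℝ) P.SDStar),
        η.IsInducedMetric G → ∀ p ∈ η.SDOver, C p = Submodule.span ℝ {G p} := by
  -- A contact form is chosen around each point separately; `hC` shows that the resulting lines do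
  -- not depend on the choices, which yields both local smoothness and uniqueness.
  choose η hη using fun p : P.SDStar ↦ P.exists_contactForm p.proj
  choose G hG using fun p : P.SDStar ↦ (η p).exists_inducedMetric
  have hC : ∀ (η' : P.ContactForm) (G' : BilinField (E3 × ℝ) P.SDStar),
      η'.IsInducedMetric G' → ∀ p ∈ η'.SDOver,
      Submodule.span ℝ {G p p} = Submodule.span ℝ {G' p} := fun η' G' h p hp ↦
    h.span_eq (hG p).1 hp (hη p)
  refine ⟨fun p ↦ Submodule.span ℝ {G p p}, ⟨fun p ↦ ⟨(η p).SDOver, G p, ContactForm.isOpen_SDOver,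
    hη p, (hG p).1.isMetric22On, hC _ _ (hG p).1⟩, hC⟩, fun C' h' ↦ ?_⟩
  funext p
  exact h'.2 _ _ (hG p).1 p (hη p)

end PathGeometry
end
end PathGeom

theorem mainTheorem2 {M : Type*} [TopologicalSpace M] [ChartedSpace E3 M]
    [IsManifold (𝓡 3) ∞ M] (P : PathGeometry M) :
    -- the construction, for each contact form `η³` on an open subset of `M`
    (∀ η : P.ContactForm,
      η.IsReduction ∧
      (∃! α : OneForm (E3 × ℝ) η.B, η.IsNormalizedConnection α) ∧
      (∀ α : OneForm (E3 × ℝ) η.B, η.IsNormalizedConnection α →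
        (∃! K : η.B → ℝ, η.IsCurvature α K) ∧
        ∀ K : η.B → ℝ, η.IsCurvature α K →
          (η.feffermanMetric α K).IsMetric22On Set.univ) ∧
      (η.SDPos ∪ η.SDNeg = η.SDOver ∧ Disjoint η.SDPos η.SDNeg) ∧
      η.IsBundleIso η.h η.SDPos ∧
      η.IsBundleIso (fun u : η.B ↦ (η.h u).J) η.SDNeg ∧
      ∃ G : BilinField (E3 × ℝ) P.SDStar,
        η.IsInducedMetric G ∧ G.IsMetric22On η.SDOver ∧
        ∀ G', η.IsInducedMetric G' → ∀ p ∈ η.SDOver, G' p = G p) ∧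
    -- a contact form can be multiplied by any smooth non-vanishing function
    (∀ (η : P.ContactForm) (f : M → ℝ), ContMDiffOn (𝓡 3) 𝓘(ℝ, ℝ) ∞ f η.domain →
      (∀ x ∈ η.domain, f x ≠ 0) →
      ∃ η' : P.ContactForm, η'.domain = η.domain ∧
        ∀ x ∈ η.domain, η'.form x = f x • η.form x) ∧
    -- rescaling the contact form rescales the induced metric by the same factor
    (∀ (η η' : P.ContactForm) (f : M → ℝ),
      (∀ x ∈ η.domain ∩ η'.domain, η'.form x = f x • η.form x) →
      ∀ G G' : BilinField (E3 × ℝ) P.SDStar,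
        η.IsInducedMetric G → η'.IsInducedMetric G' →
        ∀ p ∈ η.SDOver ∩ η'.SDOver, G' p = f p.proj • G p) ∧
    -- the induced metrics define one conformal class on the whole of `SD*`
    ∃! C : (∀ p : P.SDStar, Submodule ℝ (TangentSpace 𝓘(ℝ, E3 × ℝ) p →L[ℝ]
        TangentSpace 𝓘(ℝ, E3 × ℝ) p →L[ℝ] ℝ)),
      IsConformalClass22 C ∧
      ∀ (η : P.ContactForm) (G : BilinField (E3 × ℝ) P.SDStar),
        η.IsInducedMetric G → ∀ p ∈ η.SDOver, C p = Submodule.span ℝ {G p} := by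
  refine ⟨fun η ↦ ⟨PathGeometry.ContactForm.isReduction, ?_, fun α hα ↦ ?_,
      ⟨PathGeometry.ContactForm.SDPos_union_SDNeg, PathGeometry.ContactForm.disjoint_SDPos_SDNeg⟩,
      PathGeometry.ContactForm.isBundleIso_h, PathGeometry.ContactForm.isBundleIso_J_h, ?_⟩,
    fun η f hf hf0 ↦ PathGeometry.ContactForm.exists_rescaled η hf hf0,
    fun η η' f h G G' hG hG' p hp ↦ hG.eq_smul h hG' hp.1 hp.2, P.existsUnique_conformalClass⟩
  · exact ⟨η.conn, PathGeometry.ContactForm.isNormalizedConnection_conn, fun α hα ↦ hα.eq_conn⟩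
  · obtain rfl := hα.eq_conn
    refine ⟨⟨η.curv, PathGeometry.ContactForm.isCurvature_curv, fun K hK ↦ hK.eq_curv⟩,
      fun K hK ↦ ?_⟩
    obtain rfl := hK.eq_curv
    exact PathGeometry.ContactForm.metric_isMetric22On
  · obtain ⟨G, hG, -⟩ := PathGeometry.ContactForm.exists_inducedMetric (η := η)
    exact ⟨G, hG, hG.isMetric22On, fun G' hG' p hp ↦ hG'.eq hG hp⟩
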